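/- **Setting.** Let $d\in\{2,3\}$, $m\ge 1$, let $\rho^f,\rho^s,\nu^f>0$, and let $W:\mathbb R^{d\times d}\to\mathbb R$ be a differentiable strain energy density with stress $\sigma^s(\varphi)=\partial W/\partial F\,(\nabla\varphi)$. Put $\sigma^f(u,p)=\rho^f\nu^f(\nabla u+\nabla u^\top)-pI$, $(\nabla\cdot A)_i=\sum_j\partial_jA_{ij}$, $A:B=\operatorname{tr}(A^\top B)$. *Meshes.* $\hat T$ is the reference simplex, $\hat\phi_p$ are its $\mathbb P_m$ Lagrange basis functions, and a mesh of order $m$ has cells $T_j=\Psi_j(\hat T)$, $\Psi_j=\sum_p\hat\phi_p\,a_{i(j,p)}$, where $a_i$ are its grid points and $i(j,p)$ is the global index of the local grid point $p$ of cell $j$. It is admissible if $\det D\Psi_j\neq0$ on $\hat T$, all $\Psi_j$ are injective, different cells meet exactly in their common face, and the topological boundary of the meshed domain is the union of the designated boundary faces. The solid domain $\Omega^s$ has a fixed admissible mesh with boundary $\Gamma\cup\Sigma_3\cup\Sigma_4$. The fluid domain $\Omega_n$ at $t^n=n\Delta t$ has a mesh with fixed connectivity and grid points $a_i^n$; its boundary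 consists of the interface, whose faces correspond to those of $\Gamma$, and of $\Sigma_1\cup\Sigma_2$. The grid points on $\Sigma_1\cup\Sigma_2$ do not move. *Mesh motion.* The position of the solid starts from a finite element function $\varphi^0$, and $\varphi^{n}=\varphi^{n-1}+\Delta t\,v^{n-1}$. If $z_i\in\Gamma$ is the solid grid point corresponding to the fluid grid point $a_i^n$ on the interface, then $a_i^n=\varphi^n(z_i)$. For $t\in[t^{n-1},t^n]$ and $x\in\Omega_n$ let, on the cell $j$, $\Phi^n(x,t)=\frac{t-t^{n-1}}{\Delta t}x+\frac{t^n-t}{\Delta t}\Psi_j^{n-1}\circ(\Psi_j^n)^{-1}(x)$, let $\Omega_{(t)}=\Phi^n(\Omega_n,t)$, and let $w^n=\partial_t\Phi^n$ be the mesh velocity. For $f$ on $\Omega_n$ put $\bar f(\cdot,t)=f\circ\Phi^n(\cdot,t)^{-1}$, and put $\bar u^{n-1}(\cdot,t)=\sum_i u^{n-1}(a_i^{n-1})\,\bar\phi_i^{n}(\cdot,t)$ with the nodal basis $\phi_i^n$ on $\Omega_n$. The *collision-free condition* for $N$ steps is that for every $n\le N$ and $t\in[t^{n-1},t^n]$ the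 grid points $\frac{t-t^{n-1}}{\Delta t}a_i^n+\frac{t^n-t}{\Delta t}a_i^{n-1}$ form an admissible mesh with boundary faces those of the interface, $\Sigma_1$ and $\Sigma_2$ (so the interface meets neither itself nor the fixed boundaries, and no cell degenerates). *Scheme.* $V_n$ is the set of continuous isoparametric $\mathbb P_m/\mathbb P_{m-1}/\mathbb P_m$ triples $(u;p;v)$ on $\Omega_n,\Omega_n,\Omega^s$ with $u(\varphi^n(z_i))=v(z_i)$ at all grid points $z_i$ of $\Gamma$. A solution for $N$ steps is a sequence $(u^n;p^n;v^n)\in V_n$, $0\le n\le N$, such that for $1\le n\le N$: $u^n=u_b(t^n)$ on $\Sigma_1$, $v^n=\partial_t\varphi_b(t^n)$ on $\Sigma_3$, and for all $(\phi;q;\psi)\in V_n$ with $\phi|_{\Sigma_1}=0$, $\psi|_{\Sigma_3}=0$, $$\begin{aligned}&\tfrac{\rho^f}{\Delta t}\big(\langle u^n,\phi\rangle_{\Omega_n}-\langle u^{n-1},\bar\phi(\cdot,t^{n-1})\rangle_{\Omega_{n-1}}\big)+\rho^f\,Q\big[\langle\nabla\cdot(\bar u^n\otimes(\bar u^{n-1}-\bar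 w^n)),\bar\phi\rangle_{\Omega_{(t)}}-\langle\tfrac12(\nabla\cdot\bar u^{n-1})\bar u^n,\bar\phi\rangle_{\Omega_{(t)}}\big]\\&+\langle\sigma^f(u^n,p^n),\nabla\phi\rangle_{\Omega_n}-\langle\nabla\cdot u^n,q\rangle_{\Omega_n}+\langle\rho^s\tfrac{v^n-v^{n-1}}{\Delta t},\psi\rangle_{\Omega^s}+\langle\sigma^s(\varphi^n+\Delta t\,v^n),\nabla\psi\rangle_{\Omega^s}\\&=\langle\rho^fg^f,\phi\rangle_{\Omega_n}+\langle\sigma^f_b,\phi\rangle_{\Sigma_2}+\langle\rho^sg^s,\psi\rangle_{\Omega^s}+\langle\sigma^s_b,\psi\rangle_{\Sigma_4}\end{aligned}$$ with data at $t^n$. Here $Q[\cdot]$ is the value at the midpoint $t=t^{n-1/2}$ if $d=2$, and the mean of the values at the two Gauss points $t=t^n-(\frac12\pm\frac1{2\sqrt3})\Delta t$ if $d=3$. The data $g^f$, $g^s$, $\sigma_b^s$ at $t^n$, $1\le n\le N$, are assumed square integrable on $\Omega_n$, $\Omega^s$, $\Sigma_4$. **Theorem.** Assume that $W$ is convex,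 $u_b=0$, $\Sigma_2=\emptyset$ and $\partial_t\varphi_b=0$ on $\Sigma_3$. Let $\Pi_s(v;\varphi)=\frac{\rho^s}2\|v\|_{\Omega^s}^2+\int_{\Omega^s}W(\nabla\varphi)$, $P_n=\langle\rho^fg^f,u^n\rangle_{\Omega_n}+\langle\rho^sg^s,v^n\rangle_{\Omega^s}+\langle\sigma_b^s,v^n\rangle_{\Sigma_4}$ and $$\mathcal Q_n=2\Pi_s(v^n;\varphi^n+\Delta t\,v^n)+\rho^f\|u^n\|_{\Omega_n}^2+\sum_{\ell=1}^n\rho^f\nu^f\|\nabla u^\ell+(\nabla u^\ell)^\top\|_{\Omega_\ell}^2\Delta t .$$ (1) For every $\Delta t>0$ and every solution for $N$ steps satisfying the collision-free condition, for $1\le n\le N$, $$\frac{\rho^f}{2\Delta t}\big(\|u^n\|_{\Omega_n}^2-\|u^{n-1}\|_{\Omega_{n-1}}^2\big)+\frac{\rho^f\nu^f}2\|\nabla u^n+(\nabla u^n)^\top\|_{\Omega_n}^2+\frac1{\Delta t}\big(\Pi_s(v^n;\varphi^n+\Delta t\,v^n)-\Pi_s(v^{n-1};\varphi^{n-1}+\Delta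 t\,v^{n-1})\big)\le P_n ,$$ and $\mathcal Q_n\le\mathcal Q_0+2\Delta t\sum_{\ell=1}^nP_\ell$ for $0\le n\le N$ (so $\mathcal Q_n\le\mathcal Q_0$ for all $n$ if the forces and the solid traction vanish). (2) $\mathcal Q_n$ is bounded uniformly in $n$, independently of the fluid mesh velocity: for all $\varphi^0$, $v^0$, $T$, $K$, $G$ there is a constant $C$, which depends only on these, on the parameters and data of the problem, on the solid mesh, on the connectivity of the fluid mesh and its designated boundary faces, such that $|\mathcal Q_n|\le C$ for $1\le n\le N$, for every $\Delta t>0$, every $N$ with $N\Delta t\le T$, all positions of the fluid meshes, and every collision-free solution for $N$ steps that starts from $\varphi^0,v^0$ with $\rho^f\|u^0\|_{\Omega_0}^2\le K$ and for which, at the times $t^1,\dots,t^N$, the $L^2$ norms of $g^f$, $g^s$, $\sigma_b^s$ on $\Omega_n$, $\Omega^s$, $\Sigma_4$ are at most $G$. -/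

import Mathlib

open MeasureTheory Set
open scoped NNReal ENNReal

namespace FSI

noncomputable section

/-- Euclidean space `ℝ^d`. -/
abbrev E (d : ℕ) : Type := EuclideanSpace ℝ (Fin d)

/-! ### Tensor calculus -/

/-- The standard basis vector `e_i`. -/
def e {d : ℕ} (i : Fin d) : E d := EuclideanSpace.single i (1 : ℝ)

/-- `A : B = tr (Aᵀ B)`. -/
def frob {d : ℕ} (A B : E d →L[ℝ] E d) : ℝ := ∑ i, inner ℝ (A (e i)) (B (e i))

/-- `∇u`, with entries `(∇u)_{ij} = ∂_j u_i`. -/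
def grad {d : ℕ} (u : E d → E d) (x : E d) : E d →L[ℝ] E d := fderiv ℝ u x

/-- `∇u + ∇uᵀ`. -/
def symGrad {d : ℕ} (u : E d → E d) (x : E d) : E d →L[ℝ] E d :=
  grad u x + ContinuousLinearMap.adjoint (grad u x)

/-- `∇ · u = ∑_i ∂_i u_i`. -/
def diverg {d : ℕ} (u : E d → E d) (x : E d) : ℝ := ∑ i, (grad u x (e i)) i

/-- `(∇ · A)_i = ∑_j ∂_j A_{ij}` for a matrix field `A`. -/
def divTensor {d : ℕ} (A : E d → (E d →L[ℝ] E d)) (x : E d) : E d :=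
  ∑ j, (fderiv ℝ A x (e j)) (e j)

/-- The matrix `a ⊗ b`, with entries `a_i b_j`. -/
def tensor {d : ℕ} (a b : E d) : E d →L[ℝ] E d := InnerProductSpace.rankOne ℝ a b

/-- The stress `σ^s(F) = ∂W(F)/∂F`, the matrix with entries `∂W/∂F_{ij}`. -/
def solidStress {d : ℕ} (W : (E d →L[ℝ] E d) → ℝ) (F : E d →L[ℝ] E d) : E d →L[ℝ] E d :=
  ∑ i, ∑ j, (fderiv ℝ W F (tensor (e i) (e j))) • tensor (e i) (e j)

/-- The `(d-1)`-dimensional surface measure in `ℝ^d`. -/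
def surfaceMeasure (d : ℕ) : Measure (E d) := Measure.euclideanHausdorffMeasure (d - 1)

/-! ### The reference simplex and the `ℙ_m` Lagrange basis -/

/-- The reference simplex with vertices `0, e_1, …, e_d`. -/
def refSimplex (d : ℕ) : Set (E d) := {x | (∀ i, 0 ≤ x i) ∧ ∑ i, x i ≤ 1}

/-- Barycentric coordinates `(1 - ∑ x_i, x_1, …, x_d)`. -/
def bary {d : ℕ} (x : E d) : Fin (d + 1) → ℝ := Fin.cons (1 - ∑ i, x i) (fun i => x i)

/-- Local indices of the principal lattice of order `m`: the multi-indices `α` with `|α| = m`;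
`α` is the point of the reference simplex with barycentric coordinates `α / m`. -/
def localNodes (d m : ℕ) : Finset (Fin (d + 1) → ℕ) := Finset.piAntidiag Finset.univ m

/-- The `ℙ_m` Lagrange basis function of the lattice point `α`:
`∏_k ∏_{r < α_k} (m λ_k - r) / (r + 1)` in barycentric coordinates `λ`. -/
def lagrange {d : ℕ} (m : ℕ) (α : Fin (d + 1) → ℕ) (x : E d) : ℝ :=
  ∏ k, ∏ r ∈ Finset.range (α k), ((m : ℝ) * bary x k - r) / (r + 1)

/-! ### Isoparametric simplicial meshes -/

/-- The connectivity of a simplicial mesh in dimension `d`, with vertex indices in `V` and cell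
indices in `J`. -/
structure Connectivity (d : ℕ) (V J : Type*) where
  /-- the vertices of a cell -/
  vert : J → Fin (d + 1) → V
  vert_injective : ∀ j, Function.Injective (vert j)
  cell_injective : Function.Injective fun j => Set.range (vert j)

variable {d : ℕ} {V J : Type*}

open scoped Classical in
/-- Push a family indexed by the vertices of the cell `j` forward to all vertices. -/
def Connectivity.push {R : Type*} [AddCommMonoid R] (T : Connectivity d V J) (j : J)
    (c : Fin (d + 1) → R) : V → R :=
  fun v => ∑ k, if T.vert j k = v then c k else 0

/-- Global index of the local grid point `α` of the cell `j`. A grid point of a mesh of order `m`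
is indexed by a multi-index of order `m` over the vertices, so that two cells share exactly the
grid points of their common face. -/
def Connectivity.node (T : Connectivity d V J) (j : J) (α : Fin (d + 1) → ℕ) : V → ℕ :=
  T.push j α

open scoped Classical in
/-- The global indices of all grid points. -/
def Connectivity.nodes [Fintype J] (T : Connectivity d V J) (m : ℕ) : Finset (V → ℕ) :=
  (Finset.univ ×ˢ localNodes d m).image fun q => T.node q.1 q.2

/-- The indices of the grid points on the faces in `S`. -/
def nodesOn [Fintype V] (m : ℕ) (S : Finset (Finset V)) : Set (V → ℕ) :=
  {i | ∑ v, i v = m ∧ ∃ F ∈ S, ∀ v, i v ≠ 0 → v ∈ F}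

/-- The map `Ψ_j(x̂) = ∑_p φ̂_p(x̂) a_{i(j,p)}` from the reference simplex onto the cell `j`, when
the grid points are placed at `a`. -/
def Connectivity.Psi (T : Connectivity d V J) (m : ℕ) (a : (V → ℕ) → E d) (j : J) (x : E d) :
    E d :=
  ∑ α ∈ localNodes d m, lagrange m α x • a (T.node j α)

/-- The union of all the (closed) cells. -/
def Connectivity.domain (T : Connectivity d V J) (m : ℕ) (a : (V → ℕ) → E d) : Set (E d) :=
  ⋃ j, T.Psi m a j '' refSimplex d

/-- The union of the images of the faces in `S`. -/
def Connectivity.faceSet (T : Connectivity d V J) (m : ℕ) (a : (V → ℕ) → E d)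
    (S : Finset (Finset V)) : Set (E d) :=
  {y | ∃ F ∈ S, ∃ j, (F : Set V) ⊆ Set.range (T.vert j) ∧
    ∃ x ∈ refSimplex d, (∀ k, T.vert j k ∉ F → bary x k = 0) ∧ T.Psi m a j x = y}

/-- The grid points `a` make `T` a genuine conforming mesh, whose boundary faces are those in `B`:
the cells are nondegenerate; two points have the same image only if they are the same point of the
same face, i.e. different cells meet exactly in their common face and no cell overlaps itself; and
the faces in `B` make up the topological boundary of the meshed domain. -/
structure Connectivity.IsMesh (T : Connectivity d V J) (m : ℕ) (B : Finset (Finset V))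
    (a : (V → ℕ) → E d) : Prop where
  nondegenerate : ∀ j, ∀ x ∈ refSimplex d, (fderiv ℝ (T.Psi m a j) x).det ≠ 0
  conforming : ∀ j k, ∀ x ∈ refSimplex d, ∀ y ∈ refSimplex d,
    T.Psi m a j x = T.Psi m a k y → T.push j (bary x) = T.push k (bary y)
  boundary : frontier (T.domain m a) = T.faceSet m a B

open scoped Classical in
/-- The function on the meshed domain which on the cell `j` is `g_j ∘ Ψ_j⁻¹`. -/
def Connectivity.onCells {F : Type*} [Zero F] (T : Connectivity d V J) (m : ℕ)
    (a : (V → ℕ) → E d) (g : J → E d → F) (y : E d) : F :=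
  if h : ∃ q : J × E d, q.2 ∈ refSimplex d ∧ T.Psi m a q.1 q.2 = y then
    g h.choose.1 h.choose.2
  else 0

open scoped Classical in
/-- The scalar finite element basis function of the grid point `i`. -/
def Connectivity.basis (T : Connectivity d V J) (m : ℕ) (a : (V → ℕ) → E d) (i : V → ℕ) :
    E d → ℝ :=
  T.onCells m a fun j x => ∑ α ∈ localNodes d m, if T.node j α = i then lagrange m α x else 0

/-- Scalar continuous `ℙ_k` finite element functions on the isoparametric mesh of order `m`. -/
def Connectivity.IsFE (T : Connectivity d V J) (m : ℕ) (a : (V → ℕ) → E d) (k : ℕ)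
    (f : E d → ℝ) : Prop :=
  ContinuousOn f (T.domain m a) ∧
    ∀ j, ∃ P : MvPolynomial (Fin d) ℝ, P.totalDegree ≤ k ∧
      ∀ x ∈ refSimplex d, f (T.Psi m a j x) = MvPolynomial.eval (fun i => x i) P

/-- Vector-valued continuous `ℙ_k` finite element functions. -/
def Connectivity.IsVecFE (T : Connectivity d V J) (m : ℕ) (a : (V → ℕ) → E d) (k : ℕ)
    (f : E d → E d) : Prop :=
  ∀ i, T.IsFE m a k fun x => f x i

/-! ### The moving mesh during the time step `[s, s + Δt]`

The grid points are at `aOld` at the time `s` and at `aNew` at the time `s + Δt`. -/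

/-- The grid points of the intermediate mesh at the time `t`. -/
def interp (s Δt : ℝ) (aOld aNew : (V → ℕ) → E d) (t : ℝ) (i : V → ℕ) : E d :=
  ((t - s) / Δt) • aNew i + ((s + Δt - t) / Δt) • aOld i

/-- The backward in time map `Φ^n(x, t)`: on the cell `j`, it is
`(t - s)/Δt x + (s + Δt - t)/Δt Ψ_j^{old} ((Ψ_j^{new})⁻¹ x)`. -/
def Connectivity.Phi (T : Connectivity d V J) (m : ℕ) (s Δt : ℝ) (aOld aNew : (V → ℕ) → E d)
    (x : E d) (t : ℝ) : E d :=
  ((t - s) / Δt) • x +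
    ((s + Δt - t) / Δt) • T.onCells m aNew (fun j xh => T.Psi m aOld j xh) x

/-- The fluid domain at an intermediate time, `Φ^n(Ω^{new}, t)`. -/
def Connectivity.domainAt (T : Connectivity d V J) (m : ℕ) (s Δt : ℝ)
    (aOld aNew : (V → ℕ) → E d) (t : ℝ) : Set (E d) :=
  (fun x => T.Phi m s Δt aOld aNew x t) '' T.domain m aNew

/-- The mesh velocity `w^n(x) = ∂_t Φ^n(x, t)` at `t = s + Δt`. -/
def Connectivity.meshVelocity (T : Connectivity d V J) (m : ℕ) (s Δt : ℝ)
    (aOld aNew : (V → ℕ) → E d) (x : E d) : E d :=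
  deriv (fun t => T.Phi m s Δt aOld aNew x t) (s + Δt)

/-- The backward in time extension `f (Φ^n(·, t)⁻¹ y)` of a function `f` on the new domain. -/
def Connectivity.backward {F : Type*} (T : Connectivity d V J) (m : ℕ) (s Δt : ℝ)
    (aOld aNew : (V → ℕ) → E d) (f : E d → F) (t : ℝ) (y : E d) : F :=
  f (Function.invFunOn (fun x => T.Phi m s Δt aOld aNew x t) (T.domain m aNew) y)

/-- The forward in time extension of a finite element function `u` on the old mesh: its nodal
values, multiplied by the backward extensions of the basis functions of the new mesh. -/
def Connectivity.forward [Fintype J] (T : Connectivity d V J) (m : ℕ) (s Δt : ℝ)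
    (aOld aNew : (V → ℕ) → E d) (u : E d → E d) (t : ℝ) (y : E d) : E d :=
  ∑ i ∈ T.nodes m, T.backward m s Δt aOld aNew (T.basis m aNew i) t y • u (aOld i)

/-- The semi-implicit convection terms at the time `t`, without the density:
`⟨∇·(ū ⊗ (ūOld - w̄)), ϕ̄⟩ - ⟨½ (∇·ūOld) ū, ϕ̄⟩`, integrated over the fluid domain at `t`. -/
def Connectivity.convectionAt [Fintype J] (T : Connectivity d V J) (m : ℕ) (s Δt : ℝ)
    (aOld aNew : (V → ℕ) → E d) (uOld u ϕ : E d → E d) (t : ℝ) : ℝ :=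
  let ub := T.backward m s Δt aOld aNew u t
  let ϕb := T.backward m s Δt aOld aNew ϕ t
  let wb := T.backward m s Δt aOld aNew (T.meshVelocity m s Δt aOld aNew) t
  let uf := T.forward m s Δt aOld aNew uOld t
  (∫ y in T.domainAt m s Δt aOld aNew t,
      inner ℝ (divTensor (fun x => tensor (ub x) (uf x - wb x)) y) (ϕb y)) -
    ∫ y in T.domainAt m s Δt aOld aNew t, inner ℝ ((1 / 2 * diverg uf y) • ub y) (ϕb y)

/-- The convection terms, with the midpoint rule in time if `d = 2` and the two-point Gauss rule
if `d = 3`. -/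
def Connectivity.convection [Fintype J] (T : Connectivity d V J) (m : ℕ) (s Δt : ℝ)
    (aOld aNew : (V → ℕ) → E d) (uOld u ϕ : E d → E d) : ℝ :=
  if d = 2 then T.convectionAt m s Δt aOld aNew uOld u ϕ (s + Δt / 2)
  else
    1 / 2 * T.convectionAt m s Δt aOld aNew uOld u ϕ
        (s + Δt - (1 / 2 + 1 / (2 * Real.sqrt 3)) * Δt) +
      1 / 2 * T.convectionAt m s Δt aOld aNew uOld u ϕ
        (s + Δt - (1 / 2 - 1 / (2 * Real.sqrt 3)) * Δt)

/-! ### The fluid-structure interaction problem -/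

/-- Physical parameters and data. -/
structure Params (d : ℕ) where
  /-- fluid density -/
  rhoF : ℝ
  /-- solid density -/
  rhoS : ℝ
  /-- fluid viscosity -/
  nuF : ℝ
  /-- strain energy density -/
  W : (E d →L[ℝ] E d) → ℝ
  /-- body forces of the fluid and of the solid, at time `t` -/
  gF : ℝ → E d → E d
  gS : ℝ → E d → E d
  /-- prescribed fluid velocity, fluid traction, solid position and solid traction -/
  uB : ℝ → E d → E d
  sigmaBF : ℝ → E d → E d
  phiB : ℝ → E d → E d
  sigmaBS : ℝ → E d → E d
  rhoF_pos : 0 < rhoF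
  rhoS_pos : 0 < rhoS
  nuF_pos : 0 < nuF
  W_differentiable : Differentiable ℝ W

/-- The fluid stress `σ^f(u, p) = ρ^f ν^f (∇u + ∇uᵀ) - p I`. -/
def Params.fluidStress (D : Params d) (u : E d → E d) (p : E d → ℝ) (x : E d) : E d →L[ℝ] E d :=
  (D.rhoF * D.nuF) • symGrad u x - p x • ContinuousLinearMap.id ℝ (E d)

/-- Connectivity of the fluid mesh, and the mesh of the solid reference domain. Both use
the same set `V` of vertex indices, so that the interface faces, and the grid points on them, have
the same index in both meshes. -/
structure Geometry (d m : ℕ) (V JF JS : Type*) where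
  fluid : Connectivity d V JF
  solid : Connectivity d V JS
  /-- the grid points of the solid reference domain -/
  z : (V → ℕ) → E d
  /-- the faces of the mesh of the interface `Γ` -/
  interface : Finset (Finset V)
  /-- the faces on `Σ_1, …, Σ_4` -/
  sigma1 : Finset (Finset V)
  sigma2 : Finset (Finset V)
  sigma3 : Finset (Finset V)
  sigma4 : Finset (Finset V)
  /-- the boundary faces of the fluid mesh and of the solid mesh -/
  fluidBoundary : Finset (Finset V)
  solidBoundary : Finset (Finset V)
  mem_fluidBoundary : ∀ F, F ∈ fluidBoundary ↔ F ∈ interface ∨ F ∈ sigma1 ∨ F ∈ sigma2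
  mem_solidBoundary : ∀ F, F ∈ solidBoundary ↔ F ∈ interface ∨ F ∈ sigma3 ∨ F ∈ sigma4
  fluid_face : ∀ F ∈ fluidBoundary, F.card = d ∧ ∃ j, (F : Set V) ⊆ Set.range (fluid.vert j)
  solid_face : ∀ F ∈ solidBoundary, F.card = d ∧ ∃ j, (F : Set V) ⊆ Set.range (solid.vert j)
  disjoint_interface_sigma1 : Disjoint interface sigma1
  disjoint_interface_sigma2 : Disjoint interface sigma2
  disjoint_sigma1_sigma2 : Disjoint sigma1 sigma2
  disjoint_interface_sigma3 : Disjoint interface sigma3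
  disjoint_interface_sigma4 : Disjoint interface sigma4
  disjoint_sigma3_sigma4 : Disjoint sigma3 sigma4
  solid_isMesh : solid.IsMesh m solidBoundary z

variable {m : ℕ} {JF JS : Type*}

/-- The solid reference domain `Ω^s`. -/
def Geometry.omegaS (M : Geometry d m V JF JS) : Set (E d) := M.solid.domain m M.z

/-- The fluid domain when the fluid grid points are at `a`. -/
def Geometry.omegaF (M : Geometry d m V JF JS) (a : (V → ℕ) → E d) : Set (E d) :=
  M.fluid.domain m a

/-- The part `Σ_4` of the boundary of the solid. -/
def Geometry.tractionBoundary (M : Geometry d m V JF JS) : Set (E d) :=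
  M.solid.faceSet m M.z M.sigma4

/-- The finite element space: fluid velocity, fluid pressure and solid velocity in
`ℙ_m / ℙ_{m-1} / ℙ_m`, where both velocities agree at the grid points of the interface; `a` are the
fluid grid points and `φ` is the position of the solid. -/
def Geometry.InSpace [Fintype V] (M : Geometry d m V JF JS) (a : (V → ℕ) → E d)
    (φ : E d → E d) (u : E d → E d) (p : E d → ℝ) (v : E d → E d) : Prop :=
  M.fluid.IsVecFE m a m u ∧ M.fluid.IsFE m a (m - 1) p ∧ M.solid.IsVecFE m M.z m v ∧
    ∀ i ∈ nodesOn m M.interface, u (φ (M.z i)) = v (M.z i)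

/-- The energy of the solid, `½ ρ^s ‖v‖² + ∫ W(∇φ)` over `Ω^s`. -/
def Geometry.solidEnergy (M : Geometry d m V JF JS) (D : Params d) (v φ : E d → E d) : ℝ :=
  D.rhoS / 2 * (∫ x in M.omegaS, ‖v x‖ ^ 2) + ∫ x in M.omegaS, D.W (grad φ x)

/-- A discrete trajectory: time step, fluid grid points, fluid velocity, pressure and solid
velocity at the times `n Δt`, and the initial position of the solid. -/
structure Trajectory (d : ℕ) (V : Type*) where
  dt : ℝ
  a : ℕ → (V → ℕ) → E d
  u : ℕ → E d → E d
  p : ℕ → E d → ℝ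
  v : ℕ → E d → E d
  phi0 : E d → E d

/-- The time `t^n = n Δt`. -/
def Trajectory.time (X : Trajectory d V) (n : ℕ) : ℝ := n * X.dt

/-- The explicitly advanced solid position, `φ^{n+1} = φ^n + Δt v^n`. -/
def Trajectory.phi (X : Trajectory d V) : ℕ → E d → E d
  | 0 => X.phi0
  | n + 1 => fun x => X.phi n x + X.dt • X.v n x

/-- The left-hand side of the scheme for the step from `t^n` to `t^{n+1}`, tested with `(ϕ, q, ψ)`. -/
def Geometry.schemeLHS [Fintype JF] (M : Geometry d m V JF JS) (D : Params d)
    (X : Trajectory d V) (n : ℕ) (ϕ : E d → E d) (q : E d → ℝ) (ψ : E d → E d) : ℝ :=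
  D.rhoF / X.dt *
      ((∫ x in M.omegaF (X.a (n + 1)), inner ℝ (X.u (n + 1) x) (ϕ x)) -
        ∫ x in M.omegaF (X.a n), inner ℝ (X.u n x)
          (M.fluid.backward m (X.time n) X.dt (X.a n) (X.a (n + 1)) ϕ (X.time n) x)) +
    D.rhoF * M.fluid.convection m (X.time n) X.dt (X.a n) (X.a (n + 1)) (X.u n) (X.u (n + 1)) ϕ +
    (∫ x in M.omegaF (X.a (n + 1)),
      frob (D.fluidStress (X.u (n + 1)) (X.p (n + 1)) x) (grad ϕ x)) -
    (∫ x in M.omegaF (X.a (n + 1)), diverg (X.u (n + 1)) x * q x) +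
    (∫ x in M.omegaS, inner ℝ ((D.rhoS / X.dt) • (X.v (n + 1) x - X.v n x)) (ψ x)) +
    ∫ x in M.omegaS,
      frob (solidStress D.W (grad (fun y => X.phi (n + 1) y + X.dt • X.v (n + 1) y) x))
        (grad ψ x)

/-- The right-hand side of the scheme for the step from `t^n` to `t^{n+1}`. -/
def Geometry.schemeRHS (M : Geometry d m V JF JS) (D : Params d) (X : Trajectory d V) (n : ℕ)
    (ϕ ψ : E d → E d) : ℝ :=
  (∫ x in M.omegaF (X.a (n + 1)), inner ℝ (D.rhoF • D.gF (X.time (n + 1)) x) (ϕ x)) +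
    (∫ x in M.fluid.faceSet m (X.a (n + 1)) M.sigma2,
      inner ℝ (D.sigmaBF (X.time (n + 1)) x) (ϕ x) ∂(surfaceMeasure d)) +
    (∫ x in M.omegaS, inner ℝ (D.rhoS • D.gS (X.time (n + 1)) x) (ψ x)) +
    ∫ x in M.tractionBoundary,
      inner ℝ (D.sigmaBS (X.time (n + 1)) x) (ψ x) ∂(surfaceMeasure d)

/-- `X` is a solution of the explicit interface advancing scheme for the first `N` time steps. -/
structure Geometry.IsSolution [Fintype V] [Fintype JF] (M : Geometry d m V JF JS) (D : Params d)
    (X : Trajectory d V) (N : ℕ) : Prop where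
  /-- the initial position of the solid is a finite element function -/
  initial : M.solid.IsVecFE m M.z m X.phi0
  /-- the interface grid points of the fluid mesh follow the solid -/
  moving : ∀ n ≤ N, ∀ i ∈ nodesOn m M.interface, X.a n i = X.phi n (M.z i)
  /-- the other boundaries of the fluid do not move -/
  fixed : ∀ n < N, ∀ i, i ∈ nodesOn m M.sigma1 ∨ i ∈ nodesOn m M.sigma2 → X.a (n + 1) i = X.a n i
  mem : ∀ n ≤ N, M.InSpace (X.a n) (X.phi n) (X.u n) (X.p n) (X.v n)
  fluid_bc : ∀ n < N, ∀ x ∈ M.fluid.faceSet m (X.a (n + 1)) M.sigma1,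
    X.u (n + 1) x = D.uB (X.time (n + 1)) x
  solid_bc : ∀ n < N, ∀ x ∈ M.solid.faceSet m M.z M.sigma3,
    X.v (n + 1) x = deriv (fun t => D.phiB t x) (X.time (n + 1))
  equation : ∀ n < N, ∀ (ϕ : E d → E d) (q : E d → ℝ) (ψ : E d → E d),
    M.InSpace (X.a (n + 1)) (X.phi (n + 1)) ϕ q ψ →
    (∀ x ∈ M.fluid.faceSet m (X.a (n + 1)) M.sigma1, ϕ x = 0) →
    (∀ x ∈ M.solid.faceSet m M.z M.sigma3, ψ x = 0) →
    M.schemeLHS D X n ϕ q ψ = M.schemeRHS D X n ϕ ψ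

/-- No collision during the first `N` steps: at every time of every step the moved grid points
still form a mesh of a fluid domain bounded by the interface and by the fixed boundaries. In
particular the interface meets neither itself nor the fixed boundaries. -/
def Geometry.CollisionFree (M : Geometry d m V JF JS) (X : Trajectory d V) (N : ℕ) : Prop :=
  ∀ n < N, ∀ t ∈ Set.Icc (X.time n) (X.time (n + 1)),
    M.fluid.IsMesh m M.fluidBoundary (interp (X.time n) X.dt (X.a n) (X.a (n + 1)) t)

/-- At each of the times `t^1, …, t^N` the forces and the solid traction are square integrable, with
`L²` norms at most `G`. -/
def Geometry.ForcesBoundedBy (M : Geometry d m V JF JS) (D : Params d) (X : Trajectory d V)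
    (N : ℕ) (G : ℝ≥0∞) : Prop :=
  ∀ n < N,
    eLpNorm (D.gF (X.time (n + 1))) 2 (volume.restrict (M.omegaF (X.a (n + 1)))) ≤ G ∧
    eLpNorm (D.gS (X.time (n + 1))) 2 (volume.restrict M.omegaS) ≤ G ∧
    eLpNorm (D.sigmaBS (X.time (n + 1))) 2 ((surfaceMeasure d).restrict M.tractionBoundary) ≤ G

/-- At each of the times `t^1, …, t^N` the forces and the solid traction are square integrable. -/
def Geometry.ForcesL2 (M : Geometry d m V JF JS) (D : Params d) (X : Trajectory d V)
    (N : ℕ) : Prop :=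
  ∀ n < N,
    MemLp (D.gF (X.time (n + 1))) 2 (volume.restrict (M.omegaF (X.a (n + 1)))) ∧
    MemLp (D.gS (X.time (n + 1))) 2 (volume.restrict M.omegaS) ∧
    MemLp (D.sigmaBS (X.time (n + 1))) 2 ((surfaceMeasure d).restrict M.tractionBoundary)

/-- `‖u^n‖²` over the fluid domain at `t^n`. -/
def Geometry.fluidNormSq (M : Geometry d m V JF JS) (X : Trajectory d V) (n : ℕ) : ℝ :=
  ∫ x in M.omegaF (X.a n), ‖X.u n x‖ ^ 2

/-- `‖∇u^n + (∇u^n)ᵀ‖²` over the fluid domain at `t^n`. -/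
def Geometry.strainNormSq (M : Geometry d m V JF JS) (X : Trajectory d V) (n : ℕ) : ℝ :=
  ∫ x in M.omegaF (X.a n), frob (symGrad (X.u n) x) (symGrad (X.u n) x)

/-- The energy of the solid at `t^n`, with the extrapolated position `φ^n + Δt v^n`. -/
def Geometry.solidEnergyAt (M : Geometry d m V JF JS) (D : Params d) (X : Trajectory d V)
    (n : ℕ) : ℝ :=
  M.solidEnergy D (X.v n) fun x => X.phi n x + X.dt • X.v n x

/-- The power of the forces at `t^n`:
`⟨ρ^f g^f, u^n⟩ + ⟨ρ^s g^s, v^n⟩ + ⟨σ_b^s, v^n⟩` over the fluid, the solid and `Σ_4`. -/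
def Geometry.power (M : Geometry d m V JF JS) (D : Params d) (X : Trajectory d V) (n : ℕ) : ℝ :=
  (∫ x in M.omegaF (X.a n), inner ℝ (D.rhoF • D.gF (X.time n) x) (X.u n x)) +
    (∫ x in M.omegaS, inner ℝ (D.rhoS • D.gS (X.time n) x) (X.v n x)) +
    ∫ x in M.tractionBoundary, inner ℝ (D.sigmaBS (X.time n) x) (X.v n x) ∂(surfaceMeasure d)

/-- Twice the total energy at `t^n`, plus the energy dissipated by viscosity up to `t^n`:
`2 Π_s + ρ^f ‖u^n‖² + ∑_{1 ≤ l ≤ n} ρ^f ν^f ‖∇u^l + (∇u^l)ᵀ‖² Δt`. -/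
def Geometry.totalEnergy (M : Geometry d m V JF JS) (D : Params d) (X : Trajectory d V)
    (n : ℕ) : ℝ :=
  2 * M.solidEnergyAt D X n + D.rhoF * M.fluidNormSq X n +
    ∑ l ∈ Finset.range n, D.rhoF * D.nuF * M.strainNormSq X (l + 1) * X.dt

end

end FSI

/-!
The energy inequality comes from testing the scheme with `(u^n; -p^n; v^n)`: the kinematic coupling
`u^n(φ^n(z_i)) = v^n(z_i)` makes this triple admissible, and the sign of the pressure makes the two
pressure terms cancel. What remains are four contributions.

*Convection.* With the transport velocity `b = ū^{n-1} - w̄^n` on the intermediate domain `Ω_(t)`,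
the convection terms tested with `ū^n` have the integrand
`½ ∇·(|ū^n|² b) - ½ (∇·w̄^n) |ū^n|²`. On the interface the mesh moves with the fluid, because
`a_i^n - a_i^{n-1} = Δt v^{n-1}(z_i) = Δt u^{n-1}(a_i^{n-1})` at the grid points, and `b` is the finite
element function with the nodal values `u^{n-1}(a_i^{n-1}) - (a_i^n - a_i^{n-1}) / Δt`; on `Σ_1` the
velocity vanishes. So `|ū^n|² b` vanishes on the boundary, and its divergence has integral zero
(`Connectivity.PiecewiseSmooth.integral_diverg_eq_zero`). No surface integrals are needed for this:
extended by zero, such a field is Lipschitz, as it is so on each set of a finite closed cover of the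
space, and Lipschitz functions of compact support admit integration by parts.

*Quadrature in time.* Pulled back to the reference simplex, the remaining term at the time
`t^{n-1} + θ Δt` is `-1/(2 Δt) ∫ ∂_θ |det D Ψ_j(θ)| |u^n ∘ Ψ_j^n|²`, by Jacobi's formula. The cell maps
are affine in `θ`, so the determinant is a polynomial in `θ` of degree at most `d`, which does not
change sign. The midpoint rule for `d = 2` and the two-point Gauss rule for `d = 3` integrate its
derivative exactly (`abs_det_sub_abs_det_eq_quadrature`), and the convection terms equal
`-1/(2 Δt) (‖u^n‖²_{Ω_n} - ‖ū^n(t^{n-1})‖²_{Ω_{n-1}})` (`Connectivity.IsMesh.convection_eq`).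
Together with the inertia term and Young's inequality on `Ω_{n-1}` they bound from above the
difference quotient of the kinetic energy.

*Viscosity* gives half of the dissipation, as `(∇u + ∇uᵀ) : ∇u = ½ |∇u + ∇uᵀ|²`.

*Elasticity.* `Δt σ^s(φ^n + Δt v^n) : ∇v^n = DW(∇φ^{n+1}) (∇φ^{n+1} - ∇φ^n)` is at least
`W(∇φ^{n+1}) - W(∇φ^n)`, by convexity
(`Connectivity.PiecewiseSmooth.integral_solidStress_ge`).

For the uniform bound, let `Y` be the maximum over `l ≤ N` of
`(ρ^f ‖u^l‖² + ρ^s ‖v^l‖²)^{1/2}`. The forces have power at most a constant times `Y`; on `Σ_4` this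
holds because all norms of finite element functions on the fixed solid mesh are equivalent
(`Connectivity.IsMesh.exists_inverse_estimate`) and the surface has finite area. A convex `W` grows at
least like a linear function, and `‖∇φ^{n+1}‖_∞` is at most a constant times `1 + Y`, again by the
inverse estimate, so the elastic energy is bounded below by `-(E₀ + E₁ Y)`. Summing the energy
inequality up to the step at which the maximum is attained gives `Y² ≤ A + b Y`, which bounds `Y` and
hence the total energy, with constants in which neither the fluid mesh nor `Δt` enters.
-/

namespace FSI

noncomputable section

open Filter Topology

/-! ### The reference simplex -/

section

variable {d m : ℕ} {V J : Type*}

/-- The interior `{x | x_i > 0, ∑ x_i < 1}` of the reference simplex. -/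
def openSimplex (d : ℕ) : Set (E d) := {x | (∀ i, 0 < x i) ∧ ∑ i, x i < 1}

lemma isOpen_openSimplex : IsOpen (openSimplex d) := by
  have h (i : Fin d) : IsOpen {x : E d | 0 < x i} :=
    isOpen_lt (g := fun x : E d => x i) continuous_const (by fun_prop)
  have h1 : IsOpen {x : E d | ∀ i, 0 < x i} := by
    rw [ofPred_forall]
    exact isOpen_iInter_of_finite h
  exact h1.inter (isOpen_lt (f := fun x : E d => ∑ i, x i) (by fun_prop) continuous_const)

lemma openSimplex_subset : openSimplex d ⊆ refSimplex d :=
  fun _ hx => ⟨fun i => (hx.1 i).le, hx.2.le⟩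

lemma le_one_of_mem_refSimplex {x : E d} (hx : x ∈ refSimplex d) (i : Fin d) : x i ≤ 1 :=
  (Finset.single_le_sum (f := fun i => x i) (fun i _ => hx.1 i) (Finset.mem_univ i)).trans hx.2

lemma isCompact_refSimplex : IsCompact (refSimplex d) := by
  have h1 : IsClosed (refSimplex d) := by
    have h (i : Fin d) : IsClosed {x : E d | 0 ≤ x i} :=
      isClosed_le (g := fun x : E d => x i) continuous_const (by fun_prop)
    have h1 : IsClosed {x : E d | ∀ i, 0 ≤ x i} := by
      rw [ofPred_forall]
      exact isClosed_iInter h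
    exact h1.inter (isClosed_le (f := fun x : E d => ∑ i, x i) (by fun_prop) continuous_const)
  refine Metric.isCompact_of_isClosed_isBounded h1 ?_
  refine (Metric.isBounded_closedBall (x := (0 : E d)) (r := 1)).subset fun x hx => ?_
  rw [mem_closedBall_zero_iff, EuclideanSpace.norm_eq, Real.sqrt_le_one]
  refine le_trans (Finset.sum_le_sum fun i _ => ?_) hx.2
  rw [Real.norm_eq_abs, sq_abs]
  nlinarith [hx.1 i, le_one_of_mem_refSimplex hx i]

lemma measurableSet_refSimplex : MeasurableSet (refSimplex d) :=
  isCompact_refSimplex.isClosed.measurableSet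

lemma convex_refSimplex : Convex ℝ (refSimplex d) := by
  intro x hx y hy a b ha hb hab
  refine ⟨fun i => ?_, ?_⟩
  · simp only [PiLp.add_apply, PiLp.smul_apply, smul_eq_mul]
    exact add_nonneg (mul_nonneg ha (hx.1 i)) (mul_nonneg hb (hy.1 i))
  · simp only [PiLp.add_apply, PiLp.smul_apply, smul_eq_mul, Finset.sum_add_distrib,
      ← Finset.mul_sum]
    nlinarith [mul_le_mul_of_nonneg_left hx.2 ha, mul_le_mul_of_nonneg_left hy.2 hb]

lemma bary_nonneg {x : E d} (hx : x ∈ refSimplex d) (k : Fin (d + 1)) : 0 ≤ bary x k := by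
  refine Fin.cases ?_ (fun i => ?_) k
  · simpa [bary] using hx.2
  · simpa [bary] using hx.1 i

lemma bary_pos {x : E d} (hx : x ∈ openSimplex d) (k : Fin (d + 1)) : 0 < bary x k := by
  refine Fin.cases ?_ (fun i => ?_) k
  · simpa [bary] using hx.2
  · simpa [bary] using hx.1 i

lemma bary_injective : Function.Injective (bary : E d → _) := by
  intro x y h
  ext i
  simpa [bary] using congrFun h i.succ

lemma refSimplex_diff_openSimplex_subset :
    refSimplex d \ openSimplex d ⊆ frontier (refSimplex d) := by
  rintro x ⟨hx, hxo⟩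
  refine ⟨subset_closure hx, fun hint => hxo ?_⟩
  -- moving from an interior point in a coordinate direction stays in the simplex
  have key : ∀ i : Fin d, ∃ ε > (0 : ℝ), x + ε • e i ∈ refSimplex d ∧ x - ε • e i ∈ refSimplex d := by
    intro i
    have h1 : ∀ᶠ ε : ℝ in nhds 0, x + ε • e i ∈ refSimplex d := by
      have : Filter.Tendsto (fun ε : ℝ => x + ε • e i) (nhds 0) (nhds x) := by
        have : Continuous fun ε : ℝ => x + ε • (e i : E d) := by fun_prop
        simpa using this.tendsto 0
      exact this (mem_interior_iff_mem_nhds.1 hint)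
    have h2 : ∀ᶠ ε : ℝ in nhds 0, x - ε • e i ∈ refSimplex d := by
      have : Filter.Tendsto (fun ε : ℝ => x - ε • e i) (nhds 0) (nhds x) := by
        have : Continuous fun ε : ℝ => x - ε • (e i : E d) := by fun_prop
        simpa using this.tendsto 0
      exact this (mem_interior_iff_mem_nhds.1 hint)
    obtain ⟨ε, h, hε⟩ := (((h1.and h2).filter_mono nhdsWithin_le_nhds).and
      (self_mem_nhdsWithin (s := Ioi (0 : ℝ)))).exists
    exact ⟨ε, hε, h⟩
  refine ⟨fun i => ?_, ?_⟩
  · obtain ⟨ε, hε, -, h⟩ := key i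
    have := h.1 i
    simp [e] at this
    linarith
  · rcases isEmpty_or_nonempty (Fin d) with hd | ⟨⟨i⟩⟩
    · simp
    · obtain ⟨ε, hε, h, -⟩ := key i
      have := h.2
      simp [e, Finset.sum_add_distrib] at this
      linarith

lemma volume_refSimplex_diff_openSimplex : volume (refSimplex d \ openSimplex d) = 0 :=
  measure_mono_null refSimplex_diff_openSimplex_subset
    (convex_refSimplex.addHaar_frontier volume)

/-! ### Lagrange basis functions in global barycentric coordinates -/

lemma Connectivity.push_vert {R : Type*} [AddCommMonoid R] (T : Connectivity d V J) (j : J)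
    (c : Fin (d + 1) → R) (k : Fin (d + 1)) : T.push j c (T.vert j k) = c k := by
  classical
  unfold Connectivity.push
  rw [Finset.sum_eq_single k]
  · simp
  · intro b _ hb
    rw [if_neg (fun h => hb (T.vert_injective j h))]
  · simp

lemma Connectivity.push_of_notMem {R : Type*} [AddCommMonoid R] (T : Connectivity d V J) (j : J)
    (c : Fin (d + 1) → R) {v : V} (hv : v ∉ Set.range (T.vert j)) : T.push j c v = 0 := by
  classical
  unfold Connectivity.push
  refine Finset.sum_eq_zero fun k _ => if_neg fun h => hv ⟨k, h⟩

lemma Connectivity.push_injective {R : Type*} [AddCommMonoid R] (T : Connectivity d V J) (j : J) :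
    Function.Injective (T.push j : (Fin (d + 1) → R) → V → R) := by
  intro c c' h
  ext k
  rw [← T.push_vert j c k, h, T.push_vert]

lemma Connectivity.sum_push {R : Type*} [AddCommMonoid R] [Fintype V] (T : Connectivity d V J)
    (j : J) (c : Fin (d + 1) → R) : ∑ v, T.push j c v = ∑ k, c k := by
  classical
  symm
  exact Fintype.sum_of_injective (T.vert j) (T.vert_injective j) c _
    (fun v hv => T.push_of_notMem j c hv) (fun k => (T.push_vert j c k).symm)

/-- If a point in the interior of the cell `j` and a point of the cell `k` have the same global
barycentric coordinates, they are the same point of the same cell. -/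
lemma Connectivity.eq_of_push_bary_eq (T : Connectivity d V J) {j k : J} {x y : E d}
    (hx : x ∈ openSimplex d)
    (h : T.push j (bary x) = T.push k (bary y)) : j = k ∧ x = y := by
  have hsub : Set.range (T.vert j) ⊆ Set.range (T.vert k) := by
    rintro _ ⟨l, rfl⟩
    by_contra hl
    have := congrFun h (T.vert j l)
    rw [T.push_vert, T.push_of_notMem k _ hl] at this
    exact (bary_pos hx l).ne' this
  have hr : Set.range (T.vert j) = Set.range (T.vert k) := by
    refine Set.eq_of_subset_of_ncard_le hsub ?_ (Set.finite_range _)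
    rw [← Set.image_univ, ← Set.image_univ, Set.ncard_image_of_injective _ (T.vert_injective j),
      Set.ncard_image_of_injective _ (T.vert_injective k)]
  obtain rfl := T.cell_injective hr
  exact ⟨rfl, bary_injective (T.push_injective j h)⟩

/-- The Lagrange basis function of the grid point `i`, as a function of the barycentric coordinates
`b` with respect to all vertices of the mesh. -/
def globalLagrange [Fintype V] (m : ℕ) (i : V → ℕ) (b : V → ℝ) : ℝ :=
  ∏ v, ∏ r ∈ Finset.range (i v), ((m : ℝ) * b v - r) / (r + 1)

lemma globalLagrange_eq_zero [Fintype V] {i : V → ℕ} {b : V → ℝ} {v : V} (hi : i v ≠ 0)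
    (hb : b v = 0) : globalLagrange m i b = 0 := by
  refine Finset.prod_eq_zero (Finset.mem_univ v) ?_
  refine Finset.prod_eq_zero (Finset.mem_range.2 (Nat.pos_of_ne_zero hi)) ?_
  simp [hb]

lemma lagrange_eq_zero {α : Fin (d + 1) → ℕ} {x : E d} {k : Fin (d + 1)} (hα : α k ≠ 0)
    (hx : bary x k = 0) : lagrange m α x = 0 :=
  globalLagrange_eq_zero hα hx

lemma Connectivity.lagrange_eq [Fintype V] (T : Connectivity d V J) (j : J)
    (α : Fin (d + 1) → ℕ) (x : E d) :
    lagrange m α x = globalLagrange m (T.node j α) (T.push j (bary x)) := by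
  refine Fintype.prod_of_injective (T.vert j) (T.vert_injective j) _ _ (fun v hv => ?_)
    (fun k => ?_)
  · simp [Connectivity.node, T.push_of_notMem j α hv]
  · simp [Connectivity.node, T.push_vert]

open scoped Classical in
/-- The cell map in global barycentric coordinates. In particular, its value depends on the cell and
the local point only through the global barycentric coordinates, whatever the grid points are. -/
lemma Connectivity.Psi_eq_sum_globalLagrange [Fintype V] (T : Connectivity d V J)
    (a : (V → ℕ) → E d) (j : J) (x : E d) :
    T.Psi m a j x = ∑ i ∈ Finset.piAntidiag Finset.univ m,
      globalLagrange m i (T.push j (bary x)) • a i := by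
  refine Finset.sum_of_injOn (T.node j) (fun _ _ _ _ h => T.push_injective j h) ?_ ?_
    (fun α _ => by rw [T.lagrange_eq j])
  · intro α hα
    simp only [localNodes, Finset.mem_coe, Finset.mem_piAntidiag, Finset.mem_univ, implies_true,
      and_true] at hα ⊢
    simpa [Connectivity.node, T.sum_push] using hα
  · intro i hi hi'
    have : ∃ v, v ∉ Set.range (T.vert j) ∧ i v ≠ 0 := by
      by_contra! hcon
      have hpush : T.node j (fun k => i (T.vert j k)) = i := by
        ext v
        by_cases hv : v ∈ Set.range (T.vert j)
        · obtain ⟨k, rfl⟩ := hv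
          simp [Connectivity.node, T.push_vert]
        · rw [hcon v hv]; exact T.push_of_notMem j _ hv
      refine hi' ⟨_, ?_, hpush⟩
      simp only [localNodes, Finset.mem_coe, Finset.mem_piAntidiag, Finset.mem_univ, implies_true,
        and_true] at hi ⊢
      rw [← hi, ← T.sum_push j]
      exact Finset.sum_congr rfl fun v _ => congrFun hpush v
    obtain ⟨v, hv, hiv⟩ := this
    rw [globalLagrange_eq_zero hiv (T.push_of_notMem j _ hv), zero_smul]

lemma Connectivity.Psi_congr [Fintype V] (T : Connectivity d V J) (a : (V → ℕ) → E d) {j k : J}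
    {x y : E d} (h : T.push j (bary x) = T.push k (bary y)) : T.Psi m a j x = T.Psi m a k y := by
  rw [T.Psi_eq_sum_globalLagrange, T.Psi_eq_sum_globalLagrange, h]

lemma Connectivity.Psi_add (T : Connectivity d V J) (a b : (V → ℕ) → E d) (j : J) (x : E d) :
    T.Psi m (a + b) j x = T.Psi m a j x + T.Psi m b j x := by
  simp [Connectivity.Psi, Finset.sum_add_distrib]

lemma Connectivity.Psi_smul (T : Connectivity d V J) (c : ℝ) (a : (V → ℕ) → E d) (j : J)
    (x : E d) : T.Psi m (c • a) j x = c • T.Psi m a j x := by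
  simp [Connectivity.Psi, Finset.smul_sum, smul_comm _ c]

lemma Connectivity.Psi_sub (T : Connectivity d V J) (a b : (V → ℕ) → E d) (j : J) (x : E d) :
    T.Psi m (a - b) j x = T.Psi m a j x - T.Psi m b j x := by
  simp [Connectivity.Psi, smul_sub, Finset.sum_sub_distrib]

lemma contDiff_bary {n : WithTop ℕ∞} (k : Fin (d + 1)) :
    ContDiff ℝ n fun x : E d => bary x k := by
  refine Fin.cases ?_ (fun i => ?_) k
  · simp only [bary, Fin.cons_zero]; fun_prop
  · simp only [bary, Fin.cons_succ]; fun_prop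

lemma contDiff_lagrange {n : WithTop ℕ∞} (α : Fin (d + 1) → ℕ) :
    ContDiff ℝ n (lagrange m α : E d → ℝ) := by
  unfold lagrange
  refine contDiff_prod fun k _ => contDiff_prod fun r _ => ?_
  have := contDiff_bary (d := d) (n := n) k
  fun_prop

lemma Connectivity.contDiff_Psi {n : WithTop ℕ∞} (T : Connectivity d V J) (a : (V → ℕ) → E d)
    (j : J) : ContDiff ℝ n (T.Psi m a j) := by
  unfold Connectivity.Psi
  exact ContDiff.sum fun α _ => (contDiff_lagrange α).smul contDiff_const

/-- On a face, the cell map only involves the grid points on the face. -/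
lemma Connectivity.Psi_eq_zero_of_face [Fintype V] (T : Connectivity d V J)
    (c : (V → ℕ) → E d) (S : Finset (Finset V)) (hc : ∀ i ∈ nodesOn m S, c i = 0)
    {F : Finset V} (hF : F ∈ S) {j : J} {x : E d} (hx : ∀ k, T.vert j k ∉ F → bary x k = 0) :
    T.Psi m c j x = 0 := by
  refine Finset.sum_eq_zero fun α hα => ?_
  by_cases h : ∃ k, α k ≠ 0 ∧ bary x k = 0
  · obtain ⟨k, hk, hk'⟩ := h
    rw [lagrange_eq_zero hk hk', zero_smul]
  · push Not at h
    rw [hc, smul_zero]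
    refine ⟨?_, F, hF, fun v hv => ?_⟩
    · simp only [localNodes, Finset.mem_piAntidiag, Finset.mem_univ, implies_true, and_true] at hα
      rw [← hα]
      exact T.sum_push j α
    · by_cases hvr : v ∈ Set.range (T.vert j)
      · obtain ⟨k, rfl⟩ := hvr
        rw [Connectivity.node, T.push_vert] at hv
        by_contra hk
        exact h k hv (hx k hk)
      · exact absurd (T.push_of_notMem j α hvr) hv

end

/-! ### Nondegenerate maps -/

section

variable {d m : ℕ} {V J : Type*} {F G : Type*} [NormedAddCommGroup F] [NormedSpace ℝ F]
  [NormedAddCommGroup G] [NormedSpace ℝ G]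

/-- The derivative of `P ∘ Ψ⁻¹`, for a nondegenerate map `Ψ`. -/
lemma hasFDerivAt_of_comp_eventuallyEq {Ψ : E d → E d} {f P : E d → F} {P' : E d →L[ℝ] F} {x : E d}
    (hΨ : ContDiff ℝ 1 Ψ) (hdet : (fderiv ℝ Ψ x).det ≠ 0) (hP : HasFDerivAt P P' x)
    (h : ∀ᶠ y in 𝓝 x, f (Ψ y) = P y) :
    HasFDerivAt f (P' ∘L (fderiv ℝ Ψ x).inverse) (Ψ x) := by
  set A := (fderiv ℝ Ψ x).toContinuousLinearEquivOfDetNeZero hdet with hA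
  have hs : HasStrictFDerivAt Ψ (A : E d →L[ℝ] E d) x := by
    rw [ContinuousLinearMap.coe_toContinuousLinearEquivOfDetNeZero]
    exact hΨ.contDiffAt.hasStrictFDerivAt one_ne_zero
  have hinv : (fderiv ℝ Ψ x).inverse = (A.symm : E d →L[ℝ] E d) := by
    rw [← ContinuousLinearMap.coe_toContinuousLinearEquivOfDetNeZero _ hdet,
      ContinuousLinearMap.inverse_equiv]
  rw [hinv]
  have hg := hs.to_localInverse.hasFDerivAt
  have hP' : HasFDerivAt P P' (hs.localInverse Ψ A x (Ψ x)) := by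
    rwa [hs.localInverse_apply_image]
  refine (hP'.comp (Ψ x) hg).congr_of_eventuallyEq ?_
  have h1 := hs.localInverse_tendsto.eventually h
  filter_upwards [h1, hs.eventually_right_inverse] with y hy hy'
  rw [Function.comp_apply, ← hy, hy']

/-- The inverse of an injective nondegenerate map is Lipschitz on compact sets. -/
lemma exists_dist_le_mul_dist_image {Ψ : E d → E d} (hΨ : ContDiff ℝ 1 Ψ) {K : Set (E d)}
    (hK : IsCompact K) (hdet : ∀ x ∈ K, (fderiv ℝ Ψ x).det ≠ 0) (hinj : InjOn Ψ K) :
    ∃ L : ℝ, 0 ≤ L ∧ ∀ x ∈ K, ∀ y ∈ K, dist x y ≤ L * dist (Ψ x) (Ψ y) := by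
  have key : ∃ L : ℝ, 0 ≤ L ∧ ∀ q ∈ K ×ˢ K, dist q.1 q.2 ≤ L * dist (Ψ q.1) (Ψ q.2) := by
    refine (hK.prod hK).induction_on
      (p := fun s => ∃ L : ℝ, 0 ≤ L ∧ ∀ q ∈ s, dist q.1 q.2 ≤ L * dist (Ψ q.1) (Ψ q.2))
      ⟨0, le_rfl, by simp⟩ (fun s t hst ⟨L, hL, h⟩ => ⟨L, hL, fun q hq => h q (hst hq)⟩) ?_ ?_
    · rintro s t ⟨L, hL, h⟩ ⟨L', hL', h'⟩
      refine ⟨max L L', le_max_of_le_left hL, ?_⟩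
      rintro q (hq | hq)
      · exact (h q hq).trans (mul_le_mul_of_nonneg_right (le_max_left _ _) dist_nonneg)
      · exact (h' q hq).trans (mul_le_mul_of_nonneg_right (le_max_right _ _) dist_nonneg)
    · rintro ⟨x, y⟩ ⟨hx, hy⟩
      by_cases hxy : x = y
      · -- near the diagonal, use the local inverse
        subst hxy
        set A := (fderiv ℝ Ψ x).toContinuousLinearEquivOfDetNeZero (hdet x hx)
        have hs : HasStrictFDerivAt Ψ (A : E d →L[ℝ] E d) x := by
          rw [ContinuousLinearMap.coe_toContinuousLinearEquivOfDetNeZero]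
          exact hΨ.contDiffAt.hasStrictFDerivAt one_ne_zero
        obtain ⟨L, s, hs', hL⟩ := hs.to_localInverse.exists_lipschitzOnWith
        have h1 : ∀ᶠ z in 𝓝 x, hs.localInverse Ψ A x (Ψ z) = z ∧ Ψ z ∈ s :=
          hs.eventually_left_inverse.and (hΨ.continuous.continuousAt hs')
        have h2 : ∀ᶠ q : E d × E d in 𝓝 (x, x), dist q.1 q.2 ≤ L * dist (Ψ q.1) (Ψ q.2) := by
          rw [nhds_prod_eq]
          filter_upwards [h1.prod_mk h1] with q hq
          simpa only [hq.1.1, hq.2.1] using hL.dist_le_mul _ hq.1.2 _ hq.2.2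
        exact ⟨_, mem_nhdsWithin_of_mem_nhds h2, L, L.2, fun q hq => hq⟩
      · have hne : 0 < dist (Ψ x) (Ψ y) := dist_pos.2 fun h => hxy (hinj hx hy h)
        have hc1 : Continuous fun q : E d × E d => dist (Ψ q.1) (Ψ q.2) := by
          have := hΨ.continuous
          fun_prop
        have hc2 : Continuous fun q : E d × E d => dist q.1 q.2 := by fun_prop
        have h1 : ∀ᶠ q : E d × E d in 𝓝 (x, y), dist (Ψ x) (Ψ y) / 2 < dist (Ψ q.1) (Ψ q.2) :=
          hc1.continuousAt.eventually_const_lt (by simpa using hne)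
        have h2 : ∀ᶠ q : E d × E d in 𝓝 (x, y), dist q.1 q.2 < dist x y + 1 :=
          hc2.continuousAt.eventually_lt_const (by simp)
        refine ⟨_, mem_nhdsWithin_of_mem_nhds (h1.and h2),
          (dist x y + 1) / (dist (Ψ x) (Ψ y) / 2), by positivity, fun q hq => ?_⟩
        refine hq.2.le.trans ?_
        rw [div_mul_eq_mul_div, le_div_iff₀ (by positivity)]
        exact mul_le_mul_of_nonneg_left hq.1.le (by positivity)
  obtain ⟨L, hL, h⟩ := key
  exact ⟨L, hL, fun x hx y hy => h (x, y) ⟨hx, hy⟩⟩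

/-! ### Integration over the cells of a mesh -/

namespace Connectivity

variable {T : Connectivity d V J} {B : Finset (Finset V)} {a : (V → ℕ) → E d}

lemma IsMesh.injOn (h : T.IsMesh m B a) (j : J) : InjOn (T.Psi m a j) (refSimplex d) :=
  fun x hx y hy hxy => bary_injective (T.push_injective j (h.conforming j j x hx y hy hxy))

lemma mem_domain {j : J} {x : E d} (hx : x ∈ refSimplex d) : T.Psi m a j x ∈ T.domain m a :=
  mem_iUnion.2 ⟨j, x, hx, rfl⟩

lemma isCompact_domain [Finite J] : IsCompact (T.domain m a) :=
  isCompact_iUnion fun j => isCompact_refSimplex.image (T.contDiff_Psi (n := 1) a j).continuous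

lemma measurableSet_domain [Finite J] : MeasurableSet (T.domain m a) :=
  isCompact_domain.isClosed.measurableSet

lemma hasFDerivAt_Psi (j : J) (x : E d) :
    HasFDerivAt (T.Psi m a j) (fderiv ℝ (T.Psi m a j) x) x :=
  ((T.contDiff_Psi (n := 1) a j).differentiable one_ne_zero x).hasFDerivAt

lemma continuous_fderiv_Psi (j : J) : Continuous fun x => fderiv ℝ (T.Psi m a j) x :=
  (T.contDiff_Psi (n := 1) a j).continuous_fderiv one_ne_zero

/-- The union of the interiors of the cells. -/
def cellInteriors (T : Connectivity d V J) (m : ℕ) (a : (V → ℕ) → E d) : Set (E d) :=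
  ⋃ j, T.Psi m a j '' openSimplex d

lemma cellInteriors_ae_eq_domain [Finite J] :
    T.cellInteriors m a =ᵐ[volume] T.domain m a := by
  have hsub : T.cellInteriors m a ⊆ T.domain m a :=
    iUnion_mono fun j => image_mono openSimplex_subset
  refine hsub.eventuallyLE.antisymm ?_
  rw [ae_le_set]
  refine measure_mono_null (t := ⋃ j, T.Psi m a j '' (refSimplex d \ openSimplex d)) ?_ ?_
  · rintro y ⟨hy, hy'⟩
    obtain ⟨j, x, hx, rfl⟩ := mem_iUnion.1 hy
    exact mem_iUnion.2 ⟨j, x, ⟨hx, fun hxo => hy' (mem_iUnion.2 ⟨j, x, hxo, rfl⟩)⟩, rfl⟩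
  · have := Finite.to_countable (α := J)
    refine measure_iUnion_null fun j => ?_
    exact addHaar_image_eq_zero_of_differentiableOn_of_addHaar_eq_zero volume
      (fun x _ => (hasFDerivAt_Psi j x).differentiableAt.differentiableWithinAt)
      volume_refSimplex_diff_openSimplex

/-- Almost every point of the meshed domain lies in the interior of a cell. -/
lemma ae_restrict_domain [Finite J] {p : E d → Prop}
    (h : ∀ j, ∀ x ∈ openSimplex d, p (T.Psi m a j x)) :
    ∀ᵐ y ∂volume.restrict (T.domain m a), p y := by
  rw [ae_restrict_iff' measurableSet_domain]
  filter_upwards [(cellInteriors_ae_eq_domain (T := T) (m := m) (a := a)).mem_iff] with y hy hyT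
  obtain ⟨j, x, hx, rfl⟩ := mem_iUnion.1 (hy.2 hyT)
  exact h j x hx

/-- The integral over the meshed domain of a function which is continuous up to the boundary on each
cell, as a sum of integrals over the reference simplex. -/
lemma IsMesh.integral_domain [Fintype V] [Fintype J] (hT : T.IsMesh m B a) {f : E d → F}
    {g : J → E d → F} (hg : ∀ j, ContinuousOn (g j) (refSimplex d))
    (h : ∀ j, ∀ x ∈ openSimplex d, f (T.Psi m a j x) = g j x) :
    IntegrableOn f (T.domain m a) ∧ ∫ y in T.domain m a, f y =
      ∑ j, ∫ x in openSimplex d, |(fderiv ℝ (T.Psi m a j) x).det| • g j x := by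
  have hfd : ∀ j, ∀ x ∈ openSimplex d, HasFDerivWithinAt (T.Psi m a j)
      (fderiv ℝ (T.Psi m a j) x) (openSimplex d) x :=
    fun j x _ => (hasFDerivAt_Psi j x).hasFDerivWithinAt
  have hinj : ∀ j, InjOn (T.Psi m a j) (openSimplex d) :=
    fun j => (hT.injOn j).mono openSimplex_subset
  have hS := (isOpen_openSimplex (d := d)).measurableSet
  have hmeas : ∀ j, MeasurableSet (T.Psi m a j '' openSimplex d) := fun j =>
    measurable_image_of_fderivWithin hS (hfd j) (hinj j)
  have hint : ∀ j, IntegrableOn (fun x => |(fderiv ℝ (T.Psi m a j) x).det| • g j x)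
      (openSimplex d) := by
    intro j
    have hc : ContinuousOn (fun x => |(fderiv ℝ (T.Psi m a j) x).det| • g j x) (refSimplex d) :=
      ContinuousOn.smul ((ContinuousLinearMap.continuous_det.comp
        (continuous_fderiv_Psi j)).abs.continuousOn) (hg j)
    exact (hc.integrableOn_compact isCompact_refSimplex).mono_set openSimplex_subset
  have hcongr : ∀ j, EqOn (fun x => |(fderiv ℝ (T.Psi m a j) x).det| • g j x)
      (fun x => |(fderiv ℝ (T.Psi m a j) x).det| • f (T.Psi m a j x)) (openSimplex d) :=
    fun j x hx => by simp only [h j x hx]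
  have hint' : ∀ j, IntegrableOn f (T.Psi m a j '' openSimplex d) := fun j => by
    rw [integrableOn_image_iff_integrableOn_abs_det_fderiv_smul volume hS (hfd j) (hinj j)]
    exact (hint j).congr_fun (hcongr j) hS
  have hdisj : Pairwise (Function.onFun Disjoint fun j => T.Psi m a j '' openSimplex d) := by
    intro j k hjk
    rw [Function.onFun, Set.disjoint_left]
    rintro _ ⟨x, hx, rfl⟩ ⟨y, hy, hxy⟩
    exact hjk (T.eq_of_push_bary_eq hx (hT.conforming j k x (openSimplex_subset hx) y
      (openSimplex_subset hy) hxy.symm)).1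
  constructor
  · rw [IntegrableOn, ← Measure.restrict_congr_set (cellInteriors_ae_eq_domain (T := T))]
    exact integrableOn_finite_iUnion.2 hint'
  · rw [← setIntegral_congr_set (cellInteriors_ae_eq_domain (T := T)), cellInteriors,
      integral_iUnion_fintype hmeas hdisj hint']
    refine Finset.sum_congr rfl fun j _ => ?_
    rw [integral_image_eq_integral_abs_det_fderiv_smul volume hS (hfd j) (hinj j)]
    exact (setIntegral_congr_fun hS (hcongr j)).symm

/-! ### Piecewise continuous and piecewise smooth functions -/

/-- The function `f` coincides in the interior of each cell with a function which is continuous on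
the closed cell, as seen on the reference simplex. -/
def PiecewiseContinuous {X : Type*} [TopologicalSpace X] (T : Connectivity d V J) (m : ℕ)
    (a : (V → ℕ) → E d) (f : E d → X) : Prop :=
  ∀ j, ∃ g : E d → X, ContinuousOn g (refSimplex d) ∧
    ∀ x ∈ openSimplex d, f (T.Psi m a j x) = g x

/-- On each closed cell, the function `f` is `P ∘ Ψ_j⁻¹` with a `C¹` function `P`. -/
def PiecewiseSmooth (T : Connectivity d V J) (m : ℕ) (a : (V → ℕ) → E d) (f : E d → F) : Prop :=
  ∀ j, ∃ P : E d → F, ContDiff ℝ 1 P ∧ ∀ x ∈ refSimplex d, f (T.Psi m a j x) = P x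

section

variable {X Y : Type*} [TopologicalSpace X] [TopologicalSpace Y]

lemma PiecewiseContinuous.comp {f : E d → X} (hf : T.PiecewiseContinuous m a f) {φ : X → Y}
    (hφ : Continuous φ) : T.PiecewiseContinuous m a fun y => φ (f y) := fun j => by
  obtain ⟨g, hg, h⟩ := hf j
  exact ⟨fun x => φ (g x), hφ.comp_continuousOn hg, fun x hx => by simp only [h x hx]⟩

lemma PiecewiseContinuous.prodMk {f : E d → X} {g : E d → Y} (hf : T.PiecewiseContinuous m a f)
    (hg : T.PiecewiseContinuous m a g) : T.PiecewiseContinuous m a fun y => (f y, g y) :=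
  fun j => by
    obtain ⟨f', hf', h⟩ := hf j
    obtain ⟨g', hg', h'⟩ := hg j
    exact ⟨fun x => (f' x, g' x), hf'.prodMk hg', fun x hx => by simp only [h x hx, h' x hx]⟩

end

lemma PiecewiseContinuous.integrableOn [Fintype V] [Fintype J] (hT : T.IsMesh m B a) {f : E d → F}
    (hf : T.PiecewiseContinuous m a f) : IntegrableOn f (T.domain m a) := by
  choose g hg h using hf
  exact (hT.integral_domain hg h).1

lemma PiecewiseSmooth.piecewiseContinuous {f : E d → F} (hf : T.PiecewiseSmooth m a f) :
    T.PiecewiseContinuous m a f := fun j => by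
  obtain ⟨P, hP, h⟩ := hf j
  exact ⟨P, hP.continuous.continuousOn, fun x hx => h x (openSimplex_subset hx)⟩

lemma PiecewiseSmooth.comp {f : E d → F} (hf : T.PiecewiseSmooth m a f) {φ : F → G}
    (hφ : ContDiff ℝ 1 φ) : T.PiecewiseSmooth m a fun y => φ (f y) := fun j => by
  obtain ⟨P, hP, h⟩ := hf j
  exact ⟨fun x => φ (P x), hφ.comp hP, fun x hx => by simp only [h x hx]⟩

lemma PiecewiseSmooth.prodMk {f : E d → F} {g : E d → G} (hf : T.PiecewiseSmooth m a f)
    (hg : T.PiecewiseSmooth m a g) : T.PiecewiseSmooth m a fun y => (f y, g y) :=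
  fun j => by
    obtain ⟨f', hf', h⟩ := hf j
    obtain ⟨g', hg', h'⟩ := hg j
    exact ⟨fun x => (f' x, g' x), hf'.prodMk hg', fun x hx => by simp only [h x hx, h' x hx]⟩

lemma IsMesh.hasFDerivAt (hT : T.IsMesh m B a) {f P : E d → F} {j : J} (hP : ContDiff ℝ 1 P)
    (h : ∀ x ∈ openSimplex d, f (T.Psi m a j x) = P x) {x : E d} (hx : x ∈ openSimplex d) :
    HasFDerivAt f (fderiv ℝ P x ∘L (fderiv ℝ (T.Psi m a j) x).inverse) (T.Psi m a j x) :=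
  hasFDerivAt_of_comp_eventuallyEq (T.contDiff_Psi a j)
    (hT.nondegenerate j x (openSimplex_subset hx))
    (hP.differentiable one_ne_zero x).hasFDerivAt
    (Filter.mem_of_superset (isOpen_openSimplex.mem_nhds hx) h)

lemma PiecewiseSmooth.differentiableAt (hT : T.IsMesh m B a) {f : E d → F}
    (hf : T.PiecewiseSmooth m a f) (j : J) {x : E d} (hx : x ∈ openSimplex d) :
    DifferentiableAt ℝ f (T.Psi m a j x) := by
  obtain ⟨P, hP, h⟩ := hf j
  exact (hT.hasFDerivAt hP (fun x hx => h x (openSimplex_subset hx)) hx).differentiableAt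

lemma IsMesh.continuousOn_inverse_fderiv (hT : T.IsMesh m B a) (j : J) :
    ContinuousOn (fun x => (fderiv ℝ (T.Psi m a j) x).inverse) (refSimplex d) := by
  intro x hx
  refine ContinuousAt.continuousWithinAt ?_
  have h : (fderiv ℝ (T.Psi m a j) x).IsInvertible :=
    ⟨(fderiv ℝ (T.Psi m a j) x).toContinuousLinearEquivOfDetNeZero (hT.nondegenerate j x hx),
      ContinuousLinearMap.coe_toContinuousLinearEquivOfDetNeZero _ _⟩
  exact ContinuousAt.comp (f := fun x => fderiv ℝ (T.Psi m a j) x)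
    (h.contDiffAt_map_inverse (n := 0)).continuousAt (continuous_fderiv_Psi j).continuousAt

lemma PiecewiseSmooth.piecewiseContinuous_fderiv (hT : T.IsMesh m B a) {f : E d → F}
    (hf : T.PiecewiseSmooth m a f) : T.PiecewiseContinuous m a (fderiv ℝ f) := fun j => by
  obtain ⟨P, hP, h⟩ := hf j
  exact ⟨_, ((hP.continuous_fderiv one_ne_zero).continuousOn).clm_comp
    (hT.continuousOn_inverse_fderiv j),
    fun x hx => (hT.hasFDerivAt hP (fun x hx => h x (openSimplex_subset hx)) hx).fderiv⟩

lemma _root_.FSI.contDiff_eval {n : WithTop ℕ∞} (P : MvPolynomial (Fin d) ℝ) :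
    ContDiff ℝ n fun x : E d => MvPolynomial.eval (fun i => x i) P := by
  simp only [MvPolynomial.eval_eq']
  refine ContDiff.sum fun β _ => contDiff_const.mul (contDiff_prod fun i _ => ?_)
  fun_prop

lemma IsFE.piecewiseSmooth {k : ℕ} {f : E d → ℝ} (hf : T.IsFE m a k f) :
    T.PiecewiseSmooth m a f := fun j => by
  obtain ⟨P, -, h⟩ := hf.2 j
  exact ⟨_, contDiff_eval P, h⟩

lemma IsVecFE.piecewiseSmooth {k : ℕ} {f : E d → E d} (hf : T.IsVecFE m a k f) :
    T.PiecewiseSmooth m a f := fun j => by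
  choose P hP h using fun i => (hf i).2 j
  refine ⟨fun x => WithLp.toLp 2 fun i => MvPolynomial.eval (fun i => x i) (P i), ?_, ?_⟩
  · rw [contDiff_euclidean]
    exact fun i => contDiff_eval (P i)
  · intro x hx
    ext i
    exact h i x hx

end Connectivity

end

/-! ### The moving mesh, seen from the reference simplex -/

section

variable {d m : ℕ} {V J : Type*}

namespace Connectivity

variable {T : Connectivity d V J} {B : Finset (Finset V)} {a : (V → ℕ) → E d}
  {s Δt t : ℝ} {aOld aNew : (V → ℕ) → E d}

/-- Functions which are given on the cells are well defined on the meshed domain if they depend on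
the cell and the local point only through the global barycentric coordinates. -/
lemma IsMesh.onCells_Psi {X : Type*} [Zero X] (hT : T.IsMesh m B a) {g : J → E d → X}
    (hg : ∀ j k x y, T.push j (bary x) = T.push k (bary y) → g j x = g k y) {j : J} {x : E d}
    (hx : x ∈ refSimplex d) : T.onCells m a g (T.Psi m a j x) = g j x := by
  have h : ∃ q : J × E d, q.2 ∈ refSimplex d ∧ T.Psi m a q.1 q.2 = T.Psi m a j x := ⟨(j, x), hx, rfl⟩
  rw [onCells, dif_pos h]
  exact hg _ _ _ _ (hT.conforming _ _ _ h.choose_spec.1 _ hx h.choose_spec.2)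

lemma _root_.FSI.interp_start (hΔt : Δt ≠ 0) : interp s Δt aOld aNew s = aOld := by
  ext1 i; simp [interp, hΔt]

lemma _root_.FSI.interp_end (hΔt : Δt ≠ 0) : interp s Δt aOld aNew (s + Δt) = aNew := by
  ext1 i; simp [interp, hΔt]

lemma Psi_interp (j : J) (x : E d) : T.Psi m (interp s Δt aOld aNew t) j x =
    ((t - s) / Δt) • T.Psi m aNew j x + ((s + Δt - t) / Δt) • T.Psi m aOld j x := by
  rw [← T.Psi_smul, ← T.Psi_smul, ← T.Psi_add]
  rfl

variable [Fintype V]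

lemma IsMesh.Phi_Psi (hT : T.IsMesh m B aNew) {j : J} {x : E d} (hx : x ∈ refSimplex d) :
    T.Phi m s Δt aOld aNew (T.Psi m aNew j x) t = T.Psi m (interp s Δt aOld aNew t) j x := by
  rw [Phi, hT.onCells_Psi (fun _ _ _ _ h => T.Psi_congr aOld h) hx, Psi_interp]

lemma IsMesh.domainAt_eq (hT : T.IsMesh m B aNew) :
    T.domainAt m s Δt aOld aNew t = T.domain m (interp s Δt aOld aNew t) := by
  rw [domainAt, domain, domain, image_iUnion]
  refine iUnion_congr fun j => ?_
  rw [image_image]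
  exact image_congr fun x hx => hT.Phi_Psi hx

lemma IsMesh.injOn_Phi (hT : T.IsMesh m B aNew) (ht : T.IsMesh m B (interp s Δt aOld aNew t)) :
    InjOn (fun x => T.Phi m s Δt aOld aNew x t) (T.domain m aNew) := by
  intro y hy z hz hyz
  obtain ⟨j, x, hx, rfl⟩ := mem_iUnion.1 hy
  obtain ⟨k, x', hx', rfl⟩ := mem_iUnion.1 hz
  simp only [hT.Phi_Psi hx, hT.Phi_Psi hx'] at hyz
  exact T.Psi_congr aNew (ht.conforming _ _ _ hx _ hx' hyz)

lemma IsMesh.backward_Psi {X : Type*} (hT : T.IsMesh m B aNew)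
    (ht : T.IsMesh m B (interp s Δt aOld aNew t)) (f : E d → X) {j : J} {x : E d}
    (hx : x ∈ refSimplex d) :
    T.backward m s Δt aOld aNew f t (T.Psi m (interp s Δt aOld aNew t) j x) =
      f (T.Psi m aNew j x) := by
  rw [backward, ← hT.Phi_Psi hx]
  exact congrArg f ((hT.injOn_Phi ht).leftInvOn_invFunOn (mem_domain hx))

lemma IsMesh.meshVelocity_Psi (hT : T.IsMesh m B aNew) {j : J} {x : E d}
    (hx : x ∈ refSimplex d) :
    T.meshVelocity m s Δt aOld aNew (T.Psi m aNew j x) =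
      Δt⁻¹ • (T.Psi m aNew j x - T.Psi m aOld j x) := by
  simp only [meshVelocity, hT.Phi_Psi hx, Psi_interp]
  have h1 : HasDerivAt (fun t => ((t - s) / Δt)) (1 / Δt) (s + Δt) :=
    ((hasDerivAt_id _).sub_const s).div_const Δt
  have h2 : HasDerivAt (fun t => ((s + Δt - t) / Δt)) (-1 / Δt) (s + Δt) :=
    ((hasDerivAt_id _).const_sub (s + Δt)).div_const Δt
  refine ((h1.smul_const (T.Psi m aNew j x)).add (h2.smul_const (T.Psi m aOld j x))).deriv.trans ?_
  rw [smul_sub, neg_div, neg_smul, one_div, sub_eq_add_neg]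

lemma IsMesh.forward_Psi [Fintype J] (hT : T.IsMesh m B aNew)
    (ht : T.IsMesh m B (interp s Δt aOld aNew t)) (u : E d → E d) {j : J} {x : E d}
    (hx : x ∈ refSimplex d) :
    T.forward m s Δt aOld aNew u t (T.Psi m (interp s Δt aOld aNew t) j x) =
      T.Psi m (fun i => u (aOld i)) j x := by
  have h : ∃ q : J × E d, q.2 ∈ refSimplex d ∧ T.Psi m aNew q.1 q.2 = T.Psi m aNew j x :=
    ⟨(j, x), hx, rfl⟩
  simp only [forward, hT.backward_Psi ht _ hx, basis, onCells, dif_pos h]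
  rw [T.Psi_congr (fun i => u (aOld i))
    (hT.conforming _ _ _ hx _ h.choose_spec.1 h.choose_spec.2.symm)]
  generalize h.choose = q
  simp only [Finset.sum_smul, Psi]
  rw [Finset.sum_comm]
  refine Finset.sum_congr rfl fun α hα => ?_
  rw [Finset.sum_eq_single (T.node q.1 α)]
  · simp
  · intro i _ hi
    rw [if_neg (Ne.symm hi), zero_smul]
  · intro hn
    refine absurd ?_ hn
    simp only [nodes, Finset.mem_image]
    exact ⟨(q.1, α), Finset.mem_product.2 ⟨Finset.mem_univ _, hα⟩, rfl⟩

end Connectivity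

end

/-! ### The divergence theorem on a meshed domain -/

section

section Lipschitz

variable {E F : Type*} [NormedAddCommGroup E] [NormedSpace ℝ E] [PseudoMetricSpace F]

/-- A function on a normed space which satisfies the Lipschitz inequality between each point and the
nearby points is Lipschitz. -/
lemma lipschitzWith_of_forall_eventually {f : E → F} {L : ℝ≥0}
    (h : ∀ x, ∀ᶠ y in 𝓝 x, dist (f y) (f x) ≤ L * dist y x) : LipschitzWith L f := by
  have hc : Continuous f := by
    rw [continuous_iff_continuousAt]
    intro x
    rw [ContinuousAt, tendsto_iff_dist_tendsto_zero]
    refine squeeze_zero' (Eventually.of_forall fun _ => dist_nonneg) (h x) ?_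
    have : Continuous fun y => L * dist y x := by fun_prop
    simpa using this.tendsto x
  refine LipschitzWith.of_dist_le_mul fun y x => ?_
  set γ : ℝ → E := fun s => x + s • (y - x) with hγ
  have hγc : Continuous γ := by fun_prop
  have hγd : ∀ s s', dist (γ s) (γ s') = |s - s'| * dist y x := fun s s' => by
    rw [hγ, dist_eq_norm, dist_eq_norm, add_sub_add_left_eq_sub, ← sub_smul, norm_smul,
      Real.norm_eq_abs]
  have key : Icc (0 : ℝ) 1 ⊆ {s | dist (f (γ s)) (f x) ≤ L * (s * dist y x)} := by
    refine IsClosed.Icc_subset_of_forall_exists_gt ?_ ?_ ?_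
    · refine IsClosed.inter ?_ isClosed_Icc
      exact isClosed_le (f := fun s => dist (f (γ s)) (f x))
        (g := fun s => L * (s * dist y x)) (by fun_prop) (by fun_prop)
    · simp [hγ]
    · rintro s ⟨hs, -⟩ s' hs'
      have h1 : ∀ᶠ r in 𝓝[>] s, dist (f (γ r)) (f (γ s)) ≤ L * dist (γ r) (γ s) :=
        (hγc.continuousAt.eventually (h (γ s))).filter_mono nhdsWithin_le_nhds
      obtain ⟨r, hr, hr'⟩ := (h1.and (Ioc_mem_nhdsGT hs')).exists
      refine ⟨r, ?_, hr'⟩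
      rw [hγd, abs_of_pos (sub_pos.2 hr'.1)] at hr
      calc dist (f (γ r)) (f x) ≤ dist (f (γ r)) (f (γ s)) + dist (f (γ s)) (f x) :=
            dist_triangle _ _ _
        _ ≤ L * ((r - s) * dist y x) + L * (s * dist y x) := add_le_add hr hs
        _ = L * (r * dist y x) := by ring
  simpa [hγ] using key (right_mem_Icc.2 zero_le_one)

/-- A function which is Lipschitz on each set of a finite closed cover is Lipschitz. -/
lemma lipschitzWith_of_finite_closed_cover {ι : Type*} [Finite ι] {A : ι → Set E}
    (hA : ∀ i, IsClosed (A i)) (hcov : ⋃ i, A i = univ) {f : E → F} {L : ℝ≥0}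
    (h : ∀ i, LipschitzOnWith L f (A i)) : LipschitzWith L f := by
  refine lipschitzWith_of_forall_eventually fun x => ?_
  have h1 : ∀ᶠ y in 𝓝 x, ∀ i, x ∉ A i → y ∉ A i := by
    rw [eventually_all]
    intro i
    by_cases hx : x ∈ A i
    · simp [hx]
    · filter_upwards [(hA i).isOpen_compl.mem_nhds hx] with y hy _ using hy
  filter_upwards [h1] with y hy
  obtain ⟨i, hi⟩ := mem_iUnion.1 (hcov ▸ mem_univ y : y ∈ ⋃ i, A i)
  exact (h i).dist_le_mul y hi x (by_contra fun hx => hy i hx hi)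

end Lipschitz

variable {d m : ℕ} {V J : Type*}

lemma fderiv_apply_coord {b : E d → E d} {y : E d} (hb : DifferentiableAt ℝ b y) (i : Fin d)
    (v : E d) : fderiv ℝ (fun x => b x i) y v = (fderiv ℝ b y v) i := by
  have := ((EuclideanSpace.proj (𝕜 := ℝ) i : E d →L[ℝ] ℝ).hasFDerivAt.comp _ hb.hasFDerivAt)
  have h2 : fderiv ℝ (fun y => b y i) y = _ := this.fderiv
  rw [h2]
  rfl

namespace Connectivity

variable {T : Connectivity d V J} {B : Finset (Finset V)} {a : (V → ℕ) → E d}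

lemma PiecewiseSmooth.exists_lipschitzOnWith {F : Type*} [NormedAddCommGroup F] [NormedSpace ℝ F]
    (hT : T.IsMesh m B a) {f : E d → F} (hf : T.PiecewiseSmooth m a f) (j : J) :
    ∃ L : ℝ≥0, LipschitzOnWith L f (T.Psi m a j '' refSimplex d) := by
  obtain ⟨P, hP, h⟩ := hf j
  obtain ⟨L, hL⟩ := hP.contDiffOn.exists_lipschitzOnWith one_ne_zero convex_refSimplex
    isCompact_refSimplex
  obtain ⟨L', hL', h'⟩ := exists_dist_le_mul_dist_image (T.contDiff_Psi a j) isCompact_refSimplex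
    (hT.nondegenerate j) (hT.injOn j)
  refine ⟨L * L'.toNNReal, LipschitzOnWith.of_dist_le_mul ?_⟩
  rintro _ ⟨x, hx, rfl⟩ _ ⟨y, hy, rfl⟩
  rw [h x hx, h y hy, NNReal.coe_mul, Real.coe_toNNReal _ hL', mul_assoc]
  exact (hL.dist_le_mul x hx y hy).trans (mul_le_mul_of_nonneg_left (h' x hx y hy) L.2)

/-- Extended by zero, a piecewise smooth function which vanishes on the boundary is Lipschitz. -/
lemma PiecewiseSmooth.exists_lipschitzWith_indicator {F : Type*} [NormedAddCommGroup F]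
    [NormedSpace ℝ F] [Finite J] (hT : T.IsMesh m B a) {f : E d → F}
    (hf : T.PiecewiseSmooth m a f) (h0 : ∀ y ∈ frontier (T.domain m a), f y = 0) :
    ∃ L : ℝ≥0, LipschitzWith L ((T.domain m a).indicator f) := by
  have := Fintype.ofFinite J
  choose L hL using fun j => hf.exists_lipschitzOnWith hT j
  refine ⟨∑ j, L j, lipschitzWith_of_finite_closed_cover (ι := Option J)
    (A := fun i => i.elim (closure (T.domain m a)ᶜ) fun j => T.Psi m a j '' refSimplex d) ?_ ?_ ?_⟩
  · rintro (_ | j)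
    · exact isClosed_closure
    · exact (isCompact_refSimplex.image (T.contDiff_Psi (n := 1) a j).continuous).isClosed
  · rw [iUnion_option, eq_univ_iff_forall]
    intro y
    by_cases hy : y ∈ T.domain m a
    · exact Or.inr hy
    · exact Or.inl (subset_closure hy)
  · rintro (_ | j)
    · have hz : ∀ y ∈ closure (T.domain m a)ᶜ, (T.domain m a).indicator f y = 0 := by
        intro y hy
        by_cases hy' : y ∈ T.domain m a
        · rw [indicator_of_mem hy', h0 y]
          rw [frontier_eq_closure_inter_closure]
          exact ⟨subset_closure hy', hy⟩
        · exact indicator_of_notMem hy' f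
      refine LipschitzOnWith.of_dist_le_mul fun y hy z hz' => ?_
      rw [hz y hy, hz z hz', dist_self]
      positivity
    · refine LipschitzOnWith.of_dist_le_mul fun y hy z hz => ?_
      have hsub : T.Psi m a j '' refSimplex d ⊆ T.domain m a := subset_iUnion_of_subset j subset_rfl
      rw [indicator_of_mem (hsub hy), indicator_of_mem (hsub hz)]
      refine ((hL j).dist_le_mul y hy z hz).trans (mul_le_mul_of_nonneg_right ?_ dist_nonneg)
      exact_mod_cast Finset.single_le_sum (f := L) (fun _ _ => zero_le) (Finset.mem_univ j)

lemma PiecewiseSmooth.integral_fderiv_eq_zero [Fintype V] [Fintype J] (hT : T.IsMesh m B a)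
    {f : E d → ℝ} (hf : T.PiecewiseSmooth m a f) (h0 : ∀ y ∈ frontier (T.domain m a), f y = 0)
    (v : E d) : ∫ y in T.domain m a, fderiv ℝ f y v = 0 := by
  obtain ⟨L, hL⟩ := hf.exists_lipschitzWith_indicator hT h0
  have hsupp : HasCompactSupport ((T.domain m a).indicator f) :=
    HasCompactSupport.intro (isCompact_domain (T := T) (m := m) (a := a)) fun y hy => indicator_of_notMem hy f
  have h1 := LipschitzWith.integral_lineDeriv_mul_eq (μ := volume)
    (LipschitzWith.const (1 : ℝ) : LipschitzWith 0 fun _ : E d => (1 : ℝ)) hL hsupp (-v)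
  have h2 : ∀ y : E d, lineDeriv ℝ (fun _ : E d => (1 : ℝ)) y (-v) = 0 := fun y => by
    simp [lineDeriv]
  simp only [h2, zero_mul, integral_zero, neg_neg, mul_one] at h1
  rw [h1, ← setIntegral_eq_integral_of_forall_compl_eq_zero (s := T.domain m a)
    (f := fun y => lineDeriv ℝ ((T.domain m a).indicator f) y v)]
  · refine integral_congr_ae (ae_restrict_domain fun j x hx => ?_)
    obtain ⟨P, hP, h⟩ := hf j
    have e1 := hT.hasFDerivAt hP (fun x hx => h x (openSimplex_subset hx)) hx
    have e2 := hT.hasFDerivAt (f := (T.domain m a).indicator f) hP (fun x hx => by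
      rw [indicator_of_mem (mem_domain (openSimplex_subset hx)), h x (openSimplex_subset hx)]) hx
    beta_reduce
    rw [e1.fderiv, (e2.hasLineDerivAt v).lineDeriv]
  · intro y hy
    have : (T.domain m a).indicator f =ᶠ[𝓝 y] fun _ => 0 := by
      filter_upwards [(isCompact_domain (T := T) (m := m) (a := a)).isClosed.isOpen_compl.mem_nhds hy] with z hz
      exact indicator_of_notMem hz f
    rw [this.lineDeriv_eq]
    simp [lineDeriv]

/-- The divergence theorem for piecewise smooth fields which vanish on the boundary. -/
lemma PiecewiseSmooth.integral_diverg_eq_zero [Fintype V] [Fintype J] (hT : T.IsMesh m B a)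
    {f : E d → E d} (hf : T.PiecewiseSmooth m a f)
    (h0 : ∀ y ∈ frontier (T.domain m a), f y = 0) : ∫ y in T.domain m a, diverg f y = 0 := by
  have hi : ∀ i : Fin d, T.PiecewiseSmooth m a fun y => f y i := fun i =>
    hf.comp (φ := fun z : E d => z i) (by fun_prop)
  have h1 : ∫ y in T.domain m a, diverg f y =
      ∫ y in T.domain m a, ∑ i, fderiv ℝ (fun y => f y i) y (e i) := by
    refine integral_congr_ae (ae_restrict_domain fun j x hx => ?_)
    refine Finset.sum_congr rfl fun i _ => ?_
    exact (fderiv_apply_coord (hf.differentiableAt hT j hx) i _).symm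
  rw [h1, integral_finsetSum]
  · exact Finset.sum_eq_zero fun i _ => (hi i).integral_fderiv_eq_zero hT
      (fun y hy => by rw [h0 y hy]; rfl) _
  · intro i _
    exact (((hi i).piecewiseContinuous_fderiv hT).comp (φ := fun A : E d →L[ℝ] ℝ => A (e i))
      (by fun_prop)).integrableOn hT

end Connectivity

end

/-! ### Exactness of the quadrature in time -/

section

variable {d m : ℕ} {V J : Type*}

/-- `∑_i (A e_i)_i` is the trace of `A`. -/
lemma sum_apply_e_eq_trace (A : E d →L[ℝ] E d) :
    ∑ i, (A (e i)) i = LinearMap.trace ℝ (E d) A := by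
  rw [LinearMap.trace_eq_matrix_trace ℝ (EuclideanSpace.basisFun (Fin d) ℝ).toBasis, Matrix.trace]
  refine Finset.sum_congr rfl fun i _ => ?_
  simp [LinearMap.toMatrix_apply, e]

/-- The determinant is a polynomial of degree at most `d` along a line. -/
lemma exists_polynomial_det (A B : E d →L[ℝ] E d) :
    ∃ p : Polynomial ℝ, p.natDegree ≤ d ∧ ∀ θ : ℝ, p.eval θ = (A + θ • B).det := by
  set b := (EuclideanSpace.basisFun (Fin d) ℝ).toBasis
  set MA := LinearMap.toMatrix b b (A : E d →ₗ[ℝ] E d)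
  set MB := LinearMap.toMatrix b b (B : E d →ₗ[ℝ] E d)
  refine ⟨Matrix.det ((Polynomial.X : Polynomial ℝ) • MB.map Polynomial.C +
    MA.map Polynomial.C), ?_, fun θ => ?_⟩
  · simpa using Polynomial.natDegree_det_X_add_C_le MB MA
  · rw [← Polynomial.coe_evalRingHom, RingHom.map_det, ContinuousLinearMap.det,
      ← LinearMap.det_toMatrix b]
    congr 1
    ext i j
    simp [MA, MB, LinearMap.toMatrix_apply, add_comm, mul_comm θ]

/-- Jacobi's formula. -/
lemma hasDerivAt_det (A B : E d →L[ℝ] E d) (θ : ℝ) (h : (A + θ • B).det ≠ 0) :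
    HasDerivAt (fun r : ℝ => (A + r • B).det)
      ((A + θ • B).det * ∑ i, ((B ∘L (A + θ • B).inverse) (e i)) i) θ := by
  set M := A + θ • B with hM
  set b := (EuclideanSpace.basisFun (Fin d) ℝ).toBasis
  set N : E d →L[ℝ] E d := M.inverse ∘L B with hN
  set MN := LinearMap.toMatrix b b (N : E d →ₗ[ℝ] E d)
  have hinv : M ∘L M.inverse = ContinuousLinearMap.id ℝ _ := by
    obtain ⟨A', hA'⟩ : ∃ A' : E d ≃L[ℝ] E d, (A' : E d →L[ℝ] E d) = M :=
      ⟨_, ContinuousLinearMap.coe_toContinuousLinearEquivOfDetNeZero M h⟩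
    rw [← hA', ContinuousLinearMap.inverse_equiv]
    simp
  have hMN : M ∘L N = B := by
    rw [hN, ← ContinuousLinearMap.comp_assoc, hinv, ContinuousLinearMap.id_comp]
  have htr : ∑ i, ((B ∘L M.inverse) (e i)) i = MN.trace := by
    rw [sum_apply_e_eq_trace, ← LinearMap.trace_eq_matrix_trace ℝ b]
    exact LinearMap.trace_mul_comm ℝ (B : E d →ₗ[ℝ] E d) (M.inverse : E d →ₗ[ℝ] E d)
  have hdet : ∀ r : ℝ, (A + r • B).det = M.det * (1 + (r - θ) • MN).det := by
    intro r
    have h1 : A + r • B = M ∘L (ContinuousLinearMap.id ℝ _ + (r - θ) • N) := by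
      rw [ContinuousLinearMap.comp_add, ContinuousLinearMap.comp_id, ContinuousLinearMap.comp_smul,
        hMN, hM]
      module
    rw [h1]
    have h2 : (1 + (r - θ) • MN).det =
        (ContinuousLinearMap.id ℝ (E d) + (r - θ) • N).det := by
      rw [ContinuousLinearMap.det, ← LinearMap.det_toMatrix b]
      congr 1
      ext i j
      simp [MN, LinearMap.toMatrix_apply, Matrix.one_apply, b]
    rw [h2]
    exact LinearMap.det_comp (M : E d →ₗ[ℝ] E d) _
  set R := (Matrix.det (1 + (Polynomial.X : Polynomial ℝ) • MN.map Polynomial.C)).divX.divX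
  have hdet' : (fun r : ℝ => (A + r • B).det) = fun r =>
      M.det * (1 + MN.trace * (r - θ) + R.eval (r - θ) * (r - θ) ^ 2) :=
    funext fun r => by rw [hdet, Matrix.det_one_add_smul]
  rw [htr, hdet']
  have h1 : HasDerivAt (fun r : ℝ => r - θ) 1 θ := (hasDerivAt_id θ).sub_const θ
  have h2 : HasDerivAt (fun r : ℝ => R.eval (r - θ)) (R.derivative.eval (θ - θ) * 1) θ :=
    HasDerivAt.comp (h₂ := fun y => R.eval y) (h := fun r : ℝ => r - θ) θ
      (R.hasDerivAt (θ - θ)) h1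
  have h3 := (((h1.const_mul MN.trace).const_add 1).add (h2.mul (h1.pow 2))).const_mul M.det
  refine h3.congr_deriv ?_
  simp

/-- The midpoint rule is exact for the derivative of a quadratic polynomial. -/
lemma eval_one_sub_eval_zero_of_natDegree_le_two {p : Polynomial ℝ} (hp : p.natDegree ≤ 2) :
    p.eval 1 - p.eval 0 = p.derivative.eval (1 / 2) := by
  rw [p.as_sum_range' 3 (by omega)]
  simp [Finset.sum_range_succ]
  ring

/-- The two-point Gauss rule is exact for the derivative of a cubic polynomial. -/
lemma eval_one_sub_eval_zero_of_natDegree_le_three {p : Polynomial ℝ} (hp : p.natDegree ≤ 3) :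
    p.eval 1 - p.eval 0 = 1 / 2 * p.derivative.eval (1 / 2 - 1 / (2 * √3)) +
      1 / 2 * p.derivative.eval (1 / 2 + 1 / (2 * √3)) := by
  have h3 : (1 / (2 * √3)) ^ 2 = 1 / 12 := by
    rw [div_pow, mul_pow, Real.sq_sqrt (by norm_num)]; norm_num
  generalize 1 / (2 * √3) = s at h3
  rw [p.as_sum_range' 4 (by omega)]
  simp [Finset.sum_range_succ]
  linear_combination (-3 * p.coeff 3) * h3

/-- The rate of change of `|det (A + θ B)|`, by Jacobi's formula. -/
def detRate (A B : E d →L[ℝ] E d) (θ : ℝ) : ℝ :=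
  |(A + θ • B).det| * ∑ i, ((B ∘L (A + θ • B).inverse) (e i)) i

/-- The quadrature in time is exact for the rate of change of the volume element. -/
lemma abs_det_sub_abs_det_eq_quadrature (hd : d = 2 ∨ d = 3) (A B : E d →L[ℝ] E d)
    (h : ∀ θ ∈ Icc (0 : ℝ) 1, (A + θ • B).det ≠ 0) :
    |(A + B).det| - |A.det| =
      if d = 2 then detRate A B (1 / 2)
      else 1 / 2 * detRate A B (1 / 2 - 1 / (2 * √3)) +
        1 / 2 * detRate A B (1 / 2 + 1 / (2 * √3)) := by
  obtain ⟨p, hp, hpe⟩ := exists_polynomial_det A B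
  have hder : ∀ θ ∈ Icc (0 : ℝ) 1, p.derivative.eval θ =
      (A + θ • B).det * ∑ i, ((B ∘L (A + θ • B).inverse) (e i)) i := by
    intro θ hθ
    have h1 := p.hasDerivAt θ
    rw [show (fun x => p.eval x) = fun θ => (A + θ • B).det from funext hpe] at h1
    exact h1.unique (hasDerivAt_det A B θ (h θ hθ))
  -- the determinant does not change its sign
  obtain ⟨σ, hσ⟩ : ∃ σ : ℝ, ∀ θ ∈ Icc (0 : ℝ) 1, |(A + θ • B).det| = σ * (A + θ • B).det := by
    have hc : ContinuousOn (fun θ : ℝ => (A + θ • B).det) (Icc 0 1) := by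
      rw [← funext hpe]; exact p.continuous.continuousOn
    rcases isPreconnected_Icc.image _ hc |>.ordConnected |> fun hoc =>
      (show (∀ θ ∈ Icc (0 : ℝ) 1, 0 < (A + θ • B).det) ∨
        ∀ θ ∈ Icc (0 : ℝ) 1, (A + θ • B).det < 0 by
        by_contra! hcon
        obtain ⟨⟨θ, hθ, h1⟩, θ', hθ', h2⟩ := hcon
        obtain ⟨r, hr, hr0⟩ := hoc.out ⟨θ, hθ, rfl⟩ ⟨θ', hθ', rfl⟩ ⟨h1, h2⟩
        exact h r hr hr0) with hpos | hneg
    · exact ⟨1, fun θ hθ => by rw [abs_of_pos (hpos θ hθ), one_mul]⟩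
    · exact ⟨-1, fun θ hθ => by rw [abs_of_neg (hneg θ hθ), neg_one_mul]⟩
  have hrate : ∀ θ ∈ Icc (0 : ℝ) 1, detRate A B θ = σ * p.derivative.eval θ := fun θ hθ => by
    rw [detRate, hσ θ hθ, hder θ hθ, mul_assoc]
  have h1 : |(A + B).det| = σ * p.eval 1 := by
    rw [hpe, ← hσ 1 (by simp)]
    congr 3
    module
  have h0 : |A.det| = σ * p.eval 0 := by
    rw [hpe, ← hσ 0 (by simp)]
    congr 2
    module
  rw [h0, h1, ← mul_sub]
  have hs : 1 / (2 * √3) ≤ 1 / 2 := by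
    apply one_div_le_one_div_of_le (by norm_num)
    nlinarith [Real.one_le_sqrt.2 (by norm_num : (1 : ℝ) ≤ 3)]
  have hs' : 0 ≤ 1 / (2 * √3) := by positivity
  rcases hd with rfl | rfl
  · rw [if_pos rfl, eval_one_sub_eval_zero_of_natDegree_le_two hp,
      hrate _ (by constructor <;> norm_num)]
  · rw [if_neg (by norm_num), eval_one_sub_eval_zero_of_natDegree_le_three hp,
      hrate _ ⟨by linarith, by linarith⟩, hrate _ ⟨by linarith, by linarith⟩]
    ring

end

/-! ### The convection terms tested with the velocity -/

section

variable {d m : ℕ} {V J : Type*}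

lemma sum_smul_e (b : E d) : ∑ j, b j • (e j : E d) = b := by
  ext i
  simp [e, Pi.single_apply]

lemma tensor_apply (a b z : E d) : tensor a b z = (inner ℝ b z : ℝ) • a := by
  simp [tensor]

lemma inner_e (b : E d) (j : Fin d) : (inner ℝ b (e j) : ℝ) = b j := by
  simp [e, EuclideanSpace.inner_single_right]

/-- `∇·(u ⊗ b) = (∇·b) u + (b·∇)u`. -/
lemma divTensor_tensor {u b : E d → E d} {y : E d} (hu : DifferentiableAt ℝ u y)
    (hb : DifferentiableAt ℝ b y) :
    divTensor (fun x => tensor (u x) (b x)) y = diverg b y • u y + fderiv ℝ u y (b y) := by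
  have hA : DifferentiableAt ℝ (fun x => tensor (u x) (b x)) y := by
    set L : Fin d → E d →L[ℝ] E d →L[ℝ] E d := fun j =>
      ContinuousLinearMap.smulRightL ℝ (E d) (E d) (EuclideanSpace.proj j) with hL
    have h1 : (fun x => tensor (u x) (b x)) = fun x => ∑ j, b x j • L j (u x) := by
      ext x z : 2
      rw [tensor_apply, PiLp.inner_apply]
      simp [hL, Finset.sum_smul, smul_smul, mul_comm]
    rw [h1]
    fun_prop
  have hj : ∀ j, (fderiv ℝ (fun x => tensor (u x) (b x)) y (e j)) (e j) =
      (fderiv ℝ b y (e j)) j • u y + b y j • fderiv ℝ u y (e j) := by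
    intro j
    have h1 : fderiv ℝ (fun x => tensor (u x) (b x) (e j)) y (e j) =
        (fderiv ℝ (fun x => tensor (u x) (b x)) y (e j)) (e j) := by
      rw [fderiv_clm_apply hA (differentiableAt_const _)]
      simp
    rw [← h1]
    simp only [tensor_apply, inner_e]
    have h2 : DifferentiableAt ℝ (fun x => b x j) y := by fun_prop
    rw [fderiv_fun_smul h2 hu]
    simp [fderiv_apply_coord hb, add_comm]
  rw [divTensor, Finset.sum_congr rfl fun j _ => hj j, Finset.sum_add_distrib, ← Finset.sum_smul]
  congr 1
  conv_rhs => rw [← sum_smul_e (b y)]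
  simp

/-- `∇·(|u|² b) = |u|² ∇·b + 2 u·(b·∇)u`. -/
lemma diverg_normSq_smul {u b : E d → E d} {y : E d} (hu : DifferentiableAt ℝ u y)
    (hb : DifferentiableAt ℝ b y) :
    diverg (fun x => ‖u x‖ ^ 2 • b x) y =
      ‖u y‖ ^ 2 * diverg b y + 2 * inner ℝ (u y) (fderiv ℝ u y (b y)) := by
  have hn := hu.hasFDerivAt.norm_sq
  have h1 := hn.smul hb.hasFDerivAt
  have h2 : fderiv ℝ (fun x => ‖u x‖ ^ 2 • b x) y = _ := h1.fderiv
  simp only [diverg, grad, h2]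
  conv_rhs => rw [← sum_smul_e (b y)]
  simp only [map_sum, map_smul, inner_sum, inner_smul_right, Finset.mul_sum,
    ← Finset.sum_add_distrib]
  refine Finset.sum_congr rfl fun i _ => ?_
  simp
  ring

lemma diverg_sub {b c : E d → E d} {y : E d} (hb : DifferentiableAt ℝ b y)
    (hc : DifferentiableAt ℝ c y) :
    diverg (fun x => b x - c x) y = diverg b y - diverg c y := by
  simp only [diverg, grad, fderiv_fun_sub hb hc]
  simp [Finset.sum_sub_distrib]

lemma continuous_sum_apply_e : Continuous fun A : E d →L[ℝ] E d => ∑ i, (A (e i)) i := by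
  fun_prop

namespace Connectivity

variable {T : Connectivity d V J} {B : Finset (Finset V)} {s Δt t : ℝ} {aOld aNew : (V → ℕ) → E d}
  {uOld u : E d → E d}

lemma PiecewiseSmooth.piecewiseContinuous_diverg {a : (V → ℕ) → E d} (hT : T.IsMesh m B a)
    {f : E d → E d} (hf : T.PiecewiseSmooth m a f) : T.PiecewiseContinuous m a (diverg f) :=
  (hf.piecewiseContinuous_fderiv hT).comp continuous_sum_apply_e

/-- The nodal values of the transport velocity `ū^{n-1} - w̄^n`. -/
def transportVelocity (Δt : ℝ) (aOld aNew : (V → ℕ) → E d) (uOld : E d → E d) (i : V → ℕ) : E d :=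
  uOld (aOld i) - Δt⁻¹ • (aNew i - aOld i)

lemma fderiv_Psi_interp {θ : ℝ} (hΔt : Δt ≠ 0) (j : J) (x : E d) :
    fderiv ℝ (T.Psi m (interp s Δt aOld aNew (s + θ * Δt)) j) x =
      fderiv ℝ (T.Psi m aOld j) x +
        θ • (fderiv ℝ (T.Psi m aNew j) x - fderiv ℝ (T.Psi m aOld j) x) := by
  have h1 : T.Psi m (interp s Δt aOld aNew (s + θ * Δt)) j =
      fun x => θ • T.Psi m aNew j x + (1 - θ) • T.Psi m aOld j x := by
    ext1 x
    rw [Psi_interp]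
    congr 2 <;> field_simp <;> ring
  rw [h1]
  refine HasFDerivAt.fderiv (((hasFDerivAt_Psi j x).const_smul θ).add
    ((hasFDerivAt_Psi j x).const_smul (1 - θ))) |>.trans ?_
  module

variable [Fintype V]

lemma piecewiseSmooth_backward (hT : T.IsMesh m B aNew)
    (ht : T.IsMesh m B (interp s Δt aOld aNew t)) (hu : T.PiecewiseSmooth m aNew u) :
    T.PiecewiseSmooth m (interp s Δt aOld aNew t) (T.backward m s Δt aOld aNew u t) := fun j => by
  obtain ⟨P, hP, h⟩ := hu j
  exact ⟨P, hP, fun x hx => by rw [hT.backward_Psi ht _ hx, h x hx]⟩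

variable [Fintype J]

/-- Tested with the velocity, the convection terms reduce to the rate of change of the kinetic
energy which is due to the mesh motion, since `(ū^{n-1} - w̄^n) |ū|²` vanishes on the boundary. -/
lemma IsMesh.convectionAt_eq_integral_diverg (hT : T.IsMesh m B aNew)
    (ht : T.IsMesh m B (interp s Δt aOld aNew t)) (hu : T.PiecewiseSmooth m aNew u)
    (h0 : ∀ F ∈ B, ∀ j, (F : Set V) ⊆ Set.range (T.vert j) → ∀ x ∈ refSimplex d,
      (∀ k, T.vert j k ∉ F → bary x k = 0) →
        u (T.Psi m aNew j x) = 0 ∨ T.Psi m (transportVelocity Δt aOld aNew uOld) j x = 0) :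
    T.convectionAt m s Δt aOld aNew uOld u u t =
      -(1 / 2) * ∫ y in T.domain m (interp s Δt aOld aNew t),
        diverg (T.backward m s Δt aOld aNew (T.meshVelocity m s Δt aOld aNew) t) y *
          ‖T.backward m s Δt aOld aNew u t y‖ ^ 2 := by
  set aMid := interp s Δt aOld aNew t with hat
  simp only [convectionAt, hT.domainAt_eq]
  rw [← hat]
  set ub := T.backward m s Δt aOld aNew u t with hub
  set wb := T.backward m s Δt aOld aNew (T.meshVelocity m s Δt aOld aNew) t with hwb
  set uf := T.forward m s Δt aOld aNew uOld t with huf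
  have sub : T.PiecewiseSmooth m aMid ub := piecewiseSmooth_backward hT ht hu
  have swb : T.PiecewiseSmooth m aMid wb := fun j =>
    ⟨fun x => Δt⁻¹ • (T.Psi m aNew j x - T.Psi m aOld j x), by
      have h1 := T.contDiff_Psi (m := m) (n := 1) aNew j
      have h2 := T.contDiff_Psi (m := m) (n := 1) aOld j
      fun_prop,
      fun x hx => by rw [hwb, hT.backward_Psi ht _ hx, hT.meshVelocity_Psi hx]⟩
  have suf : T.PiecewiseSmooth m aMid uf := fun j =>
    ⟨T.Psi m (fun i => uOld (aOld i)) j, T.contDiff_Psi _ j,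
      fun x hx => hT.forward_Psi ht uOld hx⟩
  have sb : T.PiecewiseSmooth m aMid fun x => uf x - wb x :=
    (suf.prodMk swb).comp (φ := fun q : E d × E d => q.1 - q.2) (by fun_prop)
  have sg : T.PiecewiseSmooth m aMid fun x => ‖ub x‖ ^ 2 • (uf x - wb x) :=
    (sub.prodMk sb).comp (φ := fun q : E d × E d => ‖q.1‖ ^ 2 • q.2)
      ((contDiff_fst.norm_sq ℝ).smul contDiff_snd)
  -- the transport velocity is the finite element function with the above nodal values
  have hb : ∀ j, ∀ x ∈ refSimplex d, uf (T.Psi m aMid j x) - wb (T.Psi m aMid j x) =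
      T.Psi m (transportVelocity Δt aOld aNew uOld) j x := by
    intro j x hx
    rw [huf, hwb, hT.forward_Psi ht uOld hx, hT.backward_Psi ht _ hx, hT.meshVelocity_Psi hx,
      ← T.Psi_sub, ← T.Psi_smul, ← T.Psi_sub]
    rfl
  have hbd : ∀ y ∈ frontier (T.domain m aMid), ‖ub y‖ ^ 2 • (uf y - wb y) = 0 := by
    rw [ht.boundary]
    rintro y ⟨F, hF, j, hFj, x, hx, hxF, rfl⟩
    rw [hb j x hx, hub, hT.backward_Psi ht _ hx]
    rcases h0 F hF j hFj x hx hxF with h | h <;> simp [h]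
  have hdiv := sg.integral_diverg_eq_zero ht hbd
  have cg := sg.piecewiseContinuous_diverg ht
  have c2 : T.PiecewiseContinuous m aMid fun y =>
      (inner ℝ ((1 / 2 * diverg uf y) • ub y) (ub y) : ℝ) :=
    ((suf.piecewiseContinuous_diverg ht).prodMk sub.piecewiseContinuous).comp
      (φ := fun q : ℝ × E d => (inner ℝ ((1 / 2 * q.1) • q.2) q.2 : ℝ)) (by fun_prop)
  have c3 : T.PiecewiseContinuous m aMid fun y => diverg wb y * ‖ub y‖ ^ 2 :=
    ((swb.piecewiseContinuous_diverg ht).prodMk sub.piecewiseContinuous).comp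
      (φ := fun q : ℝ × E d => q.1 * ‖q.2‖ ^ 2) (by fun_prop)
  have key : ∀ᵐ y ∂volume.restrict (T.domain m aMid),
      (inner ℝ (divTensor (fun x => tensor (ub x) (uf x - wb x)) y) (ub y) : ℝ) =
      1 / 2 * diverg (fun x => ‖ub x‖ ^ 2 • (uf x - wb x)) y -
      1 / 2 * (diverg wb y * ‖ub y‖ ^ 2) + inner ℝ ((1 / 2 * diverg uf y) • ub y) (ub y) := by
    refine ae_restrict_domain fun j x hx => ?_
    have d1 := sub.differentiableAt ht j hx
    have d2 := suf.differentiableAt ht j hx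
    have d3 := swb.differentiableAt ht j hx
    have d4 := sb.differentiableAt ht j hx
    rw [divTensor_tensor d1 d4, diverg_normSq_smul d1 d4, diverg_sub d2 d3, inner_add_left,
      inner_smul_left, inner_smul_left, real_inner_self_eq_norm_sq, real_inner_comm (ub _)]
    simp only [conj_trivial]
    ring
  rw [integral_congr_ae key, integral_add, integral_sub, integral_const_mul,
    integral_const_mul, hdiv]
  · ring
  · exact (cg.integrableOn ht).const_mul _
  · exact (c3.integrableOn ht).const_mul _
  · exact ((cg.integrableOn ht).const_mul _).sub ((c3.integrableOn ht).const_mul _)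
  · exact c2.integrableOn ht

/-- The integral of the rate of change of the volume element times `|u|²`, at `t = s + θ Δt`. -/
def energyRate (T : Connectivity d V J) (m : ℕ) (aOld aNew : (V → ℕ) → E d) (u : E d → E d)
    (θ : ℝ) : ℝ :=
  ∑ j, ∫ x in openSimplex d,
    detRate (fderiv ℝ (T.Psi m aOld j) x)
      (fderiv ℝ (T.Psi m aNew j) x - fderiv ℝ (T.Psi m aOld j) x) θ * ‖u (T.Psi m aNew j x)‖ ^ 2

lemma IsMesh.convectionAt_eq_energyRate {θ : ℝ} (hΔt : Δt ≠ 0) (hT : T.IsMesh m B aNew)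
    (ht : T.IsMesh m B (interp s Δt aOld aNew (s + θ * Δt))) (hu : T.PiecewiseSmooth m aNew u)
    (h0 : ∀ F ∈ B, ∀ j, (F : Set V) ⊆ Set.range (T.vert j) → ∀ x ∈ refSimplex d,
      (∀ k, T.vert j k ∉ F → bary x k = 0) →
        u (T.Psi m aNew j x) = 0 ∨ T.Psi m (transportVelocity Δt aOld aNew uOld) j x = 0) :
    T.convectionAt m s Δt aOld aNew uOld u u (s + θ * Δt) =
      -(1 / (2 * Δt)) * T.energyRate m aOld aNew u θ := by
  rw [hT.convectionAt_eq_integral_diverg ht hu h0]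
  choose P hP hPu using hu
  have hω : ∀ j x, HasFDerivAt (fun x => Δt⁻¹ • (T.Psi m aNew j x - T.Psi m aOld j x))
      (Δt⁻¹ • (fderiv ℝ (T.Psi m aNew j) x - fderiv ℝ (T.Psi m aOld j) x)) x := fun j x =>
    ((hasFDerivAt_Psi j x).fun_sub (hasFDerivAt_Psi j x)).fun_const_smul _
  have hωc : ∀ j, ContDiff ℝ 1 (fun x => Δt⁻¹ • (T.Psi m aNew j x - T.Psi m aOld j x)) := by
    intro j
    have h1 := T.contDiff_Psi (m := m) (n := 1) aNew j
    have h2 := T.contDiff_Psi (m := m) (n := 1) aOld j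
    fun_prop
  rw [(ht.integral_domain (g := fun j x => (∑ i, (((Δt⁻¹ • (fderiv ℝ (T.Psi m aNew j) x -
      fderiv ℝ (T.Psi m aOld j) x)) ∘L
      (fderiv ℝ (T.Psi m (interp s Δt aOld aNew (s + θ * Δt)) j) x).inverse) (e i)) i) *
      ‖P j x‖ ^ 2) ?_ ?_).2]
  · rw [energyRate, Finset.mul_sum, Finset.mul_sum]
    refine Finset.sum_congr rfl fun j _ => ?_
    rw [← integral_const_mul, ← integral_const_mul]
    refine setIntegral_congr_fun isOpen_openSimplex.measurableSet fun x hx => ?_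
    simp only [fderiv_Psi_interp hΔt, detRate, hPu j x (openSimplex_subset hx), smul_eq_mul,
      ContinuousLinearMap.smul_comp, smul_apply, PiLp.smul_apply,
      ← Finset.mul_sum]
    field_simp
  · intro j
    refine ContinuousOn.mul ?_ ((hP j).continuous.norm.pow 2).continuousOn
    refine continuous_sum_apply_e.comp_continuousOn (ContinuousOn.clm_comp ?_
      (ht.continuousOn_inverse_fderiv j))
    have h1 := continuous_fderiv_Psi (T := T) (m := m) (a := aNew) j
    have h2 := continuous_fderiv_Psi (T := T) (m := m) (a := aOld) j
    fun_prop
  · intro j x hx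
    have hx' := openSimplex_subset hx
    rw [hT.backward_Psi ht _ hx', hPu j x hx', diverg, grad,
      (ht.hasFDerivAt (hωc j) (fun x hx => by
        rw [hT.backward_Psi ht _ (openSimplex_subset hx),
          hT.meshVelocity_Psi (openSimplex_subset hx)]) hx).fderiv, (hω j x).fderiv]

/-- Tested with the velocity, the convection terms are half the difference quotient of the kinetic
energies of the extended velocity. -/
lemma IsMesh.convection_eq (hd : d = 2 ∨ d = 3) (hΔt : 0 < Δt)
    (hmesh : ∀ t ∈ Icc s (s + Δt), T.IsMesh m B (interp s Δt aOld aNew t))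
    (hu : T.PiecewiseSmooth m aNew u)
    (h0 : ∀ F ∈ B, ∀ j, (F : Set V) ⊆ Set.range (T.vert j) → ∀ x ∈ refSimplex d,
      (∀ k, T.vert j k ∉ F → bary x k = 0) →
        u (T.Psi m aNew j x) = 0 ∨ T.Psi m (transportVelocity Δt aOld aNew uOld) j x = 0) :
    T.convection m s Δt aOld aNew uOld u u =
      -(1 / (2 * Δt)) * ((∫ y in T.domain m aNew, ‖u y‖ ^ 2) -
        ∫ y in T.domain m aOld, ‖T.backward m s Δt aOld aNew u s y‖ ^ 2) := by
  have hmesh' : ∀ θ ∈ Icc (0 : ℝ) 1, T.IsMesh m B (interp s Δt aOld aNew (s + θ * Δt)) :=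
    fun θ hθ => hmesh _ ⟨by nlinarith [hθ.1], by nlinarith [hθ.2]⟩
  have hT : T.IsMesh m B aNew := by
    have := hmesh (s + Δt) ⟨by linarith, le_rfl⟩
    rwa [interp_end hΔt.ne'] at this
  have hs : T.IsMesh m B (interp s Δt aOld aNew s) := hmesh s ⟨le_rfl, by linarith⟩
  have hTo : T.IsMesh m B aOld := by rwa [interp_start hΔt.ne'] at hs
  choose P hP hPu using hu
  have hPc : ∀ j, Continuous fun x => ‖P j x‖ ^ 2 := fun j => (hP j).continuous.norm.pow 2
  have h1 : ∫ y in T.domain m aNew, ‖u y‖ ^ 2 =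
      ∑ j, ∫ x in openSimplex d, |(fderiv ℝ (T.Psi m aNew j) x).det| * ‖P j x‖ ^ 2 :=
    (hT.integral_domain (fun j => (hPc j).continuousOn)
      fun j x hx => by rw [hPu j x (openSimplex_subset hx)]).2
  have h2 : ∫ y in T.domain m aOld, ‖T.backward m s Δt aOld aNew u s y‖ ^ 2 =
      ∑ j, ∫ x in openSimplex d, |(fderiv ℝ (T.Psi m aOld j) x).det| * ‖P j x‖ ^ 2 :=
    (hTo.integral_domain (fun j => (hPc j).continuousOn) fun j x hx => by
      have := hT.backward_Psi hs u (openSimplex_subset hx) (j := j)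
      rw [interp_start hΔt.ne'] at this
      rw [this, hPu j x (openSimplex_subset hx)]).2
  have hint : ∀ a : (V → ℕ) → E d, ∀ j, IntegrableOn
      (fun x => |(fderiv ℝ (T.Psi m a j) x).det| * ‖P j x‖ ^ 2) (openSimplex d) := by
    intro a j
    refine (ContinuousOn.integrableOn_compact isCompact_refSimplex ?_).mono_set openSimplex_subset
    exact ((ContinuousLinearMap.continuous_det.comp (continuous_fderiv_Psi j)).abs.mul
      (hPc j)).continuousOn
  have hdet : ∀ j, ∀ x ∈ refSimplex d, ∀ θ ∈ Icc (0 : ℝ) 1, (fderiv ℝ (T.Psi m aOld j) x +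
      θ • (fderiv ℝ (T.Psi m aNew j) x - fderiv ℝ (T.Psi m aOld j) x)).det ≠ 0 := by
    intro j x hx θ hθ
    rw [← fderiv_Psi_interp (s := s) hΔt.ne']
    exact (hmesh' θ hθ).nondegenerate j x hx
  have hintR : ∀ θ ∈ Icc (0 : ℝ) 1, ∀ j, IntegrableOn (fun x =>
      detRate (fderiv ℝ (T.Psi m aOld j) x)
        (fderiv ℝ (T.Psi m aNew j) x - fderiv ℝ (T.Psi m aOld j) x) θ * ‖P j x‖ ^ 2)
      (openSimplex d) := by
    intro θ hθ j
    refine (ContinuousOn.integrableOn_compact isCompact_refSimplex ?_).mono_set openSimplex_subset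
    refine ContinuousOn.mul ?_ (hPc j).continuousOn
    have c1 := continuous_fderiv_Psi (T := T) (m := m) (a := aNew) j
    have c2 := continuous_fderiv_Psi (T := T) (m := m) (a := aOld) j
    have c3 := (hmesh' θ hθ).continuousOn_inverse_fderiv j
    simp only [fderiv_Psi_interp hΔt.ne'] at c3
    refine ContinuousOn.mul ?_ (continuous_sum_apply_e.comp_continuousOn
      (ContinuousOn.clm_comp ?_ c3))
    · exact (ContinuousLinearMap.continuous_det.comp (by fun_prop)).abs.continuousOn
    · exact (c1.sub c2).continuousOn
  have hrate : ∀ θ, T.energyRate m aOld aNew u θ = ∑ j, ∫ x in openSimplex d,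
      detRate (fderiv ℝ (T.Psi m aOld j) x)
        (fderiv ℝ (T.Psi m aNew j) x - fderiv ℝ (T.Psi m aOld j) x) θ * ‖P j x‖ ^ 2 := by
    intro θ
    refine Finset.sum_congr rfl fun j _ => ?_
    refine setIntegral_congr_fun isOpen_openSimplex.measurableSet fun x hx => ?_
    simp only [hPu j x (openSimplex_subset hx)]
  have hs3 : 1 / (2 * √3) ≤ 1 / 2 := by
    apply one_div_le_one_div_of_le (by norm_num)
    nlinarith [Real.one_le_sqrt.2 (by norm_num : (1 : ℝ) ≤ 3)]
  have hs3' : 0 ≤ 1 / (2 * √3) := by positivity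
  have hq : (∫ y in T.domain m aNew, ‖u y‖ ^ 2) -
      ∫ y in T.domain m aOld, ‖T.backward m s Δt aOld aNew u s y‖ ^ 2 =
      if d = 2 then T.energyRate m aOld aNew u (1 / 2)
      else 1 / 2 * T.energyRate m aOld aNew u (1 / 2 - 1 / (2 * √3)) +
        1 / 2 * T.energyRate m aOld aNew u (1 / 2 + 1 / (2 * √3)) := by
    rw [h1, h2, ← Finset.sum_sub_distrib]
    simp only [hrate]
    have hpt := fun j x hx => abs_det_sub_abs_det_eq_quadrature hd _ _
      (hdet j x (openSimplex_subset hx))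
    simp only [add_sub_cancel] at hpt
    by_cases h2 : d = 2
    · rw [if_pos h2]
      refine Finset.sum_congr rfl fun j _ => ?_
      rw [← integral_sub (hint _ j) (hint _ j)]
      refine setIntegral_congr_fun isOpen_openSimplex.measurableSet fun x hx => ?_
      beta_reduce
      rw [← sub_mul, hpt j x hx, if_pos h2]
    · rw [if_neg h2, Finset.mul_sum, Finset.mul_sum, ← Finset.sum_add_distrib]
      refine Finset.sum_congr rfl fun j _ => ?_
      rw [← integral_sub (hint _ j) (hint _ j), ← integral_const_mul, ← integral_const_mul,
        ← integral_add ((hintR _ ⟨by linarith, by linarith⟩ j).const_mul _)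
          ((hintR _ ⟨by linarith, by linarith⟩ j).const_mul _)]
      refine setIntegral_congr_fun isOpen_openSimplex.measurableSet fun x hx => ?_
      beta_reduce
      rw [← sub_mul, hpt j x hx, if_neg h2]
      ring
  have hu : T.PiecewiseSmooth m aNew u := fun j => ⟨P j, hP j, hPu j⟩
  rw [hq, convection]
  by_cases h2 : d = 2
  · rw [if_pos h2, if_pos h2, show s + Δt / 2 = s + 1 / 2 * Δt by ring,
      hT.convectionAt_eq_energyRate hΔt.ne' (hmesh' _ (by constructor <;> norm_num)) hu h0]
  · rw [if_neg h2, if_neg h2, show s + Δt - (1 / 2 + 1 / (2 * √3)) * Δt =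
        s + (1 / 2 - 1 / (2 * √3)) * Δt by ring, show s + Δt - (1 / 2 - 1 / (2 * √3)) * Δt =
        s + (1 / 2 + 1 / (2 * √3)) * Δt by ring,
      hT.convectionAt_eq_energyRate hΔt.ne' (hmesh' _ ⟨by linarith, by linarith⟩) hu h0,
      hT.convectionAt_eq_energyRate hΔt.ne' (hmesh' _ ⟨by linarith, by linarith⟩) hu h0]
    ring

end Connectivity

end

/-! ### Stresses -/

section

variable {d m : ℕ} {V J JF JS : Type*}

lemma frob_eq_sum (A B : E d →L[ℝ] E d) : frob A B = ∑ i, ∑ j, (A (e i)) j * (B (e i)) j := by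
  simp [frob, PiLp.inner_apply, mul_comm]

lemma adjoint_e_apply (A : E d →L[ℝ] E d) (i j : Fin d) :
    (ContinuousLinearMap.adjoint A (e i)) j = (A (e j)) i := by
  rw [← inner_e, ← inner_e, ContinuousLinearMap.adjoint_inner_left, real_inner_comm]

lemma continuous_frob_add_adjoint : Continuous fun A : E d →L[ℝ] E d =>
    frob (A + ContinuousLinearMap.adjoint A) (A + ContinuousLinearMap.adjoint A) := by
  simp only [frob_eq_sum, add_apply, PiLp.add_apply, adjoint_e_apply]
  fun_prop

/-- `(∇u + ∇uᵀ) : ∇u = ½ |∇u + ∇uᵀ|²`. -/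
lemma frob_add_adjoint (A : E d →L[ℝ] E d) :
    frob (A + ContinuousLinearMap.adjoint A) (A + ContinuousLinearMap.adjoint A) =
      2 * frob (A + ContinuousLinearMap.adjoint A) A := by
  have hs : ∑ i, ∑ j, ((A (e i)) j + (A (e j)) i) * (A (e j)) i =
      ∑ i, ∑ j, ((A (e i)) j + (A (e j)) i) * (A (e i)) j := by
    rw [Finset.sum_comm]
    refine Finset.sum_congr rfl fun i _ => Finset.sum_congr rfl fun j _ => ?_
    ring
  simp only [frob_eq_sum, add_apply, PiLp.add_apply, adjoint_e_apply]
  simp only [mul_add, Finset.sum_add_distrib] at hs ⊢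
  linarith

lemma frob_fluidStress (D : Params d) (u : E d → E d) (p : E d → ℝ) (y : E d) :
    frob (D.fluidStress u p y) (grad u y) =
      D.rhoF * D.nuF / 2 * frob (symGrad u y) (symGrad u y) - diverg u y * p y := by
  have h1 := frob_add_adjoint (grad u y)
  have h2 : frob (D.fluidStress u p y) (grad u y) =
      D.rhoF * D.nuF * frob (symGrad u y) (grad u y) - p y * diverg u y := by
    simp only [frob, diverg, Params.fluidStress, Finset.mul_sum, ← Finset.sum_sub_distrib]
    refine Finset.sum_congr rfl fun i _ => ?_
    have h3 := inner_e (grad u y (e i)) i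
    rw [real_inner_comm] at h3
    simp [inner_sub_left, inner_smul_left, h3]
  rw [h2]
  unfold symGrad
  rw [h1]
  ring

lemma sum_tensor (G : E d →L[ℝ] E d) :
    ∑ i, ∑ j, (G (e j)) i • tensor (e i) (e j) = G := by
  ext x : 1
  have h1 : G x = ∑ j, x j • G (e j) := by
    conv_lhs => rw [← sum_smul_e x]
    simp
  have h2 : ∀ j, (inner ℝ (e j) x : ℝ) = x j := fun j => by rw [real_inner_comm, inner_e]
  rw [h1, Finset.sum_comm]
  simp only [sum_apply, smul_apply, tensor_apply, h2]
  refine Finset.sum_congr rfl fun j _ => ?_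
  conv_rhs => rw [← sum_smul_e (G (e j)), Finset.smul_sum]
  exact Finset.sum_congr rfl fun i _ => smul_comm _ _ _

/-- `σ^s(F) : G` is the derivative of the strain energy density in the direction `G`. -/
lemma frob_solidStress (W : (E d →L[ℝ] E d) → ℝ) (F G : E d →L[ℝ] E d) :
    frob (solidStress W F) G = fderiv ℝ W F G := by
  conv_rhs => rw [← sum_tensor G]
  simp only [map_sum, map_smul, smul_eq_mul]
  rw [frob]
  have h1 : ∀ k, solidStress W F (e k) = ∑ i, fderiv ℝ W F (tensor (e i) (e k)) • e i := by
    intro k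
    simp only [solidStress, sum_apply, smul_apply, tensor_apply]
    refine Finset.sum_congr rfl fun i _ => ?_
    rw [Finset.sum_eq_single k]
    · rw [inner_e]; simp [e]
    · intro j _ hj
      rw [inner_e]; simp [e, Ne.symm hj]
    · simp
  simp only [h1, sum_inner, inner_smul_left]
  rw [Finset.sum_comm]
  refine Finset.sum_congr rfl fun i _ => Finset.sum_congr rfl fun j _ => ?_
  rw [real_inner_comm, inner_e]
  simp [mul_comm]

/-- The graph of a differentiable convex function lies above its tangents. -/
lemma _root_.ConvexOn.fderiv_apply_le {X : Type*} [NormedAddCommGroup X] [NormedSpace ℝ X]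
    {W : X → ℝ} (hW : ConvexOn ℝ univ W) (hd : Differentiable ℝ W) (F G : X) :
    fderiv ℝ W F G ≤ W (F + G) - W F := by
  have hconv : ConvexOn ℝ univ fun t : ℝ => W (F + t • G) := by
    refine ⟨convex_univ, fun s _ t _ a b ha hb hab => ?_⟩
    have := hW.2 (mem_univ (F + s • G)) (mem_univ (F + t • G)) ha hb hab
    convert this using 2
    have hF : F = (a + b) • F := by rw [hab, one_smul]
    conv_lhs => rw [hF]
    simp only [smul_eq_mul]
    module
  have hder : HasDerivAt (fun t : ℝ => W (F + t • G)) (fderiv ℝ W F G) 0 := by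
    have h1 : HasDerivAt (fun t : ℝ => F + t • G) G 0 := by
      simpa using ((hasDerivAt_id (0 : ℝ)).smul_const G).const_add F
    have h2 : HasFDerivAt W (fderiv ℝ W F) (F + (0 : ℝ) • G) := by
      simpa using (hd F).hasFDerivAt
    exact h2.comp_hasDerivAt (0 : ℝ) h1
  have := hconv.le_slope_of_hasDerivAt (mem_univ 0) (mem_univ 1) zero_lt_one hder
  simpa [slope] using this

namespace Connectivity

variable [Fintype V] [Fintype J] {T : Connectivity d V J} {B : Finset (Finset V)}
  {a : (V → ℕ) → E d}

lemma PiecewiseSmooth.integrableOn_normSq (hT : T.IsMesh m B a) {u : E d → E d}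
    (hu : T.PiecewiseSmooth m a u) : IntegrableOn (fun y => ‖u y‖ ^ 2) (T.domain m a) :=
  (hu.piecewiseContinuous.comp (φ := fun z => ‖z‖ ^ 2) (by fun_prop)).integrableOn hT

lemma PiecewiseSmooth.integrableOn_inner (hT : T.IsMesh m B a) {u v : E d → E d}
    (hu : T.PiecewiseSmooth m a u) (hv : T.PiecewiseSmooth m a v) :
    IntegrableOn (fun y => (inner ℝ (u y) (v y) : ℝ)) (T.domain m a) :=
  ((hu.piecewiseContinuous.prodMk hv.piecewiseContinuous).comp
    (φ := fun q : E d × E d => (inner ℝ q.1 q.2 : ℝ)) (by fun_prop)).integrableOn hT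

lemma PiecewiseSmooth.integral_inner_le (hT : T.IsMesh m B a) {u v : E d → E d}
    (hu : T.PiecewiseSmooth m a u) (hv : T.PiecewiseSmooth m a v) :
    ∫ y in T.domain m a, (inner ℝ (u y) (v y) : ℝ) ≤
      1 / 2 * (∫ y in T.domain m a, ‖u y‖ ^ 2) + 1 / 2 * ∫ y in T.domain m a, ‖v y‖ ^ 2 := by
  rw [← integral_const_mul, ← integral_const_mul, ← integral_add
    ((hu.integrableOn_normSq hT).const_mul _) ((hv.integrableOn_normSq hT).const_mul _)]
  refine integral_mono (hu.integrableOn_inner hT hv)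
    (((hu.integrableOn_normSq hT).const_mul _).add ((hv.integrableOn_normSq hT).const_mul _))
    fun y => ?_
  have := real_inner_le_norm (u y) (v y)
  beta_reduce
  nlinarith [sq_nonneg (‖u y‖ - ‖v y‖)]

lemma PiecewiseSmooth.integral_frob_fluidStress (hT : T.IsMesh m B a) (D : Params d)
    {u : E d → E d} {p : E d → ℝ} (hu : T.PiecewiseSmooth m a u) (hp : T.PiecewiseSmooth m a p) :
    ∫ y in T.domain m a, frob (D.fluidStress u p y) (grad u y) =
      D.rhoF * D.nuF / 2 * (∫ y in T.domain m a, frob (symGrad u y) (symGrad u y)) -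
        ∫ y in T.domain m a, diverg u y * p y := by
  simp only [frob_fluidStress]
  rw [integral_sub, integral_const_mul]
  · have hS : T.PiecewiseContinuous m a fun y => frob (symGrad u y) (symGrad u y) := by
      exact (hu.piecewiseContinuous_fderiv hT).comp (φ := fun A : E d →L[ℝ] E d =>
        frob (A + ContinuousLinearMap.adjoint A) (A + ContinuousLinearMap.adjoint A)) continuous_frob_add_adjoint
    exact (hS.integrableOn hT).const_mul _
  · exact PiecewiseContinuous.integrableOn hT
      (((hu.piecewiseContinuous_diverg hT).prodMk hp.piecewiseContinuous).comp
        (φ := fun q : ℝ × ℝ => q.1 * q.2) (by fun_prop))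

/-- The work of the solid stress dominates the increase of the elastic energy. The power density
`DW(F) : G` is integrable because convexity squeezes it between differences of values of `W`. -/
lemma PiecewiseSmooth.integral_solidStress_ge (hT : T.IsMesh m B a)
    {W : (E d →L[ℝ] E d) → ℝ} (hW : ConvexOn ℝ univ W) (hWd : Differentiable ℝ W) {τ : ℝ}
    {φ v : E d → E d} (hφ : T.PiecewiseSmooth m a φ) (hv : T.PiecewiseSmooth m a v) :
    (∫ x in T.domain m a, W (grad (fun y => φ y + τ • v y) x)) -
        ∫ x in T.domain m a, W (grad φ x) ≤
      τ * ∫ x in T.domain m a,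
        frob (solidStress W (grad (fun y => φ y + τ • v y) x)) (grad v x) := by
  have hψ : T.PiecewiseSmooth m a fun y => φ y + τ • v y :=
    (hφ.prodMk hv).comp (φ := fun q : E d × E d => q.1 + τ • q.2) (by fun_prop)
  have c1 : T.PiecewiseContinuous m a (grad fun y => φ y + τ • v y) :=
    hψ.piecewiseContinuous_fderiv hT
  have c2 : T.PiecewiseContinuous m a (grad v) := hv.piecewiseContinuous_fderiv hT
  have c3 : T.PiecewiseContinuous m a (grad φ) := hφ.piecewiseContinuous_fderiv hT
  have hgrad : ∀ᵐ x ∂volume.restrict (T.domain m a),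
      grad (fun y => φ y + τ • v y) x + -(τ • grad v x) = grad φ x := by
    refine ae_restrict_domain fun j x hx => ?_
    have d1 := hφ.differentiableAt hT j hx
    have d2 := hv.differentiableAt hT j hx
    simp only [grad]
    rw [fderiv_fun_add d1 (d2.fun_const_smul τ), fderiv_fun_const_smul d2]
    abel
  simp only [frob_solidStress]
  set F := grad fun y => φ y + τ • v y with hF
  have hi1 : IntegrableOn (fun x => W (F x)) (T.domain m a) :=
    (c1.comp hWd.continuous).integrableOn hT
  have hi2 : IntegrableOn (fun x => W (grad φ x)) (T.domain m a) :=
    (c3.comp hWd.continuous).integrableOn hT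
  have hlo : IntegrableOn (fun x => W (F x) - W (F x - grad v x)) (T.domain m a) :=
    ((c1.prodMk c2).comp (φ := fun q => W q.1 - W (q.1 - q.2))
      (by have := hWd.continuous; fun_prop)).integrableOn hT
  have hhi : IntegrableOn (fun x => W (F x + grad v x) - W (F x)) (T.domain m a) :=
    ((c1.prodMk c2).comp (φ := fun q => W (q.1 + q.2) - W q.1)
      (by have := hWd.continuous; fun_prop)).integrableOn hT
  have hmeas : AEStronglyMeasurable (fun x => fderiv ℝ W (F x) (grad v x))
      (volume.restrict (T.domain m a)) := by
    have m1 : AEMeasurable F (volume.restrict (T.domain m a)) :=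
      (c1.integrableOn hT).aestronglyMeasurable.aemeasurable
    have m2 := (c2.integrableOn hT).aestronglyMeasurable
    have m3 : AEStronglyMeasurable (fun x => fderiv ℝ W (F x)) (volume.restrict (T.domain m a)) :=
      ((measurable_fderiv ℝ W).comp_aemeasurable m1).aestronglyMeasurable
    have hc : Continuous fun q : ((E d →L[ℝ] E d) →L[ℝ] ℝ) × (E d →L[ℝ] E d) => q.1 q.2 := by
      fun_prop
    exact hc.comp_aestronglyMeasurable (m3.prodMk m2)
  have hint : IntegrableOn (fun x => fderiv ℝ W (F x) (grad v x)) (T.domain m a) := by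
    refine Integrable.mono (hlo.norm.add hhi.norm) hmeas (Eventually.of_forall fun x => ?_)
    have h1 := hW.fderiv_apply_le hWd (F x) (grad v x)
    have h2 := hW.fderiv_apply_le hWd (F x) (-grad v x)
    rw [map_neg, ← sub_eq_add_neg] at h2
    have h3 : ‖‖W (F x) - W (F x - grad v x)‖ + ‖W (F x + grad v x) - W (F x)‖‖ =
        |W (F x) - W (F x - grad v x)| + |W (F x + grad v x) - W (F x)| :=
      abs_of_nonneg (add_nonneg (abs_nonneg _) (abs_nonneg _))
    refine le_of_le_of_eq ?_ h3.symm
    rw [Real.norm_eq_abs, abs_le]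
    constructor
    · have := neg_abs_le (W (F x) - W (F x - grad v x))
      have := abs_nonneg (W (F x + grad v x) - W (F x))
      linarith
    · have := le_abs_self (W (F x + grad v x) - W (F x))
      have := abs_nonneg (W (F x) - W (F x - grad v x))
      linarith
  rw [← integral_sub hi1 hi2, ← integral_const_mul]
  refine integral_mono_ae (hi1.sub hi2) (hint.const_mul τ) ?_
  filter_upwards [hgrad] with x hx
  have := hW.fderiv_apply_le hWd (F x) (-(τ • grad v x))
  rw [hx, map_neg, map_smul, smul_eq_mul] at this
  beta_reduce
  linarith

end Connectivity

end

/-! ### The energy inequality -/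

section

variable {d m : ℕ} {V JF JS : Type*}

namespace Geometry

variable {M : Geometry d m V JF JS} {D : Params d} {X : Trajectory d V} {N n : ℕ}

lemma _root_.FSI.Trajectory.time_succ (X : Trajectory d V) (n : ℕ) :
    X.time (n + 1) = X.time n + X.dt := by
  simp [Trajectory.time]; ring

lemma CollisionFree.isMesh_interp (h : M.CollisionFree X N) (hn : n < N) :
    ∀ t ∈ Icc (X.time n) (X.time n + X.dt),
      M.fluid.IsMesh m M.fluidBoundary (interp (X.time n) X.dt (X.a n) (X.a (n + 1)) t) := by
  intro t ht
  rw [← X.time_succ] at ht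
  exact h n hn t ht

lemma CollisionFree.isMesh_new (h : M.CollisionFree X N) (hdt : 0 < X.dt) (hn : n < N) :
    M.fluid.IsMesh m M.fluidBoundary (X.a (n + 1)) := by
  have := h.isMesh_interp hn (X.time n + X.dt) ⟨by linarith, le_rfl⟩
  rwa [interp_end hdt.ne'] at this

lemma CollisionFree.isMesh_old (h : M.CollisionFree X N) (hdt : 0 < X.dt) (hn : n < N) :
    M.fluid.IsMesh m M.fluidBoundary (X.a n) := by
  have := h.isMesh_interp hn (X.time n) ⟨le_rfl, by linarith⟩
  rwa [interp_start hdt.ne'] at this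

lemma totalEnergy_succ : M.totalEnergy D X (n + 1) = M.totalEnergy D X n +
    (2 * (M.solidEnergyAt D X (n + 1) - M.solidEnergyAt D X n) +
      D.rhoF * (M.fluidNormSq X (n + 1) - M.fluidNormSq X n) +
      D.rhoF * D.nuF * M.strainNormSq X (n + 1) * X.dt) := by
  simp only [totalEnergy, Finset.sum_range_succ]
  ring

lemma totalEnergy_le (hdt : 0 < X.dt)
    (hstep : ∀ n < N, D.rhoF / (2 * X.dt) * (M.fluidNormSq X (n + 1) - M.fluidNormSq X n) +
        D.rhoF * D.nuF / 2 * M.strainNormSq X (n + 1) +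
        1 / X.dt * (M.solidEnergyAt D X (n + 1) - M.solidEnergyAt D X n) ≤
      M.power D X (n + 1)) :
    ∀ n ≤ N, M.totalEnergy D X n ≤
      M.totalEnergy D X 0 + 2 * X.dt * ∑ l ∈ Finset.range n, M.power D X (l + 1) := by
  intro n
  induction n with
  | zero => simp
  | succ n ih =>
    intro hn
    have h1 := ih (by omega)
    have h2 := mul_le_mul_of_nonneg_left (hstep n hn) (by positivity : 0 ≤ 2 * X.dt)
    have h3 : 2 * X.dt * (D.rhoF / (2 * X.dt) * (M.fluidNormSq X (n + 1) - M.fluidNormSq X n) +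
        D.rhoF * D.nuF / 2 * M.strainNormSq X (n + 1) +
        1 / X.dt * (M.solidEnergyAt D X (n + 1) - M.solidEnergyAt D X n)) =
        2 * (M.solidEnergyAt D X (n + 1) - M.solidEnergyAt D X n) +
          D.rhoF * (M.fluidNormSq X (n + 1) - M.fluidNormSq X n) +
          D.rhoF * D.nuF * M.strainNormSq X (n + 1) * X.dt := by
      field_simp
      ring
    rw [h3] at h2
    rw [totalEnergy_succ, Finset.sum_range_succ, mul_add]
    linarith

variable [Fintype V] [Fintype JF]

lemma IsSolution.piecewiseSmooth_v (h : M.IsSolution D X N) (hn : n ≤ N) :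
    M.solid.PiecewiseSmooth m M.z (X.v n) :=
  (h.mem n hn).2.2.1.piecewiseSmooth

lemma IsSolution.piecewiseSmooth_phi (h : M.IsSolution D X N) :
    ∀ n ≤ N + 1, M.solid.PiecewiseSmooth m M.z (X.phi n)
  | 0, _ => h.initial.piecewiseSmooth
  | n + 1, hn => ((h.piecewiseSmooth_phi n (by omega)).prodMk
      (h.piecewiseSmooth_v (n := n) (by omega))).comp
        (φ := fun q : E d × E d => q.1 + X.dt • q.2) (by fun_prop)

/-- On the boundary, either the velocity vanishes or the mesh moves with the fluid. -/
lemma IsSolution.boundary_velocity (huB : ∀ t x, D.uB t x = 0) (hsigma2 : M.sigma2 = ∅)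
    (hdt : 0 < X.dt) (h : M.IsSolution D X N) (hn : n < N) :
    ∀ F ∈ M.fluidBoundary, ∀ j, (F : Set V) ⊆ Set.range (M.fluid.vert j) → ∀ x ∈ refSimplex d,
      (∀ k, M.fluid.vert j k ∉ F → bary x k = 0) →
        X.u (n + 1) (M.fluid.Psi m (X.a (n + 1)) j x) = 0 ∨
        M.fluid.Psi m (Connectivity.transportVelocity X.dt (X.a n) (X.a (n + 1)) (X.u n)) j x =
          0 := by
  intro F hF j hFj x hx hxF
  rw [M.mem_fluidBoundary, hsigma2] at hF
  rcases hF with hF | hF | hF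
  · right
    refine M.fluid.Psi_eq_zero_of_face _ M.interface (fun i hi => ?_) hF hxF
    rw [Connectivity.transportVelocity, h.moving n hn.le i hi, h.moving (n + 1) hn i hi,
      (h.mem n hn.le).2.2.2 i hi]
    simp only [Trajectory.phi, add_sub_cancel_left]
    rw [inv_smul_smul₀ hdt.ne', sub_self]
  · left
    rw [h.fluid_bc n hn _ ⟨F, hF, j, hFj, x, hx, hxF, rfl⟩, huB]
  · simp at hF

variable [Fintype JS]

/-- The scheme, tested with `(u^n; -p^n; v^n)`, gives the discrete energy inequality. -/
lemma IsSolution.energy_step (hd : d = 2 ∨ d = 3) (hW : ConvexOn ℝ univ D.W)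
    (huB : ∀ t x, D.uB t x = 0) (hsigma2 : M.sigma2 = ∅)
    (hphiB : ∀ t > 0, ∀ x ∈ M.solid.faceSet m M.z M.sigma3, HasDerivAt (fun s => D.phiB s x) 0 t)
    (hdt : 0 < X.dt) (h : M.IsSolution D X N) (hcf : M.CollisionFree X N) (hn : n < N) :
    D.rhoF / (2 * X.dt) * (M.fluidNormSq X (n + 1) - M.fluidNormSq X n) +
        D.rhoF * D.nuF / 2 * M.strainNormSq X (n + 1) +
        1 / X.dt * (M.solidEnergyAt D X (n + 1) - M.solidEnergyAt D X n) ≤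
      M.power D X (n + 1) := by
  have hT := hcf.isMesh_new hdt hn
  have hTo := hcf.isMesh_old hdt hn
  have hTs := hcf.isMesh_interp hn (X.time n) ⟨le_rfl, by linarith⟩
  obtain ⟨memu, memp, memv, memi⟩ := h.mem (n + 1) hn
  have su := memu.piecewiseSmooth
  have sp := memp.piecewiseSmooth
  have su0 := (h.mem n hn.le).1.piecewiseSmooth
  have hrho := D.rhoF_pos
  -- the equation tested with the solution, with the sign of the pressure reversed
  have memp' : M.fluid.IsFE m (X.a (n + 1)) (m - 1) fun x => -X.p (n + 1) x := by
    refine ⟨memp.1.neg, fun j => ?_⟩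
    obtain ⟨P, hP, hPe⟩ := memp.2 j
    exact ⟨-P, by rwa [MvPolynomial.totalDegree_neg], fun x hx => by simp [hPe x hx]⟩
  have heq := h.equation n hn (X.u (n + 1)) (fun x => -X.p (n + 1) x) (X.v (n + 1))
    ⟨memu, memp', memv, memi⟩ (fun x hx => by rw [h.fluid_bc n hn x hx, huB])
    (fun x hx => by
      rw [h.solid_bc n hn x hx]
      refine (hphiB _ ?_ x hx).deriv
      rw [Trajectory.time]
      positivity)
  have hRHS : M.schemeRHS D X n (X.u (n + 1)) (X.v (n + 1)) = M.power D X (n + 1) := by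
    have hempty : M.fluid.faceSet m (X.a (n + 1)) M.sigma2 = ∅ := by
      simp [hsigma2, Connectivity.faceSet]
    simp [schemeRHS, power, hempty]
  rw [hRHS] at heq
  rw [← heq, schemeLHS]
  -- convection
  have hconv := Connectivity.IsMesh.convection_eq hd hdt (hcf.isMesh_interp hn) su
    (h.boundary_velocity huB hsigma2 hdt hn)
  rw [hconv]
  -- viscosity and pressure
  have hvisc := su.integral_frob_fluidStress hT D sp
  have hpress : ∫ x in M.omegaF (X.a (n + 1)), diverg (X.u (n + 1)) x * -X.p (n + 1) x =
      -∫ x in M.omegaF (X.a (n + 1)), diverg (X.u (n + 1)) x * X.p (n + 1) x := by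
    simp only [mul_neg, integral_neg]
  -- fluid inertia: the mass term at `t^n` is taken on the old domain, with the velocity carried back
  have sb : M.fluid.PiecewiseSmooth m (X.a n) (M.fluid.backward m (X.time n) X.dt (X.a n)
      (X.a (n + 1)) (X.u (n + 1)) (X.time n)) := by
    have := Connectivity.piecewiseSmooth_backward hT hTs su
    rwa [interp_start hdt.ne'] at this
  have hin := su0.integral_inner_le hTo sb
  have huu : ∫ x in M.omegaF (X.a (n + 1)), (inner ℝ (X.u (n + 1) x) (X.u (n + 1) x) : ℝ) =
      ∫ x in M.omegaF (X.a (n + 1)), ‖X.u (n + 1) x‖ ^ 2 := by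
    simp only [real_inner_self_eq_norm_sq]
  -- solid inertia
  have sv := h.piecewiseSmooth_v (n := n + 1) hn
  have sv0 := h.piecewiseSmooth_v hn.le
  have hS := M.solid_isMesh
  have hvv : ∫ x in M.omegaS,
      (inner ℝ ((D.rhoS / X.dt) • (X.v (n + 1) x - X.v n x)) (X.v (n + 1) x) : ℝ) =
      D.rhoS / X.dt * ((∫ x in M.omegaS, ‖X.v (n + 1) x‖ ^ 2) -
        ∫ x in M.omegaS, (inner ℝ (X.v n x) (X.v (n + 1) x) : ℝ)) := by
    simp only [inner_smul_left, inner_sub_left, real_inner_self_eq_norm_sq, conj_trivial]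
    rw [integral_const_mul]
    congr 1
    exact integral_sub (sv.integrableOn_normSq hS) (sv0.integrableOn_inner hS sv)
  have hvin := sv0.integral_inner_le hS sv
  -- elasticity
  have hel := (h.piecewiseSmooth_phi (n + 1) (by omega)).integral_solidStress_ge hS hW
    D.W_differentiable (τ := X.dt) sv
  rw [huu, hpress, hvv]
  simp only [solidEnergyAt, solidEnergy, fluidNormSq, strainNormSq, omegaF, omegaS] at *
  rw [hvisc]
  set U1 := ∫ x in M.fluid.domain m (X.a (n + 1)), ‖X.u (n + 1) x‖ ^ 2
  set U0 := ∫ x in M.fluid.domain m (X.a n), ‖X.u n x‖ ^ 2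
  set Ub := ∫ x in M.fluid.domain m (X.a n), ‖M.fluid.backward m (X.time n) X.dt (X.a n)
    (X.a (n + 1)) (X.u (n + 1)) (X.time n) x‖ ^ 2
  set V1 := ∫ x in M.solid.domain m M.z, ‖X.v (n + 1) x‖ ^ 2
  set V0 := ∫ x in M.solid.domain m M.z, ‖X.v n x‖ ^ 2
  set W1 := ∫ x in M.solid.domain m M.z,
    D.W (grad (fun x => X.phi (n + 1) x + X.dt • X.v (n + 1) x) x)
  set W0 := ∫ x in M.solid.domain m M.z, D.W (grad (X.phi (n + 1)) x)
  have hel' : 1 / X.dt * (W1 - W0) ≤ ∫ x in M.solid.domain m M.z,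
      frob (solidStress D.W (grad (fun y => X.phi (n + 1) y + X.dt • X.v (n + 1) y) x))
        (grad (X.v (n + 1)) x) := by
    rw [one_div, inv_mul_le_iff₀ hdt]
    exact hel
  have hin' := mul_le_mul_of_nonneg_left hin (div_pos hrho hdt).le
  have hvin' := mul_le_mul_of_nonneg_left hvin (div_pos D.rhoS_pos hdt).le
  have e1 : D.rhoF / (2 * X.dt) = 1 / 2 * (D.rhoF / X.dt) := by field_simp
  have e2 : D.rhoF * (-(1 / (2 * X.dt)) * (U1 - Ub)) =
      -(1 / 2) * (D.rhoF / X.dt) * (U1 - Ub) := by field_simp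
  have e3 : 1 / X.dt * (D.rhoS / 2 * V1 + W1 - (D.rhoS / 2 * V0 + ∫ x in M.solid.domain m M.z,
      D.W (grad (fun x => X.phi n x + X.dt • X.v n x) x))) =
      1 / 2 * (D.rhoS / X.dt) * (V1 - V0) + 1 / X.dt * (W1 - W0) := by
    have : (∫ x in M.solid.domain m M.z,
      D.W (grad (fun x => X.phi n x + X.dt • X.v n x) x)) = W0 := rfl
    rw [this]
    field_simp
    ring
  rw [e1, e2, e3]
  linarith

end Geometry

end

/-! ### Inverse estimates on a fixed mesh -/

section

variable {d m : ℕ} {V J : Type*}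

/-- A positive definite quadratic form on a finite-dimensional space dominates the norm. -/
lemma exists_norm_le_mul_sqrt {X : Type*} [NormedAddCommGroup X] [NormedSpace ℝ X]
    [FiniteDimensional ℝ X] {q : X → ℝ} (hc : Continuous q)
    (hq : ∀ (t : ℝ) (c : X), q (t • c) = t ^ 2 * q c) (hpos : ∀ c ≠ 0, 0 < q c) :
    ∃ C : ℝ, 0 ≤ C ∧ ∀ c, ‖c‖ ≤ C * √(q c) := by
  have : ProperSpace X := FiniteDimensional.proper ℝ X
  rcases (Metric.sphere (0 : X) 1).eq_empty_or_nonempty with hemp | hne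
  · refine ⟨0, le_rfl, fun c => ?_⟩
    by_cases h : c = 0
    · simp [h]
    · have : ‖c‖⁻¹ • c ∈ Metric.sphere (0 : X) 1 := by
        rw [mem_sphere_zero_iff_norm, norm_smul, norm_inv, norm_norm,
          inv_mul_cancel₀ (norm_ne_zero_iff.2 h)]
      rw [hemp] at this
      exact this.elim
  · obtain ⟨c₀, hc₀, hmin⟩ := (isCompact_sphere (0 : X) 1).exists_isMinOn hne hc.continuousOn
    have hδ : 0 < q c₀ := hpos c₀ (by
      rintro rfl
      simp at hc₀)
    refine ⟨(√(q c₀))⁻¹, by positivity, fun c => ?_⟩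
    by_cases h : c = 0
    · rw [h, norm_zero]; positivity
    · have hn : 0 < ‖c‖ := norm_pos_iff.2 h
      have hs : ‖c‖⁻¹ • c ∈ Metric.sphere (0 : X) 1 := by
        rw [mem_sphere_zero_iff_norm, norm_smul, norm_inv, norm_norm,
          inv_mul_cancel₀ (norm_ne_zero_iff.2 h)]
      have h1 : q c₀ ≤ q (‖c‖⁻¹ • c) := hmin hs
      rw [hq, inv_pow, ← div_eq_inv_mul, le_div_iff₀ (by positivity)] at h1
      rw [inv_mul_eq_div, le_div_iff₀ (Real.sqrt_pos.2 hδ)]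
      refine Real.le_sqrt_of_sq_le ?_
      rw [mul_pow, Real.sq_sqrt hδ.le]
      linarith

/-- A polynomial which vanishes in the interior of the reference simplex is zero. -/
lemma eq_zero_of_eval_eq_zero {P : MvPolynomial (Fin d) ℝ}
    (h : ∀ x ∈ openSimplex d, MvPolynomial.eval (fun i => x i) P = 0) : P = 0 := by
  refine MvPolynomial.funext_set (fun _ => Ioo (0 : ℝ) (1 / (d + 1)))
    (fun _ => Ioo_infinite (by positivity)) fun x hx => ?_
  rw [map_zero]
  have hx' : ∀ i, x i ∈ Ioo (0 : ℝ) (1 / (d + 1)) := fun i => hx i (mem_univ i)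
  refine h (WithLp.toLp 2 x) ⟨fun i => (hx' i).1, ?_⟩
  calc ∑ i, x i ≤ ∑ _i : Fin d, (1 / (d + 1) : ℝ) := Finset.sum_le_sum fun i _ => (hx' i).2.le
    _ = d / (d + 1) := by simp [div_eq_mul_inv]
    _ < 1 := by rw [div_lt_one (by positivity)]; linarith

/-- On polynomials of bounded degree, a weighted `L²` norm over the reference simplex controls the
values and the derivatives. -/
lemma exists_polynomial_estimate (k : ℕ) {w : E d → ℝ} (hw : Continuous w)
    (hpos : ∀ x ∈ refSimplex d, 0 < w x) :
    ∃ C : ℝ, 0 ≤ C ∧ ∀ P : MvPolynomial (Fin d) ℝ, P.totalDegree ≤ k → ∀ x ∈ refSimplex d,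
      |MvPolynomial.eval (fun i => x i) P| ≤ C * √(∫ y in refSimplex d,
        w y * MvPolynomial.eval (fun i => y i) P ^ 2) ∧
      ‖fderiv ℝ (fun y : E d => MvPolynomial.eval (fun i => y i) P) x‖ ≤
        C * √(∫ y in refSimplex d, w y * MvPolynomial.eval (fun i => y i) P ^ 2) := by
  set R := MvPolynomial.restrictTotalDegree (Fin d) ℝ k
  set b := Module.finBasis ℝ R
  set n := Module.finrank ℝ R
  set h : Fin n → E d → ℝ := fun l x => MvPolynomial.eval (fun i => x i) (b l : MvPolynomial _ ℝ)
  have hh : ∀ l, ContDiff ℝ 1 (h l) := fun l => contDiff_eval _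
  have hhc : ∀ l, Continuous (h l) := fun l => (hh l).continuous
  have heval : ∀ (P : R) (x : E d), MvPolynomial.eval (fun i => x i) (P : MvPolynomial _ ℝ) =
      ∑ l, b.repr P l * h l x := by
    intro P x
    conv_lhs => rw [← b.sum_repr P]
    simp only [Submodule.coe_sum, Submodule.coe_smul, map_sum, MvPolynomial.smul_eval, h]
  set q : (Fin n → ℝ) → ℝ := fun c => ∫ y in refSimplex d, w y * (∑ l, c l * h l y) ^ 2 with hq
  have hqc : Continuous q := by
    refine continuous_parametric_integral_of_continuous (s := refSimplex d) ?_ isCompact_refSimplex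
    simp only [Function.uncurry_def]
    fun_prop
  obtain ⟨C, hC, hCq⟩ := exists_norm_le_mul_sqrt hqc (fun t c => by
    rw [hq]
    simp only [← integral_const_mul]
    refine integral_congr_ae (Eventually.of_forall fun y => ?_)
    simp only [Pi.smul_apply, smul_eq_mul, mul_assoc, ← Finset.mul_sum]
    ring) (fun c hc => by
    set P : R := ∑ l, c l • b l
    have hP : P ≠ 0 := by
      intro h0
      refine hc (funext fun l => ?_)
      have := congrArg (fun P => b.repr P l) h0
      simpa [P, Finsupp.single_apply] using this
    have hrepr : ∀ y, ∑ l, c l * h l y = MvPolynomial.eval (fun i => y i) (P : MvPolynomial _ ℝ) :=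
      fun y => by simp [P, h, MvPolynomial.smul_eval]
    obtain ⟨x₀, hx₀, hne⟩ : ∃ x₀ ∈ openSimplex d, ∑ l, c l * h l x₀ ≠ 0 := by
      by_contra! hcon
      exact hP (Subtype.ext (eq_zero_of_eval_eq_zero fun x hx => by rw [← hrepr, hcon x hx]))
    have hcont : Continuous fun y => w y * (∑ l, c l * h l y) ^ 2 := by fun_prop
    have hnn : 0 ≤ᵐ[volume.restrict (refSimplex d)] fun y => w y * (∑ l, c l * h l y) ^ 2 := by
      filter_upwards [ae_restrict_mem measurableSet_refSimplex] with y hy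
      exact mul_nonneg (hpos y hy).le (sq_nonneg _)
    rw [hq]
    refine (setIntegral_pos_iff_support_of_nonneg_ae hnn
      (hcont.continuousOn.integrableOn_compact isCompact_refSimplex)).2 ?_
    have ho : IsOpen (Function.support (fun y => w y * (∑ l, c l * h l y) ^ 2) ∩ openSimplex d) :=
      hcont.isOpen_support.inter isOpen_openSimplex
    refine (ho.measure_pos volume ⟨x₀, ?_, hx₀⟩).trans_le
      (measure_mono (inter_subset_inter_right _ openSimplex_subset))
    exact mul_ne_zero (hpos x₀ (openSimplex_subset hx₀)).ne' (pow_ne_zero _ hne))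
  -- the basis functions and their derivatives are bounded
  have hb : ∃ B : ℝ, 0 ≤ B ∧ ∀ x ∈ refSimplex d, ∑ l, (|h l x| + ‖fderiv ℝ (h l) x‖) ≤ B := by
    have hc : Continuous fun x => ∑ l, (|h l x| + ‖fderiv ℝ (h l) x‖) :=
      continuous_finsetSum _ fun l _ =>
        (hhc l).abs.add ((hh l).continuous_fderiv one_ne_zero).norm
    obtain ⟨B, hB⟩ := isCompact_refSimplex.bddAbove_image hc.continuousOn
    exact ⟨max B 0, le_max_right _ _, fun x hx => (hB ⟨x, hx, rfl⟩).trans (le_max_left _ _)⟩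
  obtain ⟨B, hB, hBh⟩ := hb
  refine ⟨B * C, mul_nonneg hB hC, fun P hP x hx => ?_⟩
  set P' : R := ⟨P, (MvPolynomial.mem_restrictTotalDegree _ _ _).2 hP⟩
  set c : Fin n → ℝ := fun l => b.repr P' l
  have hPc : ∀ y : E d, MvPolynomial.eval (fun i => y i) P = ∑ l, c l * h l y := heval P'
  have hcq : ‖c‖ ≤ C * √(∫ y in refSimplex d, w y * MvPolynomial.eval (fun i => y i) P ^ 2) := by
    simp only [hPc]
    exact hCq c
  have hcl : ∀ l, |c l| ≤ ‖c‖ := fun l => norm_le_pi_norm c l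
  have main : ∀ r : Fin n → ℝ, (∀ l, r l ≤ |h l x| + ‖fderiv ℝ (h l) x‖) → (∀ l, 0 ≤ r l) →
      ∑ l, |c l| * r l ≤ B * C * √(∫ y in refSimplex d,
        w y * MvPolynomial.eval (fun i => y i) P ^ 2) := by
    intro r hr hr0
    calc ∑ l, |c l| * r l ≤ ∑ l, ‖c‖ * (|h l x| + ‖fderiv ℝ (h l) x‖) :=
          Finset.sum_le_sum fun l _ => mul_le_mul (hcl l) (hr l) (hr0 l) (norm_nonneg _)
      _ = (∑ l, (|h l x| + ‖fderiv ℝ (h l) x‖)) * ‖c‖ := by rw [← Finset.mul_sum, mul_comm]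
      _ ≤ B * ‖c‖ := mul_le_mul_of_nonneg_right (hBh x hx) (norm_nonneg _)
      _ ≤ _ := by rw [mul_assoc]; exact mul_le_mul_of_nonneg_left hcq hB
  constructor
  · rw [hPc]
    refine (Finset.abs_sum_le_sum_abs _ _).trans ?_
    simp only [abs_mul]
    exact main _ (fun l => le_add_of_nonneg_right (norm_nonneg _)) (fun l => abs_nonneg _)
  · have hfd : fderiv ℝ (fun y : E d => MvPolynomial.eval (fun i => y i) P) x =
        ∑ l, c l • fderiv ℝ (h l) x := by
      simp only [hPc]
      refine HasFDerivAt.fderiv (HasFDerivAt.fun_sum fun l _ => ?_)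
      exact (((hh l).differentiable one_ne_zero x).hasFDerivAt).const_mul (c l)
    rw [hfd]
    refine (norm_sum_le _ _).trans ?_
    simp only [norm_smul, Real.norm_eq_abs]
    exact main _ (fun l => le_add_of_nonneg_left (abs_nonneg _)) (fun l => norm_nonneg _)

lemma norm_le_sum_abs (b : E d) : ‖b‖ ≤ ∑ i, |b i| := by
  conv_lhs => rw [← sum_smul_e b]
  refine (norm_sum_le _ _).trans (Finset.sum_le_sum fun i _ => ?_)
  simp [norm_smul, e]

namespace Connectivity

variable {T : Connectivity d V J} {B : Finset (Finset V)} {a : (V → ℕ) → E d}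

/-- The `L²` norm of a finite element function controls its values and its gradient. -/
lemma IsMesh.exists_inverse_estimate [Fintype V] [Fintype J] (hT : T.IsMesh m B a) (k : ℕ) :
    ∃ C : ℝ, 0 ≤ C ∧ ∀ v : E d → E d, T.IsVecFE m a k v → ∀ j,
      (∀ x ∈ refSimplex d, ‖v (T.Psi m a j x)‖ ≤ C * √(∫ y in T.domain m a, ‖v y‖ ^ 2)) ∧
      ∀ x ∈ openSimplex d,
        ‖grad v (T.Psi m a j x)‖ ≤ C * √(∫ y in T.domain m a, ‖v y‖ ^ 2) := by
  have hw : ∀ j, Continuous fun x => |(fderiv ℝ (T.Psi m a j) x).det| := fun j =>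
    (ContinuousLinearMap.continuous_det.comp (continuous_fderiv_Psi j)).abs
  choose C hC hCP using fun j => exists_polynomial_estimate k (hw j)
    fun x hx => abs_pos.2 (hT.nondegenerate j x hx)
  have hinv : ∀ j, ∃ I : ℝ, ∀ x ∈ refSimplex d, ‖(fderiv ℝ (T.Psi m a j) x).inverse‖ ≤ I :=
    fun j => isCompact_refSimplex.exists_bound_of_continuousOn (hT.continuousOn_inverse_fderiv j)
  choose I hI using hinv
  set K : ℝ := ∑ j, d * (C j * (1 + |I j|)) with hK
  have hKj : ∀ j, d * (C j * (1 + |I j|)) ≤ K := fun j =>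
    Finset.single_le_sum (f := fun j => d * (C j * (1 + |I j|)))
      (fun j _ => mul_nonneg (Nat.cast_nonneg _) (mul_nonneg (hC j) (by positivity)))
      (Finset.mem_univ j)
  refine ⟨K, Finset.sum_nonneg fun j _ =>
    mul_nonneg (Nat.cast_nonneg _) (mul_nonneg (hC j) (by positivity)), fun v hv j => ?_⟩
  have hvs := hv.piecewiseSmooth
  set N := √(∫ y in T.domain m a, ‖v y‖ ^ 2) with hN
  have hN0 : 0 ≤ N := Real.sqrt_nonneg _
  choose P hP hPv using fun i => (hv i).2 j
  beta_reduce at hPv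
  -- the norm over the cell is at most the norm over the domain
  have hcell : ∀ i, √(∫ x in refSimplex d, |(fderiv ℝ (T.Psi m a j) x).det| *
      MvPolynomial.eval (fun i => x i) (P i) ^ 2) ≤ N := by
    intro i
    refine Real.sqrt_le_sqrt ?_
    choose p hp hpv using hvs
    have h1 := (hT.integral_domain (f := fun y => ‖v y‖ ^ 2) (g := fun j x => ‖p j x‖ ^ 2)
      (fun j => ((hp j).continuous.norm.pow 2).continuousOn)
      fun j x hx => by rw [hpv j x (openSimplex_subset hx)]).2
    rw [h1]
    refine le_trans ?_ (Finset.single_le_sum (f := fun j => ∫ x in openSimplex d,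
      |(fderiv ℝ (T.Psi m a j) x).det| • ‖p j x‖ ^ 2) (fun j _ => ?_) (Finset.mem_univ j))
    · have hae : openSimplex d =ᵐ[volume] refSimplex d :=
        openSimplex_subset.eventuallyLE.antisymm (ae_le_set.2 volume_refSimplex_diff_openSimplex)
      rw [← setIntegral_congr_set hae]
      have hPc : Continuous fun x : E d => MvPolynomial.eval (fun i => x i) (P i) :=
        (contDiff_eval (n := 1) (P i)).continuous
      refine setIntegral_mono_on ?_ ?_ isOpen_openSimplex.measurableSet fun x hx => ?_
      · exact (((hw j).mul (hPc.pow 2)).continuousOn.integrableOn_compact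
          isCompact_refSimplex).mono_set openSimplex_subset
      · exact (((hw j).mul ((hp j).continuous.norm.pow 2)).continuousOn.integrableOn_compact
          isCompact_refSimplex).mono_set openSimplex_subset
      · refine mul_le_mul_of_nonneg_left ?_ (abs_nonneg _)
        rw [← hPv i x (openSimplex_subset hx), ← hpv j x (openSimplex_subset hx), ← sq_abs]
        have h2 := PiLp.norm_apply_le (v (T.Psi m a j x)) i
        rw [Real.norm_eq_abs] at h2
        exact pow_le_pow_left₀ (abs_nonneg _) h2 2
    · exact integral_nonneg fun x => mul_nonneg (abs_nonneg _) (sq_nonneg _)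
  constructor
  · intro x hx
    refine (norm_le_sum_abs _).trans ?_
    calc ∑ i, |v (T.Psi m a j x) i| ≤ ∑ _i : Fin d, C j * N := by
          refine Finset.sum_le_sum fun i _ => ?_
          rw [hPv i x hx]
          exact ((hCP j (P i) (hP i) x hx).1).trans (mul_le_mul_of_nonneg_left (hcell i) (hC j))
      _ = d * (C j * 1) * N := by simp; ring
      _ ≤ d * (C j * (1 + |I j|)) * N := by
          have := hC j
          have := abs_nonneg (I j)
          gcongr
          linarith
      _ ≤ K * N := mul_le_mul_of_nonneg_right (hKj j) hN0
  · intro x hx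
    have hx' := openSimplex_subset hx
    refine ContinuousLinearMap.opNorm_le_bound _ (mul_nonneg (le_trans (mul_nonneg
      (Nat.cast_nonneg _) (mul_nonneg (hC j) (by positivity))) (hKj j)) hN0) fun z => ?_
    refine (norm_le_sum_abs _).trans ?_
    calc ∑ i, |(grad v (T.Psi m a j x) z) i| ≤ ∑ _i : Fin d, C j * N * |I j| * ‖z‖ := by
          refine Finset.sum_le_sum fun i _ => ?_
          have hfd := hT.hasFDerivAt (f := fun y => v y i) (contDiff_eval (P i))
            (fun x hx => hPv i x (openSimplex_subset hx)) hx
          rw [grad, ← fderiv_apply_coord (hvs.differentiableAt hT j hx), hfd.fderiv,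
            ← Real.norm_eq_abs]
          refine (ContinuousLinearMap.le_opNorm _ _).trans
            (mul_le_mul_of_nonneg_right ?_ (norm_nonneg _))
          refine (ContinuousLinearMap.opNorm_comp_le _ _).trans ?_
          refine mul_le_mul ?_ ((hI j x hx').trans (le_abs_self _)) (norm_nonneg _)
            (mul_nonneg (hC j) hN0)
          exact ((hCP j (P i) (hP i) x hx').2).trans (mul_le_mul_of_nonneg_left (hcell i) (hC j))
      _ = d * (C j * |I j|) * N * ‖z‖ := by simp; ring
      _ ≤ d * (C j * (1 + |I j|)) * N * ‖z‖ := by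
          have := hC j
          gcongr
          linarith
      _ ≤ K * N * ‖z‖ := by
          gcongr
          exact hKj j

end Connectivity

end

/-! ### The surface measure of boundary faces -/

section

variable {d m : ℕ} {V J : Type*}

lemma sum_bary (x : E d) : ∑ k, bary x k = 1 := by
  rw [Fin.sum_univ_succ]
  simp [bary]

/-- The vertices `0, e_1, …, e_d` of the reference simplex. -/
def vertex (k : Fin (d + 1)) : E d := Fin.cases 0 (fun i => e i) k

lemma sum_bary_smul_vertex (x : E d) : ∑ k, bary x k • vertex k = x := by
  rw [Fin.sum_univ_succ]
  simp [bary, vertex, sum_smul_e]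

/-- The affine parametrization of the face of the reference simplex opposite to the vertex `k`. -/
def faceMap (k : Fin (d + 2)) (y : E d) : E (d + 1) := ∑ l, bary y l • vertex (k.succAbove l)

lemma contDiff_faceMap (k : Fin (d + 2)) : ContDiff ℝ 1 (faceMap k : E d → E (d + 1)) :=
  ContDiff.sum fun l _ => (contDiff_bary l).smul contDiff_const

lemma subset_image_faceMap (k : Fin (d + 2)) :
    {x | x ∈ refSimplex (d + 1) ∧ bary x k = 0} ⊆ faceMap k '' refSimplex d := by
  rintro x ⟨hx, hk⟩
  set y : E d := WithLp.toLp 2 fun i => bary x (k.succAbove i.succ)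
  have hsum : ∑ l, bary x (k.succAbove l) = 1 := by
    have := sum_bary x
    rwa [Fin.sum_univ_succAbove _ k, hk, zero_add] at this
  have hy : ∀ l, bary y l = bary x (k.succAbove l) := by
    intro l
    refine Fin.cases ?_ (fun i => ?_) l
    · rw [Fin.sum_univ_succ] at hsum
      simp only [bary, Fin.cons_zero, y]
      simp only [bary] at hsum
      linarith
    · simp [bary, y]
  refine ⟨y, ⟨fun i => bary_nonneg hx _, ?_⟩, ?_⟩
  · have h0 : 0 ≤ bary y 0 := by rw [hy]; exact bary_nonneg hx _
    simp only [bary, Fin.cons_zero] at h0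
    linarith
  · conv_rhs => rw [← sum_bary_smul_vertex x, Fin.sum_univ_succAbove _ k, hk, zero_smul, zero_add]
    exact Finset.sum_congr rfl fun l _ => by rw [hy]

namespace Connectivity

variable {T : Connectivity d V J} {a : (V → ℕ) → E d} {S : Finset (Finset V)}

lemma faceSet_eq_iUnion : T.faceSet m a S = ⋃ F ∈ S, ⋃ j,
    {x | (F : Set V) ⊆ Set.range (T.vert j) ∧ x ∈ T.Psi m a j ''
      (refSimplex d ∩ ⋂ k, {x | T.vert j k ∉ F → bary x k = 0})} := by
  ext y
  simp only [faceSet, mem_iUnion]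
  constructor
  · rintro ⟨F, hF, j, hj, x, hx, hxF, rfl⟩
    exact ⟨F, hF, j, hj, x, ⟨hx, mem_iInter.2 hxF⟩, rfl⟩
  · rintro ⟨F, hF, j, hj, x, ⟨hx, hxF⟩, rfl⟩
    exact ⟨F, hF, j, hj, x, hx, mem_iInter.1 hxF, rfl⟩

lemma measurableSet_faceSet [Finite J] : MeasurableSet (T.faceSet m a S) := by
  rw [faceSet_eq_iUnion]
  have := Finite.to_countable (α := J)
  refine Finset.measurableSet_biUnion _ fun F _ => MeasurableSet.iUnion fun j => ?_
  refine (MeasurableSet.const _).inter (IsCompact.measurableSet ?_)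
  refine (isCompact_refSimplex.inter_right (isClosed_iInter fun k => ?_)).image
    (T.contDiff_Psi (n := 1) a j).continuous
  by_cases hk : T.vert j k ∈ F
  · simp [hk]
  · simp only [hk, not_false_eq_true, forall_true_left]
    exact isClosed_eq (contDiff_bary (n := 0) k).continuous continuous_const

lemma faceSet_subset_domain : T.faceSet m a S ⊆ T.domain m a := by
  rintro y ⟨F, -, j, -, x, hx, -, rfl⟩
  exact mem_domain hx

/-- The boundary faces have finite area. -/
lemma surfaceMeasure_faceSet_lt_top [Finite J] (hd : 0 < d) (hS : ∀ F ∈ S, F.card = d) :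
    surfaceMeasure d (T.faceSet m a S) < ∞ := by
  classical
  obtain ⟨d, rfl⟩ := Nat.exists_eq_succ_of_ne_zero hd.ne'
  have := Fintype.ofFinite J
  have hsub : T.faceSet m a S ⊆ ⋃ j, ⋃ k : Fin (d + 2),
      (T.Psi m a j ∘ faceMap k) '' refSimplex d := by
    rintro y ⟨F, hF, j, -, x, hx, hxF, rfl⟩
    obtain ⟨k, hk⟩ : ∃ k, T.vert j k ∉ F := by
      by_contra! hcon
      have h1 : (Finset.univ.image (T.vert j)).card ≤ F.card :=
        Finset.card_le_card fun v hv => by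
          obtain ⟨k, -, rfl⟩ := Finset.mem_image.1 hv
          exact hcon k
      rw [Finset.card_image_of_injective _ (T.vert_injective j), hS F hF] at h1
      simp at h1
    obtain ⟨z, hz, hzx⟩ := subset_image_faceMap k ⟨hx, hxF k hk⟩
    exact mem_iUnion.2 ⟨j, mem_iUnion.2 ⟨k, z, hz, by rw [Function.comp_apply, hzx]⟩⟩
  refine (measure_mono hsub).trans_lt ?_
  refine (measure_iUnion_fintype_le _ _).trans_lt (ENNReal.sum_lt_top.2 fun j _ => ?_)
  refine (measure_iUnion_fintype_le _ _).trans_lt (ENNReal.sum_lt_top.2 fun k _ => ?_)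
  rw [surfaceMeasure, Measure.euclideanHausdorffMeasure_def, Measure.smul_apply]
  refine ENNReal.mul_lt_top ENNReal.coe_lt_top ?_
  obtain ⟨L, hL⟩ := ((T.contDiff_Psi a j).comp (contDiff_faceMap k)).contDiffOn
    |>.exists_lipschitzOnWith one_ne_zero convex_refSimplex isCompact_refSimplex
  refine (hL.hausdorffMeasure_image_le (by positivity)).trans_lt (ENNReal.mul_lt_top ?_ ?_)
  · exact ENNReal.rpow_lt_top_of_nonneg (by positivity) ENNReal.coe_ne_top
  · have : (μH[((d + 1 - 1 : ℕ) : ℝ)] : Measure (E d)) = μH[(d : ℝ)] := by simp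
    rw [this]
    exact isCompact_refSimplex.measure_lt_top

end Connectivity

/-- The Cauchy–Schwarz inequality in `L²`. -/
lemma abs_integral_inner_le {α : Type*} [MeasurableSpace α] {μ : Measure α} {f g : α → E d}
    (hf : MemLp f 2 μ) (hg : MemLp g 2 μ) {G : ℝ≥0} (hG : eLpNorm f 2 μ ≤ G) :
    |∫ x, (inner ℝ (f x) (g x) : ℝ) ∂μ| ≤ G * √(∫ x, ‖g x‖ ^ 2 ∂μ) := by
  have h1 : ∀ {f g : α → E d} (hf : MemLp f 2 μ) (hg : MemLp g 2 μ),
      (inner ℝ (hf.toLp f) (hg.toLp g) : ℝ) = ∫ x, (inner ℝ (f x) (g x) : ℝ) ∂μ := by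
    intro f g hf hg
    rw [L2.inner_def]
    refine integral_congr_ae ?_
    filter_upwards [hf.coeFn_toLp, hg.coeFn_toLp] with x h1 h2
    rw [h1, h2]
  have h2 : ‖hg.toLp g‖ = √(∫ x, ‖g x‖ ^ 2 ∂μ) := by
    rw [norm_eq_sqrt_real_inner, h1]
    simp only [real_inner_self_eq_norm_sq]
  have h3 : ‖hf.toLp f‖ ≤ G := by
    rw [Lp.norm_toLp]
    exact ENNReal.toReal_le_coe_of_le_coe hG
  rw [← h1 hf hg, ← h2]
  exact (abs_real_inner_le_norm _ _).trans (mul_le_mul_of_nonneg_right h3 (norm_nonneg _))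

end

/-! ### The uniform bound -/

section

variable {d m : ℕ} {V J JF JS : Type*}

namespace Connectivity

variable [Fintype V] [Fintype J] {T : Connectivity d V J} {B : Finset (Finset V)}
  {a : (V → ℕ) → E d}

lemma PiecewiseSmooth.memLp_two (hT : T.IsMesh m B a) {u : E d → E d}
    (hu : T.PiecewiseSmooth m a u) : MemLp u 2 (volume.restrict (T.domain m a)) :=
  (memLp_two_iff_integrable_sq_norm
    (hu.piecewiseContinuous.integrableOn hT).aestronglyMeasurable).2 (hu.integrableOn_normSq hT)

/-- A convex strain energy grows at least like a linear function, so that the elastic energy is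
bounded below in terms of a bound of the deformation gradient. -/
lemma PiecewiseSmooth.neg_le_integral_of_convexOn (hT : T.IsMesh m B a)
    {W : (E d →L[ℝ] E d) → ℝ} (hW : ConvexOn ℝ univ W) (hWd : Differentiable ℝ W)
    {φ : E d → E d} (hφ : T.PiecewiseSmooth m a φ) {R : ℝ}
    (hR : ∀ j, ∀ x ∈ openSimplex d, ‖grad φ (T.Psi m a j x)‖ ≤ R) :
    -(volume.real (T.domain m a) * (|W 0| + ‖fderiv ℝ W 0‖ * R)) ≤
      ∫ x in T.domain m a, W (grad φ x) := by
  have hfin : volume (T.domain m a) ≠ ∞ := isCompact_domain.measure_lt_top.ne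
  have h1 : ∫ _x in T.domain m a, -(|W 0| + ‖fderiv ℝ W 0‖ * R) =
      -(volume.real (T.domain m a) * (|W 0| + ‖fderiv ℝ W 0‖ * R)) := by
    rw [setIntegral_const, smul_eq_mul, mul_neg]
  rw [← h1]
  refine integral_mono_ae (integrableOn_const hfin)
    (((hφ.piecewiseContinuous_fderiv hT).comp hWd.continuous).integrableOn hT) ?_
  refine ae_restrict_domain fun j x hx => ?_
  have h2 := hW.fderiv_apply_le hWd 0 (grad φ (T.Psi m a j x))
  rw [zero_add] at h2
  have h3 := (fderiv ℝ W 0).le_opNorm (grad φ (T.Psi m a j x))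
  have h4 := mul_le_mul_of_nonneg_left (hR j x hx) (norm_nonneg (fderiv ℝ W 0))
  rw [Real.norm_eq_abs] at h3
  have h5 := neg_abs_le (fderiv ℝ W 0 (grad φ (T.Psi m a j x)))
  have h6 := neg_abs_le (W 0)
  change -(|W 0| + ‖fderiv ℝ W 0‖ * R) ≤ W (grad φ (T.Psi m a j x))
  linarith

/-- By convexity, the elastic energy along a segment of deformations is controlled by its values at
the end points. -/
lemma PiecewiseSmooth.integral_add_smul_le (hT : T.IsMesh m B a)
    {W : (E d →L[ℝ] E d) → ℝ} (hW : ConvexOn ℝ univ W) (hWd : Differentiable ℝ W)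
    {φ v : E d → E d} (hφ : T.PiecewiseSmooth m a φ) (hv : T.PiecewiseSmooth m a v) {τ t : ℝ}
    (hτ : 0 ≤ τ) (hτt : τ ≤ t) :
    ∫ x in T.domain m a, W (grad (fun y => φ y + τ • v y) x) ≤
      |∫ x in T.domain m a, W (grad φ x)| +
        |∫ x in T.domain m a, W (grad (fun y => φ y + t • v y) x)| := by
  rcases hτ.eq_or_lt with rfl | hpos
  · simp only [zero_smul, add_zero]
    exact (le_abs_self _).trans (le_add_of_nonneg_right (abs_nonneg _))
  have ht : 0 < t := hpos.trans_le hτt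
  set θ := τ / t
  have hθ0 : 0 ≤ θ := div_nonneg hτ ht.le
  have hθ1 : θ ≤ 1 := (div_le_one ht).2 hτt
  have hψ : ∀ r : ℝ, T.PiecewiseSmooth m a fun y => φ y + r • v y := fun r =>
    (hφ.prodMk hv).comp (φ := fun q : E d × E d => q.1 + r • q.2) (by fun_prop)
  have hi : ∀ {ψ}, T.PiecewiseSmooth m a ψ →
      IntegrableOn (fun x => W (grad ψ x)) (T.domain m a) := fun h =>
    ((h.piecewiseContinuous_fderiv hT).comp hWd.continuous).integrableOn hT
  have hgrad : ∀ r : ℝ, ∀ j, ∀ x ∈ openSimplex d, grad (fun y => φ y + r • v y) (T.Psi m a j x) =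
      grad φ (T.Psi m a j x) + r • grad v (T.Psi m a j x) := by
    intro r j x hx
    have d1 := hφ.differentiableAt hT j hx
    have d2 := hv.differentiableAt hT j hx
    simp only [grad]
    rw [fderiv_fun_add d1 (d2.fun_const_smul r), fderiv_fun_const_smul d2]
  have hle : ∫ x in T.domain m a, W (grad (fun y => φ y + τ • v y) x) ≤
      (1 - θ) * (∫ x in T.domain m a, W (grad φ x)) +
        θ * ∫ x in T.domain m a, W (grad (fun y => φ y + t • v y) x) := by
    rw [← integral_const_mul, ← integral_const_mul,
      ← integral_add ((hi hφ).const_mul _) ((hi (hψ t)).const_mul _)]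
    refine integral_mono_ae (hi (hψ τ)) (((hi hφ).const_mul _).add ((hi (hψ t)).const_mul _)) ?_
    refine ae_restrict_domain fun j x hx => ?_
    beta_reduce
    rw [hgrad τ j x hx, hgrad t j x hx]
    have := hW.2 (mem_univ (grad φ (T.Psi m a j x)))
      (mem_univ (grad φ (T.Psi m a j x) + t • grad v (T.Psi m a j x)))
      (sub_nonneg.2 hθ1) hθ0 (sub_add_cancel 1 θ)
    refine le_of_eq_of_le (congrArg W ?_) this
    have hτθ : τ = θ * t := (div_mul_cancel₀ τ ht.ne').symm
    rw [hτθ]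
    module
  refine hle.trans (add_le_add ?_ ?_)
  · refine (mul_le_mul_of_nonneg_left (le_abs_self _) (sub_nonneg.2 hθ1)).trans ?_
    exact mul_le_of_le_one_left (abs_nonneg _) (by linarith)
  · refine (mul_le_mul_of_nonneg_left (le_abs_self _) hθ0).trans ?_
    exact mul_le_of_le_one_left (abs_nonneg _) hθ1

end Connectivity

/-- The elementary bound which replaces a discrete Gronwall inequality: the maximum `y` of the
energy norms satisfies `y² ≤ A + b y`. -/
lemma le_of_sq_le_add_mul {A b y : ℝ} (hb : 0 ≤ b) (h : y ^ 2 ≤ A + b * y) : y ≤ 1 + |A| + b := by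
  by_contra! hlt
  have h1 := le_abs_self A
  have h2 := abs_nonneg A
  nlinarith

namespace Geometry

variable {M : Geometry d m V JF JS} {D : Params d} {X : Trajectory d V} {N n : ℕ}

/-- The `L²` norm over the solid domain. -/
def solidNorm (M : Geometry d m V JF JS) (v : E d → E d) : ℝ := √(∫ x in M.omegaS, ‖v x‖ ^ 2)

lemma solidNorm_sq (v : E d → E d) : M.solidNorm v ^ 2 = ∫ x in M.omegaS, ‖v x‖ ^ 2 :=
  Real.sq_sqrt (integral_nonneg fun _ => sq_nonneg _)

lemma fluidNormSq_nonneg : 0 ≤ M.fluidNormSq X n := integral_nonneg fun _ => sq_nonneg _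

lemma strainNormSq_nonneg : 0 ≤ M.strainNormSq X n :=
  integral_nonneg fun _ => Finset.sum_nonneg fun _ _ => real_inner_self_nonneg

/-- The kinetic energy norm `(ρ^f ‖u^n‖² + ρ^s ‖v^n‖²)^{1/2}`. -/
def energyNorm (M : Geometry d m V JF JS) (D : Params d) (X : Trajectory d V) (n : ℕ) : ℝ :=
  √(D.rhoF * M.fluidNormSq X n + D.rhoS * M.solidNorm (X.v n) ^ 2)

lemma energyNorm_sq : M.energyNorm D X n ^ 2 =
    D.rhoF * M.fluidNormSq X n + D.rhoS * M.solidNorm (X.v n) ^ 2 :=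
  Real.sq_sqrt (add_nonneg (mul_nonneg D.rhoF_pos.le fluidNormSq_nonneg)
    (mul_nonneg D.rhoS_pos.le (sq_nonneg _)))

lemma sqrt_fluidNormSq_le : √(M.fluidNormSq X n) ≤ (√D.rhoF)⁻¹ * M.energyNorm D X n := by
  rw [inv_mul_eq_div, le_div_iff₀ (Real.sqrt_pos.2 D.rhoF_pos), ← Real.sqrt_mul fluidNormSq_nonneg]
  refine Real.sqrt_le_sqrt ?_
  nlinarith [mul_nonneg D.rhoS_pos.le (sq_nonneg (M.solidNorm (X.v n)))]

lemma solidNorm_le : M.solidNorm (X.v n) ≤ (√D.rhoS)⁻¹ * M.energyNorm D X n := by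
  rw [inv_mul_eq_div, le_div_iff₀ (Real.sqrt_pos.2 D.rhoS_pos)]
  refine Real.le_sqrt_of_sq_le ?_
  rw [mul_pow, Real.sq_sqrt D.rhoS_pos.le]
  nlinarith [mul_nonneg D.rhoF_pos.le (fluidNormSq_nonneg (M := M) (X := X) (n := n))]

/-- The total energy splits into the kinetic, the elastic and the dissipated energy. -/
lemma totalEnergy_eq : M.totalEnergy D X n = M.energyNorm D X n ^ 2 +
    2 * (∫ x in M.omegaS, D.W (grad (X.phi (n + 1)) x)) +
    ∑ l ∈ Finset.range n, D.rhoF * D.nuF * M.strainNormSq X (l + 1) * X.dt := by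
  have h1 : M.solidEnergyAt D X n = D.rhoS / 2 * M.solidNorm (X.v n) ^ 2 +
      ∫ x in M.omegaS, D.W (grad (X.phi (n + 1)) x) := by
    rw [solidNorm_sq]
    rfl
  rw [totalEnergy, h1, energyNorm_sq]
  ring

variable [Fintype V] [Fintype JF]

/-- The gradient of the position of the solid grows at most linearly with the velocities. -/
lemma IsSolution.norm_grad_phi_le (h : M.IsSolution D X N) (hdt : 0 < X.dt) {C : ℝ}
    (hC : ∀ v : E d → E d, M.solid.IsVecFE m M.z m v → ∀ j, ∀ x ∈ openSimplex d,
      ‖grad v (M.solid.Psi m M.z j x)‖ ≤ C * M.solidNorm v) :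
    ∀ n ≤ N + 1, ∀ j, ∀ x ∈ openSimplex d, ‖grad (X.phi n) (M.solid.Psi m M.z j x)‖ ≤
      C * (M.solidNorm X.phi0 + X.dt * ∑ l ∈ Finset.range n, M.solidNorm (X.v l)) := by
  intro n
  induction n with
  | zero =>
    intro _ j x hx
    simp only [Finset.range_zero, Finset.sum_empty, mul_zero, add_zero]
    exact hC _ h.initial j x hx
  | succ n ih =>
    intro hn j x hx
    have d1 := (h.piecewiseSmooth_phi n (by omega)).differentiableAt M.solid_isMesh j hx
    have d2 := (h.piecewiseSmooth_v (n := n) (by omega)).differentiableAt M.solid_isMesh j hx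
    have h1 : grad (X.phi (n + 1)) (M.solid.Psi m M.z j x) =
        grad (X.phi n) (M.solid.Psi m M.z j x) + X.dt • grad (X.v n) (M.solid.Psi m M.z j x) := by
      simp only [grad, Trajectory.phi]
      rw [fderiv_fun_add d1 (d2.fun_const_smul X.dt), fderiv_fun_const_smul d2]
    rw [h1, Finset.sum_range_succ]
    refine (norm_add_le _ _).trans ?_
    rw [norm_smul, Real.norm_of_nonneg hdt.le]
    have h2 := mul_le_mul_of_nonneg_left (hC _ (h.mem n (by omega)).2.2.1 j x hx) hdt.le
    have h3 := ih (by omega) j x hx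
    linarith

variable [Fintype JS]

/-- The power of the forces is controlled by the kinetic energy norm. -/
lemma exists_power_le (hd : 0 < d) (M : Geometry d m V JF JS) (D : Params d) (G : ℝ≥0) :
    ∃ C : ℝ, 0 ≤ C ∧ ∀ (X : Trajectory d V) (N : ℕ), 0 < X.dt → M.IsSolution D X N →
      M.CollisionFree X N → M.ForcesL2 D X N → M.ForcesBoundedBy D X N G →
      ∀ n < N, M.power D X (n + 1) ≤ C * M.energyNorm D X (n + 1) := by
  obtain ⟨C, hC, hCv⟩ := M.solid_isMesh.exists_inverse_estimate m
  have hfin : surfaceMeasure d M.tractionBoundary < ∞ :=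
    Connectivity.surfaceMeasure_faceSet_lt_top hd fun F hF =>
      (M.solid_face F ((M.mem_solidBoundary F).2 (Or.inr (Or.inr hF)))).1
  set A := (surfaceMeasure d).real M.tractionBoundary with hA
  refine ⟨D.rhoF * (G * (√D.rhoF)⁻¹) + D.rhoS * (G * (√D.rhoS)⁻¹) +
    G * (√A * (C * (√D.rhoS)⁻¹)), ?_, ?_⟩
  · have := D.rhoF_pos
    have := D.rhoS_pos
    positivity
  intro X N hdt h hcf hL2 hG n hn
  have hT := hcf.isMesh_new hdt hn
  have su := (h.mem (n + 1) hn).1.piecewiseSmooth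
  have hvFE := (h.mem (n + 1) hn).2.2.1
  have sv := h.piecewiseSmooth_v (n := n + 1) hn
  obtain ⟨l1, l2, l3⟩ := hL2 n hn
  obtain ⟨g1, g2, g3⟩ := hG n hn
  have hY : 0 ≤ M.energyNorm D X (n + 1) := Real.sqrt_nonneg _
  have b1 : ∫ x in M.omegaF (X.a (n + 1)),
      (inner ℝ (D.rhoF • D.gF (X.time (n + 1)) x) (X.u (n + 1) x) : ℝ) ≤
      D.rhoF * (G * ((√D.rhoF)⁻¹ * M.energyNorm D X (n + 1))) := by
    simp only [inner_smul_left, conj_trivial]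
    rw [integral_const_mul]
    refine mul_le_mul_of_nonneg_left ((le_abs_self _).trans ?_) D.rhoF_pos.le
    exact (abs_integral_inner_le l1 (su.memLp_two hT) g1).trans
      (mul_le_mul_of_nonneg_left sqrt_fluidNormSq_le G.2)
  have b2 : ∫ x in M.omegaS,
      (inner ℝ (D.rhoS • D.gS (X.time (n + 1)) x) (X.v (n + 1) x) : ℝ) ≤
      D.rhoS * (G * ((√D.rhoS)⁻¹ * M.energyNorm D X (n + 1))) := by
    simp only [inner_smul_left, conj_trivial]
    rw [integral_const_mul]
    refine mul_le_mul_of_nonneg_left ((le_abs_self _).trans ?_) D.rhoS_pos.le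
    exact (abs_integral_inner_le l2 (sv.memLp_two M.solid_isMesh) g2).trans
      (mul_le_mul_of_nonneg_left solidNorm_le G.2)
  -- on `Σ_4`, the velocity is bounded by its norm over the solid domain
  have hmeas : MeasurableSet M.tractionBoundary := Connectivity.measurableSet_faceSet
  have hvc : ContinuousOn (X.v (n + 1)) M.tractionBoundary := by
    have hc : ContinuousOn (X.v (n + 1)) M.omegaS := by
      have : ContinuousOn (fun x => WithLp.toLp 2 fun i => X.v (n + 1) x i) M.omegaS :=
        (PiLp.continuous_toLp 2 _).comp_continuousOn (continuousOn_pi.2 fun i => (hvFE i).1)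
      exact this
    exact hc.mono Connectivity.faceSet_subset_domain
  have hvb : ∀ x ∈ M.tractionBoundary, ‖X.v (n + 1) x‖ ≤ C * M.solidNorm (X.v (n + 1)) := by
    rintro x ⟨F, -, j, -, z, hz, -, rfl⟩
    exact (hCv _ hvFE j).1 z hz
  have hvae : ∀ᵐ x ∂(surfaceMeasure d).restrict M.tractionBoundary,
      ‖X.v (n + 1) x‖ ≤ C * M.solidNorm (X.v (n + 1)) := by
    filter_upwards [ae_restrict_mem hmeas] with x hx using hvb x hx
  have hfinm : IsFiniteMeasure ((surfaceMeasure d).restrict M.tractionBoundary) :=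
    ⟨by rwa [Measure.restrict_apply_univ]⟩
  have hvL : MemLp (X.v (n + 1)) 2 ((surfaceMeasure d).restrict M.tractionBoundary) :=
    MemLp.of_bound (hvc.aestronglyMeasurable hmeas) _ hvae
  have hvn : √(∫ x in M.tractionBoundary, ‖X.v (n + 1) x‖ ^ 2 ∂(surfaceMeasure d)) ≤
      √A * (C * ((√D.rhoS)⁻¹ * M.energyNorm D X (n + 1))) := by
    have hle : C * M.solidNorm (X.v (n + 1)) ≤
        C * ((√D.rhoS)⁻¹ * M.energyNorm D X (n + 1)) :=
      mul_le_mul_of_nonneg_left solidNorm_le hC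
    have h0 : 0 ≤ C * M.solidNorm (X.v (n + 1)) := mul_nonneg hC (Real.sqrt_nonneg _)
    refine le_trans ?_ (mul_le_mul_of_nonneg_left hle (Real.sqrt_nonneg _))
    rw [← Real.sqrt_sq h0, ← Real.sqrt_mul measureReal_nonneg]
    refine Real.sqrt_le_sqrt ?_
    have h1 : ∫ _x in M.tractionBoundary, (C * M.solidNorm (X.v (n + 1))) ^ 2
        ∂(surfaceMeasure d) = A * (C * M.solidNorm (X.v (n + 1))) ^ 2 := by
      rw [setIntegral_const, smul_eq_mul]
    rw [← h1]
    refine integral_mono_ae (memLp_two_iff_integrable_sq_norm hvL.1 |>.1 hvL)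
      (integrable_const _) ?_
    filter_upwards [hvae] with x hx
    exact pow_le_pow_left₀ (norm_nonneg _) hx 2
  have b3 : ∫ x in M.tractionBoundary,
      (inner ℝ (D.sigmaBS (X.time (n + 1)) x) (X.v (n + 1) x) : ℝ) ∂(surfaceMeasure d) ≤
      G * (√A * (C * ((√D.rhoS)⁻¹ * M.energyNorm D X (n + 1)))) :=
    (le_abs_self _).trans ((abs_integral_inner_le l3 hvL g3).trans
      (mul_le_mul_of_nonneg_left hvn G.2))
  rw [power]
  linarith

/-- The total energy is bounded in terms of the data, uniformly in the motion of the fluid mesh. -/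
lemma exists_totalEnergy_bound (hd : 0 < d) (M : Geometry d m V JF JS) (D : Params d)
    (hW : ConvexOn ℝ univ D.W) (phi0 v0 : E d → E d) (T K : ℝ) (G : ℝ≥0) :
    ∃ C : ℝ, ∀ (X : Trajectory d V) (N : ℕ), 0 < X.dt → M.IsSolution D X N →
      M.CollisionFree X N → M.ForcesL2 D X N → M.ForcesBoundedBy D X N G →
      X.phi0 = phi0 → X.v 0 = v0 → D.rhoF * M.fluidNormSq X 0 ≤ K → X.time N ≤ T →
      (∀ n ≤ N, M.totalEnergy D X n ≤
        M.totalEnergy D X 0 + 2 * X.dt * ∑ l ∈ Finset.range n, M.power D X (l + 1)) →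
      ∀ n, 1 ≤ n → n ≤ N → |M.totalEnergy D X n| ≤ C := by
  obtain ⟨C₁, hC₁, hpow⟩ := exists_power_le hd M D G
  obtain ⟨C₂, hC₂, hinv⟩ := M.solid_isMesh.exists_inverse_estimate m
  have hrs : 0 ≤ (√D.rhoS)⁻¹ := by positivity
  -- the bound of the initial energy
  set Q₀ := D.rhoS * M.solidNorm v0 ^ 2 + 2 * (|∫ x in M.omegaS, D.W (grad phi0 x)| +
    |∫ x in M.omegaS, D.W (grad (fun y => phi0 y + T • v0 y) x)|) + K with hQ₀
  -- the elastic energy is at least `-(E₀ + E₁ max_n energyNorm)`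
  set vol := volume.real M.omegaS with hvol
  have hvol0 : 0 ≤ vol := measureReal_nonneg
  set W₁ := ‖fderiv ℝ D.W 0‖ with hW₁
  have hW₁0 : 0 ≤ W₁ := norm_nonneg (fderiv ℝ D.W 0)
  set E₀ := vol * (|D.W 0| + W₁ * (C₂ * M.solidNorm phi0)) with hE₀
  set E₁ := vol * (W₁ * (C₂ * (2 * |T| * (√D.rhoS)⁻¹))) with hE₁
  have hE₁0 : 0 ≤ E₁ := by positivity
  set b := 2 * |T| * C₁ + 2 * E₁ with hb
  have hb0 : 0 ≤ b := by positivity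
  set R := 1 + |Q₀ + 2 * E₀| + b with hR
  refine ⟨|Q₀| + 2 * |T| * C₁ * R + 2 * (|E₀| + E₁ * R), ?_⟩
  intro X N hdt h hcf hL2 hG hphi0 hv0 hK hTN henergy n hn1 hnN
  subst hphi0 hv0
  have hN : 1 ≤ N := hn1.trans hnN
  have hdtT : X.dt * N ≤ T := by rw [mul_comm]; exact hTN
  have hNr : (1 : ℝ) ≤ N := by exact_mod_cast hN
  have hdtT1 : X.dt ≤ T := by nlinarith
  have hT0 : 0 < T := hdt.trans_le hdtT1
  rw [abs_of_pos hT0] at *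
  -- by convexity, the energy at `φ⁰ + Δt v⁰` is controlled by those at `φ⁰` and `φ⁰ + T v⁰`
  have hQ : M.totalEnergy D X 0 ≤ Q₀ := by
    have h1 := (h.piecewiseSmooth_phi 0 (by omega)).integral_add_smul_le M.solid_isMesh hW
      D.W_differentiable (h.piecewiseSmooth_v (n := 0) (by omega)) hdt.le hdtT1
    have h2 : M.totalEnergy D X 0 = D.rhoF * M.fluidNormSq X 0 +
        D.rhoS * M.solidNorm (X.v 0) ^ 2 + 2 * ∫ x in M.omegaS,
          D.W (grad (fun y => X.phi 0 y + X.dt • X.v 0 y) x) := by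
      rw [totalEnergy_eq, energyNorm_sq]
      simp [Trajectory.phi]
    rw [h2, hQ₀]
    have h3 : ∫ x in M.omegaS, D.W (grad (fun y => X.phi 0 y + X.dt • X.v 0 y) x) ≤
      |∫ x in M.omegaS, D.W (grad X.phi0 x)| +
      |∫ x in M.omegaS, D.W (grad (fun y => X.phi0 y + T • X.v 0 y) x)| := h1
    linarith
  -- the largest kinetic energy norm
  obtain ⟨l₀, hl₀, hmax⟩ := (Finset.range (N + 1)).exists_max_image (M.energyNorm D X)
    ⟨0, by simp⟩
  set Y := M.energyNorm D X l₀ with hY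
  have hY0 : 0 ≤ Y := Real.sqrt_nonneg _
  have hYl : ∀ l ≤ N, M.energyNorm D X l ≤ Y := fun l hl => hmax l (by simp; omega)
  have hel : ∀ k ≤ N, -(E₀ + E₁ * Y) ≤ ∫ x in M.omegaS, D.W (grad (X.phi (k + 1)) x) := by
    intro k hk
    have h1 := h.norm_grad_phi_le hdt (fun v hv j => (hinv v hv j).2) (k + 1) (by omega)
    have hsum : X.dt * ∑ l ∈ Finset.range (k + 1), M.solidNorm (X.v l) ≤
        2 * T * (√D.rhoS)⁻¹ * Y := by
      have h2 : ∑ l ∈ Finset.range (k + 1), M.solidNorm (X.v l) ≤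
          (k + 1 : ℕ) * ((√D.rhoS)⁻¹ * Y) := by
        refine (Finset.sum_le_card_nsmul _ _ ((√D.rhoS)⁻¹ * Y) fun l hl => ?_).trans_eq
          (by rw [Finset.card_range, nsmul_eq_mul])
        exact solidNorm_le.trans (mul_le_mul_of_nonneg_left
          (hYl l (by have := Finset.mem_range.1 hl; omega)) hrs)
      have h3 : X.dt * (k + 1 : ℕ) ≤ 2 * T := by
        have : (k : ℝ) ≤ N := by exact_mod_cast hk
        push_cast
        nlinarith
      calc X.dt * ∑ l ∈ Finset.range (k + 1), M.solidNorm (X.v l)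
          ≤ X.dt * ((k + 1 : ℕ) * ((√D.rhoS)⁻¹ * Y)) := mul_le_mul_of_nonneg_left h2 hdt.le
        _ = X.dt * (k + 1 : ℕ) * ((√D.rhoS)⁻¹ * Y) := by ring
        _ ≤ 2 * T * ((√D.rhoS)⁻¹ * Y) := mul_le_mul_of_nonneg_right h3 (mul_nonneg hrs hY0)
        _ = _ := by ring
    have h4 : ∀ j, ∀ x ∈ openSimplex d, ‖grad (X.phi (k + 1)) (M.solid.Psi m M.z j x)‖ ≤
        C₂ * (M.solidNorm X.phi0 + 2 * T * (√D.rhoS)⁻¹ * Y) := fun j x hx =>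
      (h1 j x hx).trans (mul_le_mul_of_nonneg_left (by linarith) hC₂)
    refine le_of_eq_of_le ?_ ((h.piecewiseSmooth_phi (k + 1) (by omega)).neg_le_integral_of_convexOn
      M.solid_isMesh hW D.W_differentiable h4)
    rw [hE₀, hE₁, hvol]
    simp only [omegaS, ← hW₁]
    ring
  have hdiss : ∀ k, 0 ≤ ∑ l ∈ Finset.range k,
      D.rhoF * D.nuF * M.strainNormSq X (l + 1) * X.dt := fun k =>
    Finset.sum_nonneg fun l _ => mul_nonneg (mul_nonneg
      (mul_nonneg D.rhoF_pos.le D.nuF_pos.le) strainNormSq_nonneg) hdt.le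
  have hup : ∀ k ≤ N, M.totalEnergy D X k ≤ Q₀ + 2 * T * C₁ * Y := by
    intro k hk
    refine (henergy k hk).trans (add_le_add hQ ?_)
    have h2 : ∑ l ∈ Finset.range k, M.power D X (l + 1) ≤ k * (C₁ * Y) := by
      refine (Finset.sum_le_card_nsmul _ _ (C₁ * Y) fun l hl => ?_).trans_eq (by simp)
      have hl' := Finset.mem_range.1 hl
      exact (hpow X N hdt h hcf hL2 hG l (by omega)).trans
        (mul_le_mul_of_nonneg_left (hYl _ (by omega)) hC₁)
    have h3 : X.dt * k ≤ T := by
      have : (k : ℝ) ≤ N := by exact_mod_cast hk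
      nlinarith
    calc 2 * X.dt * ∑ l ∈ Finset.range k, M.power D X (l + 1)
        ≤ 2 * X.dt * (k * (C₁ * Y)) := mul_le_mul_of_nonneg_left h2 (by positivity)
      _ = 2 * (X.dt * k) * (C₁ * Y) := by ring
      _ ≤ 2 * T * (C₁ * Y) := by
          refine mul_le_mul_of_nonneg_right (by linarith) (mul_nonneg hC₁ hY0)
      _ = _ := by ring
  -- at the step `l₀`, the energy inequality reads `Y² ≤ Q₀ + 2 E₀ + b Y`
  have hYR : Y ≤ R := by
    refine le_of_sq_le_add_mul hb0 ?_
    have hl₀' : l₀ ≤ N := by simp at hl₀; omega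
    have h1 := hup l₀ hl₀'
    rw [totalEnergy_eq] at h1
    have h2 := hel l₀ hl₀'
    have h3 := hdiss l₀
    rw [hb]
    linarith
  have h1 := hup n hnN
  have h2 := hel n hnN
  have h3 := hdiss n
  have h4 : E₁ * Y ≤ E₁ * R := mul_le_mul_of_nonneg_left hYR hE₁0
  have h5 : 2 * T * C₁ * Y ≤ 2 * T * C₁ * R := mul_le_mul_of_nonneg_left hYR (by positivity)
  have h6 := le_abs_self Q₀
  have h7 := le_abs_self E₀
  have h8 : 0 ≤ |Q₀| := abs_nonneg _
  have h9 : 0 ≤ |E₀| := abs_nonneg _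
  have hR0 : 0 ≤ R := hY0.trans hYR
  have h10 : 0 ≤ E₁ * R := mul_nonneg hE₁0 hR0
  have h11 : 0 ≤ 2 * T * C₁ * R := by positivity
  rw [abs_le]
  constructor
  · rw [totalEnergy_eq]
    have := sq_nonneg (M.energyNorm D X n)
    linarith
  · linarith

end Geometry

end

end

end FSI

theorem theorem4p1 {d m : ℕ} {V JF JS : Type*} [Fintype V] [Fintype JF] [Fintype JS]
    (hd : d = 2 ∨ d = 3) (hm : 1 ≤ m) (M : FSI.Geometry d m V JF JS) (D : FSI.Params d)
    (hW : ConvexOn ℝ Set.univ D.W)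
    (huB : ∀ t x, D.uB t x = 0)
    (hsigma2 : M.sigma2 = ∅)
    (hphiB : ∀ t > 0, ∀ x ∈ M.solid.faceSet m M.z M.sigma3, HasDerivAt (fun s => D.phiB s x) 0 t) :
    (∀ (X : FSI.Trajectory d V) (N : ℕ), 0 < X.dt → M.IsSolution D X N → M.CollisionFree X N →
      M.ForcesL2 D X N →
      (∀ n < N,
        D.rhoF / (2 * X.dt) * (M.fluidNormSq X (n + 1) - M.fluidNormSq X n) +
            D.rhoF * D.nuF / 2 * M.strainNormSq X (n + 1) +
            1 / X.dt * (M.solidEnergyAt D X (n + 1) - M.solidEnergyAt D X n) ≤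
          M.power D X (n + 1)) ∧
      ∀ n ≤ N, M.totalEnergy D X n ≤
        M.totalEnergy D X 0 + 2 * X.dt * ∑ l ∈ Finset.range n, M.power D X (l + 1)) ∧
    ∀ (phi0 v0 : FSI.E d → FSI.E d) (T K : ℝ) (G : NNReal), ∃ C : ℝ,
      ∀ (X : FSI.Trajectory d V) (N : ℕ), 0 < X.dt → M.IsSolution D X N → M.CollisionFree X N →
        M.ForcesL2 D X N → M.ForcesBoundedBy D X N G →
        X.phi0 = phi0 → X.v 0 = v0 → D.rhoF * M.fluidNormSq X 0 ≤ K → X.time N ≤ T →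
        ∀ n, 1 ≤ n → n ≤ N → |M.totalEnergy D X n| ≤ C := by
  have hstep : ∀ (X : FSI.Trajectory d V) (N : ℕ), 0 < X.dt → M.IsSolution D X N →
      M.CollisionFree X N → ∀ n < N,
        D.rhoF / (2 * X.dt) * (M.fluidNormSq X (n + 1) - M.fluidNormSq X n) +
            D.rhoF * D.nuF / 2 * M.strainNormSq X (n + 1) +
            1 / X.dt * (M.solidEnergyAt D X (n + 1) - M.solidEnergyAt D X n) ≤
          M.power D X (n + 1) := fun X N hdt h hcf n hn =>
    h.energy_step hd hW huB hsigma2 hphiB hdt hcf hn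
  refine ⟨fun X N hdt h hcf _ => ⟨hstep X N hdt h hcf,
    FSI.Geometry.totalEnergy_le hdt (hstep X N hdt h hcf)⟩, fun phi0 v0 T K G => ?_⟩
  obtain ⟨C, hC⟩ := FSI.Geometry.exists_totalEnergy_bound (by omega) M D hW phi0 v0 T K G
  exact ⟨C, fun X N hdt h hcf hL2 hG hp hv hK hT => hC X N hdt h hcf hL2 hG hp hv hK hT
    (FSI.Geometry.totalEnergy_le hdt (hstep X N hdt h hcf))⟩
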